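/- All data are smooth ($C^\infty$) up to the boundary in all variables; $\dot\alpha_t$ denotes the $t$-derivative, $t\in[0,1]$. A contact form on an $n$-manifold is a $1$-form $\alpha$ with $\alpha_x\neq0$ and $d\alpha_x|_{\ker\alpha_x}$ nondegenerate for every $x$; its Reeb field $R$ is given by $\alpha(R)=1$, $\iota_Rd\alpha=0$. Manifolds are Hausdorff and second countable, hypersurfaces are embedded but not necessarily closed. \textbf{1)} Let $(\alpha_t)_{t\in[0,1]}$ be a smooth path of contact forms on an $n$-manifold $V$ (without boundary), and let $L\subset V$ be a hypersurface to which the Reeb field $R_t$ of $\alpha_t$ is nowhere tangent, for every $t$. Then there are an open neighbourhood $U$ of $L$ and a smooth family $(X_t)_{t\in[0,1]}$ of vector fields on $U$ such that $$L_{X_t}\alpha_t+\dot\alpha_t=0\quad\text{on }U\text{ for all }t\in[0,1].$$ \textbf{2)} Let $(\alpha_t)_{t\in[0,1]}$ be a smooth path of germs at $0\in\mathbb R^{2p+1}$ of contact forms such that $\ker\alpha_t(0)$ does not depend on $t$. Then these germs are isotopic: there is a smooth isotopy $(\varphi_t)_{t\in[0,1]}$ of germs at $0$ of diffeomorphisms,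 with $\varphi_0=\mathrm{id}$, $\varphi_t(0)=0$ and $\varphi_t^*\alpha_t=\alpha_0$ near $0$ for all $t\in[0,1]$. \textbf{3)} Both statements hold with parameters and in a relative version. Let $P$ be a finite-dimensional smooth manifold, possibly with boundary or corners. \emph{For 1):} Let $\alpha_{u,t}$, $(u,t)\in P\times[0,1]$, be a smooth family of contact forms on $V$, and $(L_u)_{u\in P}$ a smooth family of hypersurfaces of $V$ (that is, a subset $\mathcal L=\{(u,x):x\in L_u\}$ of $P\times V$ that is locally the zero set of a smooth function whose differential in $x$ does not vanish), such that the Reeb field of $\alpha_{u,t}$ is nowhere tangent to $L_u$. Let $A\subset P\times V$ be closed, and let a smooth solution $X^0_{u,t}$ of $L_{X^0_{u,t}}\alpha_{u,t}+\dot\alpha_{u,t}=0$ be given on an open neighbourhood $N$ of $A$ in $P\times V$. Then there are an open neighbourhood $U$ of $\mathcal L$ in $P\times V$ and a smooth solution $X_{u,t}$ of $L_{X_{u,t}}\alpha_{u,t}+\dot\alpha_{u,t}=0$ on $U$ such that $X=X^0$ on a neighbourhood of $A\cap U$. Moreover, $X_{u,t}=0$ on $U_u=\{x:(u,x)\in U\}$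 for all $t$, for every $u\in P$ such that $\alpha_{u,t}$ is independent of $t$ and $X^0_{u,t}=0$ for all $t$ on $N_u=\{x:(u,x)\in N\}$. \emph{For 2):} Let $\alpha_{u,t}$, $(u,t)\in P\times[0,1]$, be a smooth family of germs at $0\in\mathbb R^{2p+1}$ of contact forms such that, for each $u$, $\ker\alpha_{u,t}(0)$ is independent of $t$. Let $A\subset P$ be closed, and let a smooth family of isotopies $\varphi^0_{u,t}$ as in 2) be given for $u$ in an open neighbourhood $N$ of $A$. Then there is a smooth family of isotopies $\varphi_{u,t}$ as in 2), $u\in P$, which agrees with $\varphi^0_{u,t}$ near $A\times\{0\}$ in $P\times\mathbb R^{2p+1}$ for all $t$. Moreover, $\varphi_{u,t}$ is the germ of the identity for every $u\in P$ such that the germ $\alpha_{u,t}$ is independent of $t$ and either $u\notin N$ or $\varphi^0_{u,t}$ is the germ of the identity for all $t$. -/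

import Mathlib

open Set Topology
open scoped Manifold ContDiff

noncomputable section

/-! ### Contact forms and Lie derivatives on a vector space -/

section Flat

variable {E : Type*} [NormedAddCommGroup E] [NormedSpace ℝ E]

/-- The exterior derivative `(dα)_y (v, w)` of a 1-form `α` on a normed space. -/
def flatD (α : E → E →L[ℝ] ℝ) (y v w : E) : ℝ :=
  extDeriv (fun z => ContinuousAlternatingMap.ofSubsingleton ℝ E ℝ (0 : Fin 1) (α z)) y ![v, w]

/-- The Lie derivative of the 1-form `α` along the vector field `X`, in linear coordinates:
`(L_X α)_y (v) = (D_{X(y)} α)(v) + α_y (D_v X)`. -/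
def flatLie (X : E → E) (α : E → E →L[ℝ] ℝ) (y v : E) : ℝ :=
  fderiv ℝ α y (X y) v + α y (fderiv ℝ X y v)

/-- `a` is a nonzero covector, and the bilinear map `b` is nondegenerate on its kernel. -/
def IsContactPair {T : Type*} [AddCommGroup T] [Module ℝ T] [TopologicalSpace T]
    (a : T →L[ℝ] ℝ) (b : T → T → ℝ) : Prop :=
  a ≠ 0 ∧ ∀ v, a v = 0 → (∀ w, a w = 0 → b v w = 0) → v = 0

/-- The 1-form `α` on a normed space is contact at `y`: `α_y ≠ 0` and `(dα)_y` is
nondegenerate on `ker α_y`. -/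
def IsFlatContactAt (α : E → E →L[ℝ] ℝ) (y : E) : Prop :=
  IsContactPair (α y) (flatD α y)

/-- `φ` is an isotopy, defined on the neighbourhood `W` of `0` and with values in `D`, of
germs at `0` of diffeomorphisms that fix `0`; it starts at the identity, and it carries the path
of 1-forms `α` to a constant path: `φ_t^* α_t = α_0`. -/
structure IsGermIsotopy (W D : Set E) (α : ℝ → E → E →L[ℝ] ℝ) (φ : ℝ → E → E) : Prop where
  smooth : ContDiffOn ℝ ∞ (fun q : ℝ × E => φ q.1 q.2) (Icc 0 1 ×ˢ W)
  init : ∀ x ∈ W, φ 0 x = x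
  fix : ∀ t ∈ Icc (0 : ℝ) 1, φ t 0 = 0
  mapsTo : ∀ t ∈ Icc (0 : ℝ) 1, MapsTo (φ t) W D
  injOn : ∀ t ∈ Icc (0 : ℝ) 1, InjOn (φ t) W
  bijective_fderiv : ∀ t ∈ Icc (0 : ℝ) 1, ∀ x ∈ W, Function.Bijective (fderiv ℝ (φ t) x)
  pullback : ∀ t ∈ Icc (0 : ℝ) 1, ∀ x ∈ W, (α t (φ t x)).comp (fderiv ℝ (φ t) x) = α 0 x

end Flat

/-- The slice `{x | (u, x) ∈ W}`. -/
def slice {P V : Type*} (W : Set (P × V)) (u : P) : Set V := {x | (u, x) ∈ W}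

/-- The set of all `(u, t, x)` with `t ∈ [0, 1]` and `(u, x) ∈ W`. -/
def timeDomain {P V : Type*} (W : Set (P × V)) : Set (P × ℝ × V) :=
  {q | q.2.1 ∈ Icc (0 : ℝ) 1 ∧ (q.1, q.2.2) ∈ W}

/-! ### 1-forms, vector fields and hypersurfaces on an `n`-manifold -/

section Manifold

variable {n : ℕ} {V : Type*} [TopologicalSpace V] [ChartedSpace (EuclideanSpace ℝ (Fin n)) V]

/-- The 1-form `α` in the chart at `x`, that is, its pullback under the inverse of that chart. -/
def coordForm (α : (x : V) → TangentSpace (𝓡 n) x →L[ℝ] ℝ) (x : V)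
    (y : EuclideanSpace ℝ (Fin n)) : EuclideanSpace ℝ (Fin n) →L[ℝ] ℝ :=
  (α ((extChartAt (𝓡 n) x).symm y)).comp
    (mfderiv 𝓘(ℝ, EuclideanSpace ℝ (Fin n)) (𝓡 n) (extChartAt (𝓡 n) x).symm y)

/-- The vector field `X` in the chart at `x`. -/
def coordField (X : (x : V) → TangentSpace (𝓡 n) x) (x : V)
    (y : EuclideanSpace ℝ (Fin n)) : EuclideanSpace ℝ (Fin n) :=
  VectorField.mpullback 𝓘(ℝ, EuclideanSpace ℝ (Fin n)) (𝓡 n) (extChartAt (𝓡 n) x).symm X y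

/-- The coordinates in the chart at `x` of a tangent vector at `x`. -/
def coordVec (x : V) (v : TangentSpace (𝓡 n) x) : EuclideanSpace ℝ (Fin n) :=
  mfderiv (𝓡 n) 𝓘(ℝ, EuclideanSpace ℝ (Fin n)) (extChartAt (𝓡 n) x) x v

/-- The exterior derivative `(dα)_x (v, w)` of a 1-form. -/
def dForm (α : (x : V) → TangentSpace (𝓡 n) x →L[ℝ] ℝ) (x : V)
    (v w : TangentSpace (𝓡 n) x) : ℝ :=
  flatD (coordForm α x) (extChartAt (𝓡 n) x x) (coordVec x v) (coordVec x w)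

/-- The Lie derivative `(L_X α)_x (v)` of a 1-form. -/
def lieForm (X : (x : V) → TangentSpace (𝓡 n) x) (α : (x : V) → TangentSpace (𝓡 n) x →L[ℝ] ℝ)
    (x : V) (v : TangentSpace (𝓡 n) x) : ℝ :=
  flatLie (coordField X x) (coordForm α x) (extChartAt (𝓡 n) x x) (coordVec x v)

/-- The (smooth) 1-form `α` is a contact form: everywhere, `α_x ≠ 0` and `(dα)_x` is
nondegenerate on `ker α_x`. -/
def IsContactForm (α : (x : V) → TangentSpace (𝓡 n) x →L[ℝ] ℝ) : Prop :=
  ∀ x, IsContactPair (α x) (dForm α x)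

/-- `v` is the value at `x` of the Reeb vector field of `α`: `α(v) = 1` and `ι_v dα = 0`. -/
def IsReebVector (α : (x : V) → TangentSpace (𝓡 n) x →L[ℝ] ℝ) (x : V)
    (v : TangentSpace (𝓡 n) x) : Prop :=
  α x v = 1 ∧ ∀ w, dForm α x v w = 0

/-- On the open set `O`, the set `L` is the regular zero set of the smooth function `f`. -/
structure IsDefiningFunction (L O : Set V) (f : V → ℝ) : Prop where
  isOpen : IsOpen O
  smooth : ContMDiffOn (𝓡 n) 𝓘(ℝ, ℝ) ∞ f O
  regular : ∀ x ∈ O, mfderiv (𝓡 n) 𝓘(ℝ, ℝ) f x ≠ 0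
  mem_iff : ∀ x ∈ O, x ∈ L ↔ f x = 0

/-- `L` is an embedded (not necessarily closed) hypersurface in `V`. -/
def IsHypersurface (n : ℕ) {V : Type*} [TopologicalSpace V]
    [ChartedSpace (EuclideanSpace ℝ (Fin n)) V] (L : Set V) : Prop :=
  ∀ x ∈ L, ∃ O f, x ∈ O ∧ IsDefiningFunction (n := n) L O f

/-- `v` is tangent at `x` to the hypersurface `L`: it is in the kernel of the differential of a
local defining function. -/
def IsTangentTo (L : Set V) (x : V) (v : TangentSpace (𝓡 n) x) : Prop :=
  ∃ O f, x ∈ O ∧ IsDefiningFunction (n := n) L O f ∧ mfderiv (𝓡 n) 𝓘(ℝ, ℝ) f x v = 0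

/-- The family `q ↦ α q` of covectors at the points `π q` of `V`, where `q` runs over a
manifold `Q`, is smooth on `S ⊆ Q`, as a map to the cotangent bundle of `V`. -/
def SmoothFormsOn [IsManifold (𝓡 n) ∞ V]
    {F K Q : Type*} [NormedAddCommGroup F] [NormedSpace ℝ F] [TopologicalSpace K]
    (J : ModelWithCorners ℝ F K) [TopologicalSpace Q] [ChartedSpace K Q]
    (π : Q → V) (α : (q : Q) → TangentSpace (𝓡 n) (π q) →L[ℝ] ℝ) (S : Set Q) : Prop :=
  ContMDiffOn J ((𝓡 n).prod 𝓘(ℝ, EuclideanSpace ℝ (Fin n) →L[ℝ] ℝ)) ∞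
    (fun q => Bundle.TotalSpace.mk' (E := fun x : V => TangentSpace (𝓡 n) x →L[ℝ] ℝ)
      (EuclideanSpace ℝ (Fin n) →L[ℝ] ℝ) (π q) (α q)) S

/-- The family `q ↦ X q` of tangent vectors at the points `π q` of `V`, where `q` runs over a
manifold `Q`, is smooth on `S ⊆ Q`, as a map to the tangent bundle of `V`. -/
def SmoothFieldsOn [IsManifold (𝓡 n) ∞ V]
    {F K Q : Type*} [NormedAddCommGroup F] [NormedSpace ℝ F] [TopologicalSpace K]
    (J : ModelWithCorners ℝ F K) [TopologicalSpace Q] [ChartedSpace K Q]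
    (π : Q → V) (X : (q : Q) → TangentSpace (𝓡 n) (π q)) (S : Set Q) : Prop :=
  ContMDiffOn J (𝓡 n).tangent ∞
    (fun q => Bundle.TotalSpace.mk' (E := fun x : V => TangentSpace (𝓡 n) x)
      (EuclideanSpace ℝ (Fin n)) (π q) (X q)) S

/-- The equation `L_{X_t} α_t + (d/dt) α_t = 0` holds on `U` for all `t ∈ [0, 1]`. -/
def SolvesLieEquation (α : ℝ → (x : V) → TangentSpace (𝓡 n) x →L[ℝ] ℝ)
    (X : ℝ → (x : V) → TangentSpace (𝓡 n) x) (U : Set V) : Prop :=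
  ∀ t ∈ Icc (0 : ℝ) 1, ∀ x ∈ U, ∀ v : TangentSpace (𝓡 n) x,
    lieForm (X t) (α t) x v + derivWithin (fun s => α s x v) (Icc 0 1) t = 0

end Manifold

/-- `L` is a smooth family of hypersurfaces `slice L u` of `V`, `u ∈ P`: near each of its points it
is the zero set of a smooth function of `(u, x)` whose differential in `x` does not vanish. -/
def IsHypersurfaceFamily {n : ℕ} {V : Type*} [TopologicalSpace V]
    [ChartedSpace (EuclideanSpace ℝ (Fin n)) V]
    {F K P : Type*} [NormedAddCommGroup F] [NormedSpace ℝ F] [TopologicalSpace K]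
    (J : ModelWithCorners ℝ F K) [TopologicalSpace P] [ChartedSpace K P]
    (L : Set (P × V)) : Prop :=
  ∀ p ∈ L, ∃ (O : Set (P × V)) (f : P × V → ℝ), p ∈ O ∧ IsOpen O ∧
    ContMDiffOn (J.prod (𝓡 n)) 𝓘(ℝ, ℝ) ∞ f O ∧
    (∀ q ∈ O, mfderiv (𝓡 n) 𝓘(ℝ, ℝ) (fun x => f (q.1, x)) q.2 ≠ 0) ∧
    ∀ q ∈ O, q ∈ L ↔ f q = 0

end

/-! Put `f = α(X)`. Cartan's formula turns `L_X α + α̇ = 0` into `df + ι_X dα + α̇ = 0`. Testing on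
the Reeb field `R` leaves the scalar transport equation `df(R) = -α̇(R)`. Conversely, if `f`
satisfies it, then `X` is found by linear algebra: the form `dα + α ⊗ α` is nondegenerate for a
contact form, and `X` is the vector that it sends to `f α - df - α̇` (`contactMap_eq_iff`). Since
`R` is transverse to `L`, the transport equation is solved by characteristics near `L`, with `f`
prescribed on `L` (`exists_transport`, `exists_flat_solution`).

The prescribed function `h = α(X)` on `L` determines `X` near `L`, for each parameter and each time
separately. Three things follow from this uniqueness. Local solutions with the same `h` agree near
`L`, so they glue without a partition of unity (`exists_glue`). With `h = χ α(X⁰)` for a cutoff `χ`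
equal to one near `A`, the solution agrees with `X⁰` near `A ∩ L`, and it remains to remove the rest
of `A` from the domain. If `α` is constant in time and `h = 0` for some parameter, the zero field
has the same data, so `X = 0` there (`exists_relative_lie_solution`).

For germs, `L` is the hyperplane `ker α_0(0)` and `h = 0`. The Reeb field is transverse to it at the
origin because this is the contact plane there at all times. At the origin, `X` lies in that plane,
and both `df` and `α̇` vanish on it; hence `dα(X, ·)` vanishes on it and `X(0) = 0`
(`exists_germ_field`). So the flow `θ` exists up to time one near the origin (`exists_germ_flow`),
and the time derivative of `θ_t^* α_t` is `θ_t^*(L_X α + α̇) = 0` (`isGermIsotopy_of_flow`).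

In the relative version the given isotopy is run only up to time `χ(u) t`. This gives `ψ`, defined
for every parameter. The forms `β_t = ψ_t^* α_t` still have a constant kernel at the origin, and are
constant in time where `χ = 1`. If `θ` is the isotopy constructed above for `β`, then `ψ_t ∘ θ_t` is
the required one (`exists_relative_germ_isotopy`).

Parameters live in a manifold with corners and time in a closed interval. The analysis is therefore
done on convex sets with unique derivatives, which include the charts' images and `[0, 1]`. -/

/-! ### Ordinary differential equations: global solutions and smooth dependence -/

section ODE

/-- Concatenation of two solutions of an ODE on adjacent intervals. -/
theorem exists_hasDerivWithinAt_concat {E : Type*} [NormedAddCommGroup E] [NormedSpace ℝ E]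
    {f : ℝ → E → E} {a b c : ℝ} (hab : a ≤ b) (hbc : b ≤ c) {γ δ : ℝ → E} (hγδ : γ b = δ b)
    (hγ : ∀ s ∈ Icc a b, HasDerivWithinAt γ (f s (γ s)) (Icc a b) s)
    (hδ : ∀ s ∈ Icc b c, HasDerivWithinAt δ (f s (δ s)) (Icc b c) s) :
    ∃ η : ℝ → E, EqOn η γ (Icc a b) ∧
      ∀ s ∈ Icc a c, HasDerivWithinAt η (f s (η s)) (Icc a c) s := by
  classical
  set η : ℝ → E := fun s => if s ≤ b then γ s else δ s with hη
  have h1 : EqOn η γ (Icc a b) := fun s hs => if_pos hs.2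
  have h2 : EqOn η δ (Icc b c) := by
    intro s hs
    rcases eq_or_lt_of_le hs.1 with h | h
    · subst h; simp [hη, hγδ]
    · exact if_neg (not_le.2 h)
  refine ⟨η, h1, fun s hs => ?_⟩
  -- Being differentiable within a closed piece is vacuous at points off that piece, so each half is
  -- checked on its own interval; the junction belongs to both.
  rw [← Icc_union_Icc_eq_Icc hab hbc]
  refine HasDerivWithinAt.union ?_ ?_
  · by_cases hsb : s ≤ b
    · have hs' : s ∈ Icc a b := ⟨hs.1, hsb⟩
      rw [h1 hs']
      exact (hγ s hs').congr_of_mem h1 hs'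
    · refine HasFDerivWithinAt.of_notMem_closure ?_
      rw [isClosed_Icc.closure_eq]
      exact fun h => hsb h.2
  · by_cases hsb : b ≤ s
    · have hs' : s ∈ Icc b c := ⟨hsb, hs.2⟩
      rw [h2 hs']
      exact (hδ s hs').congr_of_mem h2 hs'
    · refine HasFDerivWithinAt.of_notMem_closure ?_
      rw [isClosed_Icc.closure_eq]
      exact fun h => hsb h.1

open scoped NNReal in
/-- A time-dependent vector field on `[0, 1]` that is globally Lipschitz in space has solutions on
all of `[0, 1]`. -/
theorem exists_solution_of_lipschitzWith {E : Type*} [NormedAddCommGroup E] [NormedSpace ℝ E]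
    [CompleteSpace E] {f : ℝ → E → E} {K : ℝ≥0}
    (hf : ∀ s ∈ Icc (0 : ℝ) 1, LipschitzWith K (f s))
    (hc : ∀ x, ContinuousOn (fun s => f s x) (Icc 0 1)) (x₀ : E) :
    ∃ γ : ℝ → E, γ 0 = x₀ ∧
      ∀ s ∈ Icc (0 : ℝ) 1, HasDerivWithinAt γ (f s (γ s)) (Icc 0 1) s := by
  -- The step length `1 / (N + 1)` depends on the Lipschitz constant only, not on the value reached
  -- so far, so finitely many Picard-Lindelöf steps arrive at time one.
  obtain ⟨N, hN⟩ := exists_nat_gt (2 * (K : ℝ))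
  have hN0 : (0 : ℝ) < N + 1 := by positivity
  have key : ∀ k : ℕ, k ≤ N + 1 → ∃ γ : ℝ → E, γ 0 = x₀ ∧
      ∀ s ∈ Icc (0 : ℝ) (k / (N + 1 : ℝ)),
        HasDerivWithinAt γ (f s (γ s)) (Icc 0 (k / (N + 1 : ℝ))) s := by
    intro k
    induction k with
    | zero =>
      intro _
      refine ⟨fun _ => x₀, rfl, fun s hs => ?_⟩
      have : Icc (0 : ℝ) ((0 : ℕ) / (N + 1 : ℝ)) = {0} := by simp
      rw [this] at hs ⊢
      have hs0 : s = 0 := hs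
      subst hs0
      exact HasFDerivWithinAt.of_subsingleton subsingleton_singleton
    | succ k ih =>
      intro hk
      obtain ⟨γ, hγ0, hγ⟩ := ih (by omega)
      set b : ℝ := k / (N + 1 : ℝ) with hb
      set c : ℝ := (k + 1 : ℕ) / (N + 1 : ℝ) with hcdef
      have hb0 : 0 ≤ b := by positivity
      have hbc : c = b + 1 / (N + 1) := by rw [hb, hcdef]; push_cast; ring
      have hc1 : c ≤ 1 := by
        rw [hcdef, div_le_one hN0]; exact_mod_cast hk
      have hbc' : b ≤ c := by rw [hbc]; have : 0 ≤ 1 / (N + 1 : ℝ) := by positivity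
                              linarith
      have hsub : Icc b c ⊆ Icc 0 1 := Icc_subset_Icc hb0 hc1
      obtain ⟨M, hM⟩ := isCompact_Icc.exists_bound_of_continuousOn (hc (γ b))
      have hM0 : 0 ≤ M := (norm_nonneg _).trans (hM 0 (by simp))
      -- On the ball of radius `2M` about the current value the speed is at most `M + 2KM`; within
      -- one step this moves less than `2M` when `M > 0`, because `2K < N`.
      have hPL : IsPicardLindelof f (⟨b, left_mem_Icc.2 hbc'⟩ : Icc b c) (γ b)
          (2 * M.toNNReal) 0 (M.toNNReal + K * (2 * M.toNNReal)) K := by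
        refine ⟨fun t ht => (hf t (hsub ht)).lipschitzOnWith, fun x _ => (hc x).mono hsub,
          fun t ht x hx => ?_, ?_⟩
        · have h1 := (hf t (hsub ht)).dist_le_mul x (γ b)
          have h2 := hM t (hsub ht)
          rw [Metric.mem_closedBall] at hx
          push_cast [Real.coe_toNNReal M hM0] at hx ⊢
          calc ‖f t x‖ ≤ ‖f t (γ b)‖ + dist (f t x) (f t (γ b)) := by
                rw [dist_eq_norm]
                have := norm_add_le (f t (γ b)) (f t x - f t (γ b))
                simpa using this
            _ ≤ M + K * (2 * M) := by
                refine add_le_add h2 (h1.trans ?_)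
                gcongr
        · have : max (c - b) (b - b) = 1 / (N + 1) := by
            rw [hbc]; simp; positivity
          push_cast [Real.coe_toNNReal M hM0]
          rw [this, sub_zero, mul_one_div, div_le_iff₀ hN0]
          nlinarith
      obtain ⟨δ, hδ0, hδ⟩ := hPL.exists_eq_forall_mem_Icc_hasDerivWithinAt₀
      obtain ⟨η, hη1, hη2⟩ := exists_hasDerivWithinAt_concat hb0 hbc' hδ0.symm hγ hδ
      exact ⟨η, by rw [hη1 (left_mem_Icc.2 hb0), hγ0], hη2⟩
  have := key (N + 1) le_rfl
  have h1 : ((N + 1 : ℕ) : ℝ) / (N + 1 : ℝ) = 1 := by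
    push_cast; exact div_self hN0.ne'
  rwa [h1] at this

/-- A Grönwall estimate in which the bound on the derivative is only needed where the function lies
between its initial bound and the bound that is to be proved. -/
theorem norm_le_mul_exp_of_norm_deriv_le {G : Type*} [NormedAddCommGroup G] [NormedSpace ℝ G]
    {f f' : ℝ → G} {η K : ℝ} (hη : 0 < η) (hK : 0 ≤ K)
    (hf : ∀ s ∈ Icc (0 : ℝ) 1, HasDerivWithinAt f (f' s) (Icc 0 1) s) (h0 : ‖f 0‖ ≤ η)
    (bound : ∀ s ∈ Icc (0 : ℝ) 1, η ≤ ‖f s‖ → ‖f s‖ ≤ η * Real.exp (K + 1) →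
      ‖f' s‖ ≤ K * ‖f s‖) :
    ∀ s ∈ Icc (0 : ℝ) 1, ‖f s‖ ≤ η * Real.exp (K + 1) := by
  have hle : ∀ s ∈ Icc (0 : ℝ) 1, η * Real.exp ((K + 1) * s) ≤ η * Real.exp (K + 1) := by
    intro s hs
    gcongr
    nlinarith [hs.1, hs.2]
  -- The barrier grows at the rate `K + 1` instead of `K`, which makes the comparison of derivatives
  -- strict at a time of contact. Only contact times matter, and there the norm lies between `η` and
  -- the final bound.
  have main := image_norm_le_of_norm_deriv_right_lt_deriv_boundary' (f := f) (f' := f')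
    (a := 0) (b := 1) (B := fun s => η * Real.exp ((K + 1) * s))
    (B' := fun s => η * (Real.exp ((K + 1) * s) * (K + 1)))
    (fun s hs => (hf s hs).continuousWithinAt)
    (fun s hs => ((hf s (Ico_subset_Icc_self hs)).mono_of_mem_nhdsWithin
      (Icc_mem_nhdsGE_of_mem hs)))
    (by simpa using h0) (by fun_prop)
    (fun s _ => by
      have : HasDerivAt (fun s : ℝ => (K + 1) * s) (K + 1) s := by
        simpa using (hasDerivAt_id s).const_mul (K + 1)
      exact (this.exp.const_mul η).hasDerivWithinAt)
    (fun s hs h => by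
      have hs' := Ico_subset_Icc_self hs
      have hge : η ≤ ‖f s‖ := by
        rw [h]
        have : 1 ≤ Real.exp ((K + 1) * s) := Real.one_le_exp (by nlinarith [hs.1])
        nlinarith
      have := bound s hs' hge (by rw [h]; exact hle s hs')
      rw [h] at this
      have hp : 0 < η * Real.exp ((K + 1) * s) := by positivity
      calc ‖f' s‖ ≤ K * (η * Real.exp ((K + 1) * s)) := this
        _ < η * (Real.exp ((K + 1) * s) * (K + 1)) := by nlinarith)
  exact fun s hs => (main hs).trans (hle s hs)

/-- A continuous function on `C` is uniformly continuous near a compact curve in `C`. -/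
theorem exists_forall_dist_lt_of_continuousOn_curve {G H : Type*} [PseudoMetricSpace G]
    [PseudoMetricSpace H] {C : Set G} {f : G → H} (hf : ContinuousOn f C) {c : ℝ → G}
    (hc : ContinuousOn c (Icc 0 1)) (hcC : ∀ s ∈ Icc (0 : ℝ) 1, c s ∈ C) {ε : ℝ} (hε : 0 < ε) :
    ∃ δ > 0, ∀ s ∈ Icc (0 : ℝ) 1, ∀ y ∈ C, dist y (c s) < δ → dist (f y) (f (c s)) < ε := by
  have hK : IsCompact (c '' Icc 0 1) := isCompact_Icc.image_of_continuousOn hc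
  have hKC : c '' Icc 0 1 ⊆ C := by rintro _ ⟨s, hs, rfl⟩; exact hcC s hs
  have hK' : IsCompact ((↑) ⁻¹' (c '' Icc 0 1) : Set C) := by
    rw [Subtype.isCompact_iff, Subtype.image_preimage_coe, inter_eq_right.2 hKC]
    exact hK
  have := hK'.uniformContinuousAt_of_continuousAt (C.domRestrict f)
    (fun a _ => (continuousOn_iff_continuous_domRestrict.1 hf).continuousAt)
    (Metric.dist_mem_uniformity hε)
  obtain ⟨δ, hδ, h⟩ := Metric.mem_uniformity_dist.1 this
  refine ⟨δ, hδ, fun s hs y hy hd => ?_⟩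
  have := h (a := ⟨c s, hcC s hs⟩) (b := ⟨y, hy⟩) (by rw [dist_comm]; exact hd)
    ⟨s, hs, rfl⟩
  rw [dist_comm]
  exact this

end ODE

/-! ### Smooth dependence of flows on parameters, on sets with corners -/

section FlowSmooth

/-- `γ` solves the autonomous equation `γ' = V γ` on `[0, 1]` and stays in `C`. -/
def IsFlowLine {G : Type*} [NormedAddCommGroup G] [NormedSpace ℝ G] (V : G → G) (C : Set G)
    (γ : ℝ → G) : Prop :=
  ∀ s ∈ Icc (0 : ℝ) 1, HasDerivWithinAt γ (V (γ s)) (Icc 0 1) s ∧ γ s ∈ C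

variable {F G : Type*} [NormedAddCommGroup F] [NormedSpace ℝ F] [NormedAddCommGroup G]
  [NormedSpace ℝ G] {V : G → G} {C : Set G}

theorem IsFlowLine.continuousOn {γ : ℝ → G} (h : IsFlowLine V C γ) : ContinuousOn γ (Icc 0 1) :=
  fun s hs => (h s hs).1.continuousWithinAt

/-- On a convex set, the first order Taylor remainder is controlled by the oscillation of the
derivative. -/
theorem Convex.norm_sub_sub_fderivWithin_le (hC : Convex ℝ C) (hV : DifferentiableOn ℝ V C)
    {x y : G} (hx : x ∈ C) (hy : y ∈ C) {A : G →L[ℝ] G} {ε δ : ℝ} (hxy : dist y x < δ)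
    (hA : ∀ z ∈ C, dist z x < δ → ‖fderivWithin ℝ V C z - A‖ ≤ ε) :
    ‖V y - V x - A (y - x)‖ ≤ ε * ‖y - x‖ := by
  have hδ : 0 < δ := dist_nonneg.trans_lt hxy
  have hcv : Convex ℝ (C ∩ Metric.ball x δ) := hC.inter (convex_ball x δ)
  refine hcv.norm_image_sub_le_of_norm_hasFDerivWithin_le' (f' := fderivWithin ℝ V C)
    (fun z hz => ((hV z hz.1).hasFDerivWithinAt).mono inter_subset_left)
    (fun z hz => hA z hz.1 hz.2) ⟨hx, Metric.mem_ball_self hδ⟩ ⟨hy, hxy⟩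

/-- Uniform local estimates for a `C^1` vector field near a flow line. -/
theorem IsFlowLine.exists_bound {γ : ℝ → G} (h : IsFlowLine V C γ) (hC : Convex ℝ C)
    (hCu : UniqueDiffOn ℝ C) (hV : ContDiffOn ℝ 1 V C) :
    ∃ K ≥ 0, (∀ s ∈ Icc (0 : ℝ) 1, ‖fderivWithin ℝ V C (γ s)‖ ≤ K) ∧
      ∀ ε > 0, ∃ δ > 0, ∀ s ∈ Icc (0 : ℝ) 1, ∀ y ∈ C, dist y (γ s) < δ →
        ‖V y - V (γ s) - fderivWithin ℝ V C (γ s) (y - γ s)‖ ≤ ε * ‖y - γ s‖ := by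
  have hD : ContinuousOn (fderivWithin ℝ V C) C := hV.continuousOn_fderivWithin hCu le_rfl
  have hDγ : ContinuousOn (fun s => fderivWithin ℝ V C (γ s)) (Icc 0 1) :=
    hD.comp h.continuousOn (fun s hs => (h s hs).2)
  obtain ⟨K, hK⟩ := isCompact_Icc.exists_bound_of_continuousOn hDγ
  refine ⟨K, (norm_nonneg _).trans (hK 0 (by simp)), hK, fun ε hε => ?_⟩
  obtain ⟨δ, hδ, H⟩ := exists_forall_dist_lt_of_continuousOn_curve hD h.continuousOn
    (fun s hs => (h s hs).2) hε
  refine ⟨δ, hδ, fun s hs y hy hd => ?_⟩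
  refine hC.norm_sub_sub_fderivWithin_le (hV.differentiableOn one_ne_zero) (h s hs).2 hy hd
    (fun z hz hzd => ?_)
  rw [← dist_eq_norm]
  exact (H s hs z hz hzd).le

variable {S : Set F} {γ : F → ℝ → G}

/-- Lipschitz dependence of flow lines on a parameter. -/
theorem IsFlowLine.exists_forall_norm_sub_le (hC : Convex ℝ C) (hCu : UniqueDiffOn ℝ C)
    (hV : ContDiffOn ℝ 1 V C) (hγ : ∀ p ∈ S, IsFlowLine V C (γ p)) {p : F} (hp : p ∈ S)
    (h0 : DifferentiableWithinAt ℝ (fun q => γ q 0) S p) :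
    ∃ M ≥ 0, ∀ᶠ q in 𝓝[S] p, ∀ s ∈ Icc (0 : ℝ) 1, ‖γ q s - γ p s‖ ≤ M * ‖q - p‖ := by
  obtain ⟨K, hK0, hK, hT⟩ := (hγ p hp).exists_bound hC hCu hV
  obtain ⟨δ, hδ, hT⟩ := hT 1 one_pos
  have hO := h0.hasFDerivWithinAt.isBigO_sub
  obtain ⟨L, hL0, hL⟩ := hO.exists_pos
  rw [Asymptotics.isBigOWith_iff] at hL
  set E := Real.exp (K + 1 + 1) with hE
  have hE0 : 0 < E := Real.exp_pos _
  refine ⟨L * E, by positivity, ?_⟩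
  have hsmall : ∀ᶠ q in 𝓝[S] p, L * E * ‖q - p‖ < δ := by
    have : Filter.Tendsto (fun q => L * E * ‖q - p‖) (𝓝[S] p) (𝓝 (L * E * ‖p - p‖)) := by
      refine Filter.Tendsto.mono_left ?_ nhdsWithin_le_nhds
      exact Continuous.tendsto (by fun_prop) p
    refine this.eventually_lt_const ?_
    simpa using hδ
  filter_upwards [hL, hsmall, self_mem_nhdsWithin] with q hq1 hq2 hqS
  rcases eq_or_ne q p with rfl | hne
  · intro s hs; simp
  have hpos : 0 < ‖q - p‖ := norm_pos_iff.2 (sub_ne_zero.2 hne)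
  -- The Taylor estimate holds only within `δ` of the reference line. The upper bound that the
  -- Grönwall lemma lets one assume is below `δ` for `q` near `p`, so no separate continuation
  -- argument is needed.
  have := norm_le_mul_exp_of_norm_deriv_le (f := fun s => γ q s - γ p s)
    (f' := fun s => V (γ q s) - V (γ p s)) (η := L * ‖q - p‖) (K := K + 1) (by positivity)
    (by positivity)
    (fun s hs => (hγ q hqS s hs).1.sub (hγ p hp s hs).1) hq1
    (fun s hs _ h2 => by
      have hd : dist (γ q s) (γ p s) < δ := by
        rw [dist_eq_norm]
        refine h2.trans_lt (lt_of_eq_of_lt ?_ hq2)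
        rw [hE]; ring
      have h3 := hT s hs _ (hγ q hqS s hs).2 hd
      have h4 := (fderivWithin ℝ V C (γ p s)).le_opNorm (γ q s - γ p s)
      have h5 := mul_le_mul_of_nonneg_right (hK s hs) (norm_nonneg (γ q s - γ p s))
      have h6 := norm_le_norm_add_norm_sub' (V (γ q s) - V (γ p s))
        (fderivWithin ℝ V C (γ p s) (γ q s - γ p s))
      linarith)
  intro s hs
  refine (this s hs).trans (le_of_eq ?_)
  rw [hE]; ring

/-- The linearised flow is the derivative of the flow with respect to the parameter. -/
theorem IsFlowLine.hasFDerivWithinAt_param (hC : Convex ℝ C) (hCu : UniqueDiffOn ℝ C)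
    (hV : ContDiffOn ℝ 1 V C) (hγ : ∀ p ∈ S, IsFlowLine V C (γ p)) {p : F} (hp : p ∈ S)
    {D : ℝ → F →L[ℝ] G} (h0 : HasFDerivWithinAt (fun q => γ q 0) (D 0) S p)
    (hD : ∀ s ∈ Icc (0 : ℝ) 1,
      HasDerivWithinAt D ((fderivWithin ℝ V C (γ p s)).comp (D s)) (Icc 0 1) s)
    {s : ℝ} (hs : s ∈ Icc (0 : ℝ) 1) :
    HasFDerivWithinAt (fun q => γ q s) (D s) S p := by
  obtain ⟨K, hK0, hK, hT⟩ := (hγ p hp).exists_bound hC hCu hV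
  obtain ⟨M, hM0, hM⟩ := IsFlowLine.exists_forall_norm_sub_le hC hCu hV hγ hp
    h0.differentiableWithinAt
  rw [hasFDerivWithinAt_iff_isLittleO, Asymptotics.isLittleO_iff] at h0 ⊢
  intro c hc
  set E := Real.exp (K + M + 1) with hE
  have hE0 : 0 < E := Real.exp_pos _
  set ε := c / E with hε
  have hε0 : 0 < ε := by positivity
  obtain ⟨δ, hδ, hT⟩ := hT ε hε0
  have hsmall : ∀ᶠ q in 𝓝[S] p, M * ‖q - p‖ < δ := by
    have : Filter.Tendsto (fun q => M * ‖q - p‖) (𝓝[S] p) (𝓝 (M * ‖p - p‖)) := by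
      refine Filter.Tendsto.mono_left ?_ nhdsWithin_le_nhds
      exact Continuous.tendsto (by fun_prop) p
    refine this.eventually_lt_const ?_
    simpa using hδ
  filter_upwards [h0 hε0, hsmall, hM, self_mem_nhdsWithin] with q hq1 hq2 hq3 hqS
  rcases eq_or_ne q p with rfl | hne
  · simp
  have hpos : 0 < ‖q - p‖ := norm_pos_iff.2 (sub_ne_zero.2 hne)
  -- With `A` the derivative of `V` along the reference line, the error `e` satisfies `e' = A e +
  -- remainder`. The remainder is at most `ε M ‖q - p‖ = M η`, hence at most `M ‖e‖` where `η ≤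
  -- ‖e‖`; so `K + M` is a homogeneous rate. The choice `ε = c / E` cancels the exponential factor.
  have := norm_le_mul_exp_of_norm_deriv_le (f := fun s => γ q s - γ p s - D s (q - p))
    (f' := fun s => V (γ q s) - V (γ p s) - (fderivWithin ℝ V C (γ p s)).comp (D s) (q - p))
    (η := ε * ‖q - p‖) (K := K + M) (by positivity) (by positivity)
    (fun s hs => ((hγ q hqS s hs).1.sub (hγ p hp s hs).1).sub
      ((ContinuousLinearMap.apply ℝ G (q - p)).hasFDerivAt.comp_hasDerivWithinAt s (hD s hs)))
    hq1
    (fun s hs h1 _ => by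
      have hd : dist (γ q s) (γ p s) < δ := by
        rw [dist_eq_norm]
        exact (hq3 s hs).trans_lt hq2
      have h3 := hT s hs _ (hγ q hqS s hs).2 hd
      set A := fderivWithin ℝ V C (γ p s)
      have h4 := A.le_opNorm (γ q s - γ p s - D s (q - p))
      have h5 := mul_le_mul_of_nonneg_right (hK s hs) (norm_nonneg (γ q s - γ p s - D s (q - p)))
      have h6 : V (γ q s) - V (γ p s) - A.comp (D s) (q - p) =
          (V (γ q s) - V (γ p s) - A (γ q s - γ p s)) + A (γ q s - γ p s - D s (q - p)) := by
        simp only [ContinuousLinearMap.comp_apply, map_sub]; abel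
      rw [h6]
      refine (norm_add_le _ _).trans ?_
      have h7 := mul_le_mul_of_nonneg_left (hq3 s hs) hε0.le
      have h8 := mul_le_mul_of_nonneg_left h1 hM0
      nlinarith)
  refine (this s hs).trans (le_of_eq ?_)
  rw [hε, ← hE]; field_simp

open scoped NNReal in
/-- Existence of the linearised flow. -/
theorem IsFlowLine.exists_linearised [CompleteSpace G] {c : ℝ → G} (hc : IsFlowLine V C c)
    (hCu : UniqueDiffOn ℝ C) (hV : ContDiffOn ℝ 1 V C) (D₀ : F →L[ℝ] G) :
    ∃ D : ℝ → F →L[ℝ] G, D 0 = D₀ ∧ ∀ s ∈ Icc (0 : ℝ) 1,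
      HasDerivWithinAt D ((fderivWithin ℝ V C (c s)).comp (D s)) (Icc 0 1) s := by
  have hD : ContinuousOn (fderivWithin ℝ V C) C := hV.continuousOn_fderivWithin hCu le_rfl
  have hDγ : ContinuousOn (fun s => fderivWithin ℝ V C (c s)) (Icc 0 1) :=
    hD.comp hc.continuousOn (fun s hs => (hc s hs).2)
  obtain ⟨K, hK⟩ := isCompact_Icc.exists_bound_of_continuousOn hDγ
  have hK0 : 0 ≤ K := (norm_nonneg _).trans (hK 0 (by simp))
  refine exists_solution_of_lipschitzWith (K := K.toNNReal)
    (f := fun s (D : F →L[ℝ] G) => (fderivWithin ℝ V C (c s)).comp D) (fun s hs => ?_)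
    (fun D => ?_) D₀
  · refine LipschitzWith.of_dist_le_mul fun x y => ?_
    rw [dist_eq_norm, dist_eq_norm, ← ContinuousLinearMap.comp_sub, Real.coe_toNNReal K hK0]
    refine (ContinuousLinearMap.opNorm_comp_le _ _).trans ?_
    gcongr
    exact hK s hs
  · exact hDγ.clm_comp continuousOn_const

universe u

/-- The curve and its derivative `D` in the parameter together form a flow line of the field `(V, DV
∘ ·)` on `G × (F →L[ℝ] G)`, which has one derivative less. The induction therefore runs over all
phase spaces at once, and `F` and `G` share a universe so that the enlarged phase space is again
admissible. -/
theorem contDiffOn_flow_nat (k : ℕ) {F : Type u} [NormedAddCommGroup F] [NormedSpace ℝ F]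
    {S : Set F} (hSu : UniqueDiffOn ℝ S) :
    ∀ {G : Type u} [NormedAddCommGroup G] [NormedSpace ℝ G] [CompleteSpace G] {V : G → G}
      {C : Set G} {γ : F → ℝ → G}, Convex ℝ C → UniqueDiffOn ℝ C → ContDiffOn ℝ (k + 1) V C →
      (∀ p ∈ S, IsFlowLine V C (γ p)) → ContDiffOn ℝ (k + 1) (fun p => γ p 0) S →
      ∀ s ∈ Icc (0 : ℝ) 1, ContDiffOn ℝ k (fun p => γ p s) S := by
  induction k with
  | zero =>
    intro G _ _ _ V C γ hC hCu hV hγ h0 s hs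
    simp only [Nat.cast_zero, zero_add] at hV h0
    rw [Nat.cast_zero, contDiffOn_zero]
    intro p hp
    obtain ⟨D, hD0, hD⟩ := (hγ p hp).exists_linearised hCu hV
      (fderivWithin ℝ (fun q => γ q 0) S p)
    refine (IsFlowLine.hasFDerivWithinAt_param hC hCu hV hγ hp (D := D) ?_ hD
      hs).continuousWithinAt
    rw [hD0]
    exact (h0.differentiableOn one_ne_zero p hp).hasFDerivWithinAt
  | succ k ih =>
    intro G _ _ _ V C γ hC hCu hV hγ h0 s hs
    push_cast at hV h0 ⊢
    have hV1 : ContDiffOn ℝ 1 V C := hV.of_le (by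
      rw [show ((k : WithTop ℕ∞) + 1 + 1) = 1 + (k + 1) by ring]; exact le_self_add)
    have h01 : ContDiffOn ℝ 1 (fun q => γ q 0) S := h0.of_le (by
      rw [show ((k : WithTop ℕ∞) + 1 + 1) = 1 + (k + 1) by ring]; exact le_self_add)
    choose! D hD0 hD using fun p (hp : p ∈ S) => (hγ p hp).exists_linearised hCu hV1
      (fderivWithin ℝ (fun q => γ q 0) S p)
    have hder : ∀ p ∈ S, ∀ s ∈ Icc (0 : ℝ) 1, HasFDerivWithinAt (fun q => γ q s) (D p s) S p :=
      fun p hp s hs => IsFlowLine.hasFDerivWithinAt_param hC hCu hV1 hγ hp (by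
        rw [hD0 p hp]
        exact (h01.differentiableOn one_ne_zero p hp).hasFDerivWithinAt) (hD p hp) hs
    have hDV : ContDiffOn ℝ (k + 1) (fderivWithin ℝ V C) C :=
      hV.fderivWithin hCu le_rfl
    have hD0' : ContDiffOn ℝ (k + 1) (fun p => fderivWithin ℝ (fun q => γ q 0) S p) S :=
      h0.fderivWithin hSu le_rfl
    have hV' : ContDiffOn ℝ (k + 1) (fun x : G × (F →L[ℝ] G) =>
        (V x.1, (fderivWithin ℝ V C x.1).comp x.2)) (C ×ˢ univ) := by
      refine ContDiffOn.prodMk ?_ ?_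
      · exact (hV.of_le (by exact le_self_add)).comp contDiff_fst.contDiffOn (fun x hx => hx.1)
      · exact (hDV.comp contDiff_fst.contDiffOn (fun x hx => hx.1)).clm_comp
          contDiff_snd.contDiffOn
    have := ih (G := G × (F →L[ℝ] G)) (γ := fun p s => (γ p s, D p s)) (hC.prod convex_univ)
      (hCu.prod uniqueDiffOn_univ) hV'
      (fun p hp s hs => ⟨(hγ p hp s hs).1.prodMk (hD p hp s hs), (hγ p hp s hs).2, trivial⟩)
      ((h0.of_le (by exact le_self_add)).prodMk (hD0'.congr fun p hp => hD0 p hp)) s hs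
    rw [contDiffOn_succ_iff_fderivWithin hSu]
    refine ⟨fun p hp => (hder p hp s hs).differentiableWithinAt, by simp, ?_⟩
    exact this.snd.congr fun p hp => (hder p hp s hs).fderivWithin (hSu p hp)

/-- Smooth dependence of flow lines on a parameter that enters through the initial value. The
parameter set and the phase space may have boundary and corners. -/
theorem contDiffOn_flow {F G : Type u} [NormedAddCommGroup F] [NormedSpace ℝ F]
    [NormedAddCommGroup G] [NormedSpace ℝ G] [CompleteSpace G] {S : Set F}
    (hSu : UniqueDiffOn ℝ S) {V : G → G} {C : Set G} {γ : F → ℝ → G} (hC : Convex ℝ C)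
    (hCu : UniqueDiffOn ℝ C) (hV : ContDiffOn ℝ ∞ V C) (hγ : ∀ p ∈ S, IsFlowLine V C (γ p))
    (h0 : ContDiffOn ℝ ∞ (fun p => γ p 0) S) {s : ℝ} (hs : s ∈ Icc (0 : ℝ) 1) :
    ContDiffOn ℝ ∞ (fun p => γ p s) S := by
  rw [contDiffOn_infty] at hV h0 ⊢
  exact fun k => contDiffOn_flow_nat k hSu hC hCu (mod_cast hV (k + 1)) hγ
    (mod_cast h0 (k + 1)) s hs

end FlowSmooth

/-! ### Estimates on boxes for the method of characteristics -/

section Characteristics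

/-- The part of `D` over `S`. -/
def restrictBase {F E : Type*} (S : Set F) (D : Set (F × E)) : Set (F × E) := D ∩ S ×ˢ univ

theorem mem_restrictBase {F E : Type*} {S : Set F} {D : Set (F × E)} {q : F × E} :
    q ∈ restrictBase S D ↔ q ∈ D ∧ q.1 ∈ S := by simp [restrictBase]

theorem restrictBase_mono {F E : Type*} {S S' : Set F} {D D' : Set (F × E)} (h : S ⊆ S') (h' : D ⊆ D') :
    restrictBase S D ⊆ restrictBase S' D' := inter_subset_inter h' (prod_mono_left h)

/-- The parameter set `S` may have corners, but `D` is open. In the fibre direction, smoothness is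
thus smoothness on a full neighbourhood, and `fderiv` may be used there. -/
theorem ContDiffOn.contDiffAt_slice {F E H : Type*} [NormedAddCommGroup F] [NormedSpace ℝ F]
    [NormedAddCommGroup E] [NormedSpace ℝ E] [NormedAddCommGroup H] [NormedSpace ℝ H]
    {S : Set F} {D : Set (F × E)} {f : F × E → H} {m : WithTop ℕ∞}
    (hf : ContDiffOn ℝ m f (restrictBase S D)) (hD : IsOpen D) {q : F × E} (hq : q ∈ restrictBase S D) :
    ContDiffAt ℝ m (fun y => f (q.1, y)) q.2 := by
  have h1 : ContDiffOn ℝ m (fun y => f (q.1, y)) ((fun y => (q.1, y)) ⁻¹' D) :=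
    hf.comp (by fun_prop) (fun y hy => ⟨hy, hq.2.1, trivial⟩)
  exact h1.contDiffAt ((hD.preimage (by fun_prop)).mem_nhds hq.1)

open scoped NNReal in
/-- The Picard-Lindelöf theorem with control on the range of the solution. -/
theorem IsPicardLindelof.exists_forall_mem_closedBall {E : Type*} [NormedAddCommGroup E]
    [NormedSpace ℝ E] [CompleteSpace E] {f : ℝ → E → E} {tmin tmax : ℝ} {t₀ : Icc tmin tmax}
    {x₀ x : E} {a r L K : ℝ≥0} (hf : IsPicardLindelof f t₀ x₀ a r L K)
    (hx : x ∈ Metric.closedBall x₀ r) :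
    ∃ α : ℝ → E, α t₀ = x ∧
      ∀ t ∈ Icc tmin tmax, HasDerivWithinAt α (f t (α t)) (Icc tmin tmax) t ∧
        α t ∈ Metric.closedBall x₀ a := by
  obtain ⟨α, hα⟩ := ODE.FunSpace.exists_isFixedPt_next hf hx
  refine ⟨α.compProj, by rw [ODE.FunSpace.compProj_val, ← hα, ODE.FunSpace.next_apply₀],
    fun t ht ↦ ⟨?_, α.compProj_mem_closedBall hf.mul_max_le⟩⟩
  apply ODE.hasDerivWithinAt_picard_Icc t₀.2 hf.continuousOn_uncurry
    α.continuous_compProj.continuousOn (fun _ ht' ↦ α.compProj_mem_closedBall hf.mul_max_le)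
    x ht |>.congr_of_mem _ ht
  intro t' ht'
  nth_rw 1 [← hα]
  rw [ODE.FunSpace.compProj_of_mem ht', ODE.FunSpace.next_apply]

open scoped NNReal in
/-- Uniform local bounds and Lipschitz estimates for a `C^1` map on a product with a convex set. -/
theorem exists_box_lipschitzOnWith {F E H : Type*} [NormedAddCommGroup F] [NormedSpace ℝ F]
    [NormedAddCommGroup E] [NormedSpace ℝ E] [NormedAddCommGroup H] [NormedSpace ℝ H]
    {S : Set F} (hS : Convex ℝ S) {D : Set (F × E)} (hD : IsOpen D) {f : F × E → H}
    (hf : ContDiffOn ℝ 1 f (restrictBase S D)) {q : F × E} (hq : q ∈ restrictBase S D) :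
    ∃ r > 0, ∃ K : ℝ≥0, ∃ M > 0, Metric.ball q.1 r ×ˢ Metric.ball q.2 r ⊆ D ∧
      (∀ p ∈ S ∩ Metric.ball q.1 r,
        LipschitzOnWith K (fun x => f (p, x)) (Metric.ball q.2 r)) ∧
      ∀ p ∈ S ∩ Metric.ball q.1 r, ∀ x ∈ Metric.ball q.2 r, ‖f (p, x)‖ ≤ M := by
  have hf' : ContDiffWithinAt ℝ 1 f (S ×ˢ univ) q := by
    have := hf q hq
    rwa [restrictBase, inter_comm, contDiffWithinAt_inter' (mem_nhdsWithin_of_mem_nhds (hD.mem_nhds hq.1))] at this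
  obtain ⟨K, t, ht, hK⟩ := hf'.exists_lipschitzOnWith (hS.prod convex_univ)
  have hDt : D ∩ t ∈ 𝓝[S ×ˢ univ] q :=
    Filter.inter_mem (mem_nhdsWithin_of_mem_nhds (hD.mem_nhds hq.1)) ht
  obtain ⟨r₀, hr₀, hr₀D⟩ := Metric.isOpen_iff.1 hD q hq.1
  obtain ⟨r₁, hr₁, hr₁t⟩ := Metric.mem_nhdsWithin_iff.1 ht
  have hball : ∀ r, Metric.ball q.1 r ×ˢ Metric.ball q.2 r = Metric.ball q r := fun r => by
    rw [ball_prod_same]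
  have hmem : ∀ p ∈ S ∩ Metric.ball q.1 (min r₀ r₁), ∀ x ∈ Metric.ball q.2 (min r₀ r₁),
      (p, x) ∈ t := by
    intro p hp x hx
    refine hr₁t ⟨?_, hp.1, trivial⟩
    rw [← hball]
    exact ⟨Metric.ball_subset_ball (min_le_right _ _) hp.2,
      Metric.ball_subset_ball (min_le_right _ _) hx⟩
  have hqt : q ∈ t := mem_of_mem_nhdsWithin hq.2 ht
  refine ⟨min r₀ r₁, lt_min hr₀ hr₁, K, ‖f q‖ + K * min r₀ r₁ + 1, ?_, ?_, ?_, ?_⟩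
  · have := lt_min hr₀ hr₁
    positivity
  · rw [hball]
    exact (Metric.ball_subset_ball (min_le_left _ _)).trans hr₀D
  · intro p hp
    have h1 : LipschitzOnWith 1 (fun x : E => (p, x)) (Metric.ball q.2 (min r₀ r₁)) :=
      (LipschitzWith.prodMk_left p).lipschitzOnWith
    have := hK.comp h1 (fun x hx => hmem p hp x hx)
    rwa [mul_one] at this
  · intro p hp x hx
    have h1 := hK.dist_le_mul _ (hmem p hp x hx) _ hqt
    have h2 : dist (p, x) q ≤ min r₀ r₁ := by
      have : (p, x) ∈ Metric.ball q (min r₀ r₁) := by rw [← hball]; exact ⟨hp.2, hx⟩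
      exact (Metric.mem_ball.1 this).le
    have h3 := norm_le_norm_add_norm_sub' (f (p, x)) (f q)
    rw [dist_eq_norm] at h1
    have h4 : (K : ℝ) * dist (p, x) q ≤ K * min r₀ r₁ := by gcongr
    linarith

/-- A function with zero derivative along a set of times that is convex is constant. -/
theorem Convex.eq_of_hasDerivWithinAt_zero {H : Type*} [NormedAddCommGroup H] [NormedSpace ℝ H]
    {s : Set ℝ} (hs : Convex ℝ s) {f : ℝ → H} (hf : ∀ x ∈ s, HasDerivWithinAt f 0 s x) {x y : ℝ}
    (hx : x ∈ s) (hy : y ∈ s) : f x = f y := by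
  have := hs.norm_image_sub_le_of_norm_hasDerivWithin_le (C := 0) hf (by simp) hy hx
  rw [zero_mul, norm_le_zero_iff, sub_eq_zero] at this
  exact this

end Characteristics

/-! ### The transport equation, solved along characteristics -/

section Transport

open Metric

universe u

open scoped NNReal in
/-- Integral curves of a vector field on `E × ℝ` that does not depend on the last coordinate, for
all parameters and initial points in a small box and for a common time. -/
theorem exists_integral_curves {F E : Type*} [NormedAddCommGroup F] [NormedSpace ℝ F]
    [NormedAddCommGroup E] [NormedSpace ℝ E] [CompleteSpace E] {S : Set F} {T : F × E → E × ℝ}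
    {q : F × E} {r : ℝ} (hr : 0 < r) {K : ℝ≥0} {M : ℝ} (hM : 0 < M)
    (hK : ∀ p ∈ S ∩ ball q.1 r, LipschitzOnWith K (fun x => T (p, x)) (ball q.2 r))
    (hTM : ∀ p ∈ S ∩ ball q.1 r, ∀ x ∈ ball q.2 r, ‖T (p, x)‖ ≤ M) :
    ∃ τ > 0, ∃ Γ : F → E → ℝ → E × ℝ, ∀ p ∈ S ∩ ball q.1 r, ∀ x ∈ ball q.2 (r / 2),
      Γ p x 0 = (x, 0) ∧ ∀ s ∈ Icc (-τ) τ,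
        HasDerivWithinAt (Γ p x) (T (p, (Γ p x s).1)) (Icc (-τ) τ) s ∧
        (Γ p x s).1 ∈ ball q.2 r ∧ ‖(Γ p x s).1 - x‖ ≤ M * |s| := by
  -- In time `τ = r / (3M)` a curve moves by at most `r / 3`. Since `r / 2 + r / 3 < r`, curves that
  -- start in the half ball stay where the bounds hold.
  set a : ℝ≥0 := ⟨r / 3, by positivity⟩ with ha
  have ha' : (a : ℝ) = r / 3 := rfl
  set τ : ℝ := r / (3 * M) with hτ
  have hτ0 : 0 < τ := by positivity
  refine ⟨τ, hτ0, ?_⟩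
  have hsub : ∀ x ∈ ball q.2 (r / 2), ∀ y ∈ closedBall ((x, 0) : E × ℝ) a, y.1 ∈ ball q.2 r := by
    intro x hx y hy
    rw [mem_closedBall, Prod.dist_eq] at hy
    have h1 : dist y.1 x ≤ r / 3 := (le_max_left _ _).trans hy
    rw [mem_ball] at hx ⊢
    linarith [dist_triangle y.1 x q.2]
  have key : ∀ p ∈ S ∩ ball q.1 r, ∀ x ∈ ball q.2 (r / 2), ∃ γ : ℝ → E × ℝ,
      γ 0 = (x, 0) ∧ ∀ s ∈ Icc (-τ) τ,
        HasDerivWithinAt γ (T (p, (γ s).1)) (Icc (-τ) τ) s ∧ (γ s).1 ∈ ball q.2 r ∧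
          ‖(γ s).1 - x‖ ≤ M * |s| := by
    intro p hp x hx
    have hPL : IsPicardLindelof (fun _ (y : E × ℝ) => T (p, y.1))
        (⟨0, by constructor <;> linarith⟩ : Icc (-τ) τ) (x, 0) a 0 ⟨M, hM.le⟩ K := by
      refine ⟨fun t _ => ?_, fun y _ => continuousOn_const, fun t _ y hy => ?_, ?_⟩
      · have h1 : LipschitzOnWith 1 (fun y : E × ℝ => y.1) (closedBall ((x, 0) : E × ℝ) a) :=
          LipschitzWith.prod_fst.lipschitzOnWith
        have := (hK p hp).comp h1 (hsub x hx)
        rwa [mul_one] at this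
      · exact hTM p hp _ (hsub x hx y hy)
      · simp only [sub_zero, zero_sub, neg_neg, max_self, ha', NNReal.coe_zero]
        rw [hτ]
        change M * (r / (3 * M)) ≤ r / 3
        apply le_of_eq
        field_simp
    obtain ⟨γ, hγ0, hγ⟩ := hPL.exists_forall_mem_closedBall (x := (x, 0)) (by simp)
    have hγ0' : γ 0 = (x, 0) := hγ0
    refine ⟨γ, hγ0', fun s hs => ⟨(hγ s hs).1, hsub x hx _ (hγ s hs).2, ?_⟩⟩
    have hd : ∀ s ∈ Icc (-τ) τ,
        HasDerivWithinAt (fun s => (γ s).1) (T (p, (γ s).1)).1 (Icc (-τ) τ) s :=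
      fun s hs => (hγ s hs).1.fst
    have := (convex_Icc (-τ) τ).norm_image_sub_le_of_norm_hasDerivWithin_le (C := M) hd
      (fun s hs => (norm_fst_le _).trans (hTM p hp _ (hsub x hx _ (hγ s hs).2)))
      (x := 0) (by constructor <;> linarith) hs
    rwa [hγ0', sub_zero, Real.norm_eq_abs] at this
  choose! Γ hΓ using key
  exact ⟨Γ, hΓ⟩

open scoped NNReal in
/-- The group law for the integral curves of a vector field on `E × ℝ` that does not depend on the
last coordinate. -/
theorem integral_curve_shift {E : Type*} [NormedAddCommGroup E] [NormedSpace ℝ E]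
    {T : E → E × ℝ} {B : Set E} {K : ℝ≥0} (hK : LipschitzOnWith K T B) {τ σ s : ℝ}
    {Γ Γ' : ℝ → E × ℝ}
    (hΓ : ∀ s ∈ Icc (-τ) τ, HasDerivWithinAt Γ (T (Γ s).1) (Icc (-τ) τ) s ∧ (Γ s).1 ∈ B)
    (hΓ' : ∀ s ∈ Icc (-τ) τ, HasDerivWithinAt Γ' (T (Γ' s).1) (Icc (-τ) τ) s ∧ (Γ' s).1 ∈ B)
    (h0 : Γ' 0 = ((Γ σ).1, 0)) (hs : |s| + |σ| < τ) :
    Γ' s = ((Γ (σ + s)).1, (Γ (σ + s)).2 - (Γ σ).2) := by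
  -- For `|t| ≤ ρ` both `t` and `σ + t` lie in the common time interval. As the field ignores the
  -- last coordinate, the shifted curve remains a solution after a constant is subtracted there, and
  -- uniqueness applies.
  set ρ := τ - |σ| with hρ
  have hρ0 : 0 < ρ := by linarith [abs_nonneg s]
  have hin : ∀ t ∈ Icc (-ρ) ρ, t ∈ Icc (-τ) τ := fun t ht =>
    ⟨by linarith [ht.1, abs_nonneg σ], by linarith [ht.2, abs_nonneg σ]⟩
  have hin' : ∀ t ∈ Icc (-ρ) ρ, σ + t ∈ Icc (-τ) τ := fun t ht =>
    ⟨by linarith [ht.1, neg_abs_le σ], by linarith [ht.2, le_abs_self σ]⟩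
  have hino : ∀ t ∈ Ioo (-ρ) ρ, Icc (-τ) τ ∈ 𝓝 t := fun t ht =>
    Icc_mem_nhds (by linarith [ht.1, abs_nonneg σ]) (by linarith [ht.2, abs_nonneg σ])
  have hino' : ∀ t ∈ Ioo (-ρ) ρ, Icc (-τ) τ ∈ 𝓝 (σ + t) := fun t ht =>
    Icc_mem_nhds (by linarith [ht.1, neg_abs_le σ]) (by linarith [ht.2, le_abs_self σ])
  have hd : ∀ t ∈ Ioo (-ρ) ρ, HasDerivAt (fun t => Γ (σ + t) - (0, (Γ σ).2))
      (T (Γ (σ + t)).1) t := by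
    intro t ht
    have := ((hΓ _ (hin' t (Ioo_subset_Icc_self ht))).1.hasDerivAt (hino' t ht)).comp_const_add
      σ t
    exact this.sub_const _
  have hc : ContinuousOn (fun t => Γ (σ + t) - (0, (Γ σ).2)) (Icc (-ρ) ρ) := by
    have h1 : ContinuousOn Γ (Icc (-τ) τ) := fun t ht => (hΓ t ht).1.continuousWithinAt
    exact (h1.comp (by fun_prop) hin').sub continuousOn_const
  have hc' : ContinuousOn Γ' (Icc (-ρ) ρ) := fun t ht =>
    (hΓ' t (hin t ht)).1.continuousWithinAt.mono hin
  have := ODE_solution_unique_of_mem_Icc (v := fun _ y => T y.1) (s := fun _ => B ×ˢ univ) (K := K)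
    (t₀ := 0) (a := -ρ) (b := ρ) (f := Γ') (g := fun t => Γ (σ + t) - (0, (Γ σ).2))
    (fun t _ => by
      have h1 : LipschitzOnWith 1 (fun y : E × ℝ => y.1) (B ×ˢ univ) :=
        LipschitzWith.prod_fst.lipschitzOnWith
      have := hK.comp h1 (fun y hy => hy.1)
      rwa [mul_one] at this)
    ⟨by linarith, hρ0⟩ hc'
    (fun t ht => (hΓ' t (hin t (Ioo_subset_Icc_self ht))).1.hasDerivAt (hino t ht))
    (fun t ht => ⟨(hΓ' t (hin t (Ioo_subset_Icc_self ht))).2, trivial⟩) hc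
    (fun t ht => by simpa using hd t ht)
    (fun t ht => ⟨by simpa using (hΓ _ (hin' t (Ioo_subset_Icc_self ht))).2, trivial⟩)
    (by
      rw [h0]
      ext <;> simp)
  have hs' : s ∈ Icc (-ρ) ρ := by
    rw [mem_Icc, ← abs_le]; linarith
  rw [this hs']
  ext <;> simp

/-- The method of characteristics with parameters, near a point of the initial hypersurface
`{ℓ = 0}`: the equation `T f = g` with `f = h` where `ℓ = 0`, for a vector field `T` with
`T ℓ = 1`. -/
theorem exists_transport {F : Type u} {E : Type} [NormedAddCommGroup F] [NormedSpace ℝ F]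
    [NormedAddCommGroup E] [NormedSpace ℝ E] [CompleteSpace E]
    [CompleteSpace F] {S : Set F} (hS : Convex ℝ S) (hSu : UniqueDiffOn ℝ S) {D : Set (F × E)}
    (hD : IsOpen D) {T : F × E → E} {g ℓ h : F × E → ℝ}
    (hT : ContDiffOn ℝ ∞ T (restrictBase S D)) (hg : ContDiffOn ℝ ∞ g (restrictBase S D))
    (hℓ : ContDiffOn ℝ ∞ ℓ (restrictBase S D)) (hh : ContDiffOn ℝ ∞ h (restrictBase S D))
    (hTℓ : ∀ q ∈ restrictBase S D, fderiv ℝ (fun y => ℓ (q.1, y)) q.2 (T q) = 1)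
    {q₀ : F × E} (hq₀ : q₀ ∈ restrictBase S D) (hℓ₀ : ℓ q₀ = 0) :
    ∃ (O : Set (F × E)) (f : F × E → ℝ) (C : ℝ), IsOpen O ∧ q₀ ∈ O ∧ O ⊆ D ∧ 0 ≤ C ∧
      ContDiffOn ℝ ∞ f (restrictBase S O) ∧
      (∀ q ∈ restrictBase S O, fderiv ℝ (fun y => f (q.1, y)) q.2 (T q) = g q) ∧
      (∀ q ∈ restrictBase S O, ℓ q = 0 → f q = h q) ∧
      ∀ q ∈ restrictBase S O, ∀ (B : Set E) (k : E → ℝ), closedBall q.2 (C * |ℓ q|) ⊆ B →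
        (∀ y ∈ B, DifferentiableAt ℝ k y) →
        (∀ y ∈ B, (q.1, y) ∈ D → fderiv ℝ k y (T (q.1, y)) = 0) →
        (∀ y ∈ B, (q.1, y) ∈ D → ℓ (q.1, y) = 0 → k y = 0) → k q.2 = 0 := by
  -- The function `g` becomes an extra component of the field, so that the last coordinate of an
  -- integral curve is the integral of `g` along it.
  have hTg : ContDiffOn ℝ ∞ (fun q => (T q, g q)) (restrictBase S D) := hT.prodMk hg
  obtain ⟨r, hr, K, M, hM, hbox, hK, hTM⟩ :=
    exists_box_lipschitzOnWith hS hD (hTg.of_le (by exact_mod_cast le_top)) hq₀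
  obtain ⟨τ, hτ, Γ, hΓ⟩ :=
    exists_integral_curves (T := fun q => (T q, g q)) hr hM hK hTM
  have hmem : ∀ p ∈ S ∩ ball q₀.1 r, ∀ x ∈ ball q₀.2 r, (p, x) ∈ restrictBase S D :=
    fun p hp x hx => mem_restrictBase.2 ⟨hbox ⟨hp.2, hx⟩, hp.1⟩
  -- the box where `|ℓ| < τ`
  obtain ⟨r', hr', hr'r, hr'ℓ⟩ : ∃ r' > 0, r' ≤ r / 2 ∧ ∀ p ∈ S ∩ ball q₀.1 r',
      ∀ x ∈ ball q₀.2 r', |ℓ (p, x)| < τ := by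
    have h1 := hℓ.continuousOn q₀ hq₀
    have h2 : ∀ᶠ q in 𝓝[restrictBase S D] q₀, |ℓ q| < τ := by
      refine (h1.abs).eventually_lt_const ?_
      simpa [hℓ₀] using hτ
    obtain ⟨ρ, hρ, hρ'⟩ := Metric.mem_nhdsWithin_iff.1 h2
    refine ⟨min ρ (r / 2), lt_min hρ (by positivity), min_le_right _ _, fun p hp x hx => ?_⟩
    refine hρ' ⟨?_, hmem p ⟨hp.1, ?_⟩ x ?_⟩
    · rw [← ball_prod_same (x := q₀.1) (y := q₀.2)]
      exact ⟨ball_subset_ball (min_le_left _ _) hp.2, ball_subset_ball (min_le_left _ _) hx⟩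
    · refine ball_subset_ball ?_ hp.2
      linarith [min_le_right ρ (r / 2)]
    · refine ball_subset_ball ?_ hx
      linarith [min_le_right ρ (r / 2)]
  set O : Set (F × E) := ball q₀.1 r' ×ˢ ball q₀.2 r' with hO
  have hOopen : IsOpen O := isOpen_ball.prod isOpen_ball
  have hOmem : ∀ q ∈ restrictBase S O, q.1 ∈ S ∩ ball q₀.1 r ∧ q.2 ∈ ball q₀.2 (r / 2) ∧
      |ℓ q| < τ := by
    intro q hq
    refine ⟨⟨hq.2.1, ball_subset_ball (by linarith) hq.1.1⟩, ball_subset_ball hr'r hq.1.2,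
      hr'ℓ q.1 ⟨hq.2.1, hq.1.1⟩ q.2 hq.1.2⟩
  have hcurve := fun q hq => hΓ q.1 (hOmem q hq).1 q.2 (hOmem q hq).2.1
  -- `ℓ` along the curves
  have hℓΓ : ∀ q ∈ restrictBase S O, ∀ s ∈ Icc (-τ) τ, ℓ (q.1, (Γ q.1 q.2 s).1) = ℓ q + s := by
    intro q hq s hs
    obtain ⟨h0, hc⟩ := hcurve q hq
    have hd : ∀ s ∈ Icc (-τ) τ, HasDerivWithinAt (fun s => ℓ (q.1, (Γ q.1 q.2 s).1) - s) 0
        (Icc (-τ) τ) s := by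
      intro s hs
      have hq' := hmem q.1 (hOmem q hq).1 _ (hc s hs).2.1
      have h1 : HasFDerivAt (fun y => ℓ (q.1, y)) _ (Γ q.1 q.2 s).1 :=
        ((hℓ.contDiffAt_slice hD hq').differentiableAt (by simp)).hasFDerivAt
      have h2 := h1.comp_hasDerivWithinAt s (hc s hs).1.fst
      have h3 := hTℓ _ hq'
      have h4 := h2.sub (hasDerivWithinAt_id s (Icc (-τ) τ))
      rw [h3, sub_self] at h4
      exact h4
    have := (convex_Icc (-τ) τ).eq_of_hasDerivWithinAt_zero hd hs
      (y := 0) (by constructor <;> linarith)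
    rw [h0] at this
    simp only [sub_zero, Prod.mk.eta] at this
    linarith
  have hneg : ∀ q ∈ restrictBase S O, -ℓ q ∈ Icc (-τ) τ := fun q hq => by
    rw [mem_Icc, ← abs_le, abs_neg]; exact (hOmem q hq).2.2.le
  -- Along a curve `ℓ` grows at unit speed, so the curve from `q` meets `{ℓ = 0}` at time `-ℓ q`.
  -- The value `f q` is `h` at the meeting point plus the integral of `g` from there back to `q`;
  -- the latter is minus the last coordinate.
  set f : F × E → ℝ := fun q => h (q.1, (Γ q.1 q.2 (-ℓ q)).1) - (Γ q.1 q.2 (-ℓ q)).2 with hf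
  have hfs : ContDiffOn ℝ ∞ f (restrictBase S O) := by
    have hOu : restrictBase S O = (S ∩ ball q₀.1 r') ×ˢ ball q₀.2 r' := by
      ext q
      simp only [restrictBase, hO, mem_inter_iff, mem_prod, mem_univ, and_true]
      tauto
    have hSr : UniqueDiffOn ℝ (S ∩ ball q₀.1 r') := hSu.inter isOpen_ball
    -- The meeting time depends on `q`. It is carried as a frozen coordinate that multiplies the
    -- field, so that all curves are evaluated at the fixed time one.
    have hΓs : ContDiffOn ℝ ∞ (fun q : F × E => ((q.1, (-ℓ q, Γ q.1 q.2 (1 * -ℓ q))) :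
        F × (ℝ × (E × ℝ)))) (restrictBase S O) := by
      refine contDiffOn_flow (s := 1)
        (γ := fun q s => ((q.1, (-ℓ q, Γ q.1 q.2 (s * -ℓ q))) : F × (ℝ × (E × ℝ))))
        (C := (S ∩ ball q₀.1 r) ×ˢ ((univ : Set ℝ) ×ˢ (ball q₀.2 r ×ˢ (univ : Set ℝ))))
        (V := fun z => (0, (0, z.2.1 • (T (z.1, z.2.2.1), g (z.1, z.2.2.1))))) ?_ ?_ ?_ ?_ ?_ ?_
        (by simp)
      · rw [hOu]; exact hSr.prod isOpen_ball.uniqueDiffOn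
      · exact (hS.inter (convex_ball _ _)).prod
          (convex_univ.prod ((convex_ball _ _).prod convex_univ))
      · exact (hSu.inter isOpen_ball).prod
          (uniqueDiffOn_univ.prod (isOpen_ball.uniqueDiffOn.prod uniqueDiffOn_univ))
      · refine contDiffOn_const.prodMk (contDiffOn_const.prodMk (ContDiffOn.fun_smul ?_ ?_))
        · exact (contDiff_fst.comp contDiff_snd).contDiffOn
        · exact hTg.comp (g := fun q => (T q, g q)) (f := fun z : F × (ℝ × (E × ℝ)) =>
            (z.1, z.2.2.1)) (by fun_prop) (fun z hz => hmem _ hz.1 _ hz.2.2.1)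
      · intro q hq s hs
        obtain ⟨h0, hc⟩ := hcurve q hq
        have hmaps : MapsTo (fun s => s * -ℓ q) (Icc 0 1) (Icc (-τ) τ) := by
          intro s hs
          have := hneg q hq
          constructor <;> nlinarith [hs.1, hs.2, this.1, this.2]
        refine ⟨?_, (hOmem q hq).1, trivial, (hc _ (hmaps hs)).2.1, trivial⟩
        refine (hasDerivWithinAt_const _ _ _).prodMk ((hasDerivWithinAt_const _ _ _).prodMk ?_)
        have h1 : HasDerivWithinAt (fun s : ℝ => s * -ℓ q) (-ℓ q) (Icc 0 1) s := by
          simpa using (hasDerivWithinAt_id s (Icc (0 : ℝ) 1)).mul_const (-ℓ q)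
        exact (hc _ (hmaps hs)).1.scomp s h1 hmaps
      · have hℓO : ContDiffOn ℝ ∞ ℓ (restrictBase S O) := hℓ.mono fun q hq =>
          hmem q.1 (hOmem q hq).1 q.2 (ball_subset_ball (by linarith) (hOmem q hq).2.1)
        refine (contDiff_fst.contDiffOn.prodMk (hℓO.neg.prodMk
          (contDiff_snd.contDiffOn.prodMk (contDiffOn_const (c := (0 : ℝ)))))).congr
          fun q hq => ?_
        simp only [zero_mul, (hcurve q hq).1]
    simp only [one_mul] at hΓs
    refine ContDiffOn.sub ?_ ?_
    · refine hh.comp (g := h) (f := fun q => (q.1, (Γ q.1 q.2 (-ℓ q)).1)) ?_ ?_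
      · exact contDiff_fst.contDiffOn.prodMk hΓs.snd.snd.fst
      · exact fun q hq => hmem _ (hOmem q hq).1 _ ((hcurve q hq).2 _ (hneg q hq)).2.1
    · exact hΓs.snd.snd.snd
  refine ⟨O, f, M, hOopen, ⟨mem_ball_self hr', mem_ball_self hr'⟩, ?_, hM.le, hfs, ?_, ?_, ?_⟩
  · exact (prod_mono (ball_subset_ball (by linarith)) (ball_subset_ball (by linarith))).trans hbox
  · intro q hq
    obtain ⟨h0, hc⟩ := hcurve q hq
    have hd0 : HasDerivAt (Γ q.1 q.2) (T q, g q) 0 := by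
      have := (hc 0 (by constructor <;> linarith)).1.hasDerivAt (Icc_mem_nhds (by linarith) hτ)
      simpa [h0] using this
    have hfd : DifferentiableAt ℝ (fun y => f (q.1, y)) (Γ q.1 q.2 0).1 := by
      rw [h0]
      exact (hfs.contDiffAt_slice hOopen hq).differentiableAt (by simp)
    have h1 := hfd.hasFDerivAt.comp_hasDerivAt 0 hd0.fst
    -- By the group law all points of a curve share the same meeting point, so `f` changes along it
    -- exactly by the integral of `g`. Differentiating at `s = 0` gives the equation.
    have h2 : (fun s => f (q.1, (Γ q.1 q.2 s).1)) =ᶠ[𝓝 0] fun s => f q + (Γ q.1 q.2 s).2 := by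
      have hcont : Filter.Tendsto (fun s => (Γ q.1 q.2 s).1) (𝓝 0) (𝓝 q.2) := by
        have := hd0.continuousAt.fst.tendsto
        simpa [h0] using this
      have e1 : ∀ᶠ s in 𝓝 (0 : ℝ), (Γ q.1 q.2 s).1 ∈ ball q₀.2 r' :=
        hcont.eventually_mem (isOpen_ball.mem_nhds hq.1.2)
      have e2 : ∀ᶠ s in 𝓝 (0 : ℝ), |ℓ q + s| + |s| < τ := by
        have : Filter.Tendsto (fun s => |ℓ q + s| + |s|) (𝓝 0) (𝓝 (|ℓ q + 0| + |0|)) :=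
          Continuous.tendsto (by fun_prop) 0
        refine this.eventually_lt_const ?_
        simpa using (hOmem q hq).2.2
      filter_upwards [e1, e2] with s hs1 hs2
      have hq' : (q.1, (Γ q.1 q.2 s).1) ∈ restrictBase S O := ⟨⟨hq.1.1, hs1⟩, hq.2⟩
      have hsτ : s ∈ Icc (-τ) τ := by
        rw [mem_Icc, ← abs_le]; linarith [abs_nonneg (ℓ q + s)]
      have hℓs := hℓΓ q hq s hsτ
      have := integral_curve_shift (hK q.1 (hOmem q hq).1) (τ := τ) (σ := s)
        (s := -ℓ (q.1, (Γ q.1 q.2 s).1)) (Γ := Γ q.1 q.2) (Γ' := Γ q.1 (Γ q.1 q.2 s).1)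
        (fun s hs => ⟨(hc s hs).1, (hc s hs).2.1⟩)
        (fun s hs => ⟨((hcurve _ hq').2 s hs).1, ((hcurve _ hq').2 s hs).2.1⟩)
        (hcurve _ hq').1 (by rw [hℓs, abs_neg]; exact hs2)
      simp only [hf, this]
      rw [hℓs, show s + -(ℓ q + s) = -ℓ q by ring]
      ring
    have h3 : HasDerivAt (fun s => f q + (Γ q.1 q.2 s).2) (g q) 0 := hd0.snd.const_add (f q)
    have h4 := (h3.congr_of_eventuallyEq h2).unique h1
    rw [h0] at h4
    exact h4.symm
  · intro q hq hq0
    have := (hcurve q hq).1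
    simp [hf, hq0, this]
  -- A function annihilated by `T` is constant along the curve from `q` to `{ℓ = 0}`. That piece
  -- takes time `|ℓ q|` at speed at most `M`, so it lies in the ball of radius `M |ℓ q|`; hence `C =
  -- M`.
  · intro q hq B k hB hk hkT hk0
    obtain ⟨h0, hc⟩ := hcurve q hq
    have hsub : uIcc (-ℓ q) 0 ⊆ Icc (-τ) τ :=
      uIcc_subset_Icc (hneg q hq) (by constructor <;> linarith)
    have hinB : ∀ s ∈ uIcc (-ℓ q) 0, (Γ q.1 q.2 s).1 ∈ B := by
      intro s hs
      refine hB ?_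
      rw [mem_closedBall, dist_eq_norm]
      refine (hc s (hsub hs)).2.2.trans ?_
      refine mul_le_mul_of_nonneg_left ?_ hM.le
      have := abs_sub_right_of_mem_uIcc hs
      simpa using this
    have hinD := fun s (hs : s ∈ uIcc (-ℓ q) 0) =>
      (hmem q.1 (hOmem q hq).1 _ (hc s (hsub hs)).2.1)
    have hd : ∀ s ∈ uIcc (-ℓ q) 0,
        HasDerivWithinAt (fun s => k (Γ q.1 q.2 s).1) 0 (uIcc (-ℓ q) 0) s := by
      intro s hs
      have h1 := (hk _ (hinB s hs)).hasFDerivAt.comp_hasDerivWithinAt s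
        ((hc s (hsub hs)).1.mono hsub).fst
      have h3 := hkT _ (hinB s hs) (hinD s hs).1
      rw [h3] at h1
      exact h1
    have h1 := (convex_uIcc (-ℓ q) 0).eq_of_hasDerivWithinAt_zero hd right_mem_uIcc left_mem_uIcc
    rw [h0] at h1
    refine h1.trans (hk0 _ (hinB _ left_mem_uIcc) (hinD _ left_mem_uIcc).1 ?_)
    rw [hℓΓ q hq _ (hneg q hq)]; ring

end Transport

/-! ### Calculus and linear algebra of contact forms on a vector space -/

section FlatForms

open Metric

variable {E : Type*} [NormedAddCommGroup E] [NormedSpace ℝ E]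

theorem flatD_eq {α : E → E →L[ℝ] ℝ} {y : E} (hα : DifferentiableAt ℝ α y) (v w : E) :
    flatD α y v w = fderiv ℝ α y v w - fderiv ℝ α y w v := by
  have h1 : DifferentiableAt ℝ
      (fun z => ContinuousAlternatingMap.ofSubsingleton ℝ E ℝ (0 : Fin 1) (α z)) y :=
    (ContinuousAlternatingMap.ofSubsingletonLIE (𝕜 := ℝ) (E := E) (F := ℝ)
      (0 : Fin 1)).differentiableAt.comp y hα
  have h2 : ∀ u, fderiv ℝ (fun z => α z u) y = (fderiv ℝ α y).flip u := fun u =>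
    (((ContinuousLinearMap.apply ℝ ℝ u).hasFDerivAt).comp y hα.hasFDerivAt).fderiv
  rw [flatD, extDeriv_apply h1]
  simp [Fin.sum_univ_two, Fin.removeNth, h2, sub_eq_add_neg]

/-- Cartan's formula. -/
theorem flatLie_eq {X : E → E} {α : E → E →L[ℝ] ℝ} {y : E} (hX : DifferentiableAt ℝ X y)
    (hα : DifferentiableAt ℝ α y) (v : E) :
    flatLie X α y v = fderiv ℝ (fun z => α z (X z)) y v + flatD α y (X y) v := by
  rw [flatD_eq hα, fderiv_clm_apply hα hX, flatLie]
  simp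
  ring

theorem flatD_swap {α : E → E →L[ℝ] ℝ} {y : E} (hα : DifferentiableAt ℝ α y) (v w : E) :
    flatD α y v w = -flatD α y w v := by
  rw [flatD_eq hα, flatD_eq hα]; ring

/-- The fibre derivative is the total derivative within the set, restricted to vectors tangent to
the fibre. The total one is smooth because the set has unique derivatives. -/
theorem ContDiffOn.fderiv_slice {F H : Type*} [NormedAddCommGroup F] [NormedSpace ℝ F]
    [NormedAddCommGroup H] [NormedSpace ℝ H]
    {S : Set F} (hS : UniqueDiffOn ℝ S) {D : Set (F × E)} (hD : IsOpen D) {f : F × E → H}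
    (hf : ContDiffOn ℝ ∞ f (restrictBase S D)) :
    ContDiffOn ℝ ∞ (fun q => fderiv ℝ (fun y => f (q.1, y)) q.2) (restrictBase S D) := by
  have hu : UniqueDiffOn ℝ (restrictBase S D) := by
    rw [restrictBase, inter_comm]
    exact (hS.prod uniqueDiffOn_univ).inter hD
  have h1 : ContDiffOn ℝ ∞ (fderivWithin ℝ f (restrictBase S D)) (restrictBase S D) :=
    hf.fderivWithin hu (by simp)
  have h2 : ContDiffOn ℝ ∞ (fun q => (fderivWithin ℝ f (restrictBase S D) q).comp
      (ContinuousLinearMap.inr ℝ F E)) (restrictBase S D) := h1.clm_comp contDiffOn_const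
  refine h2.congr fun q hq => ?_
  have h3 : HasFDerivWithinAt f (fderivWithin ℝ f (restrictBase S D) q) (restrictBase S D)
      (q.1, q.2) := (hf.differentiableOn (by simp) q hq).hasFDerivWithinAt
  have h4 : HasFDerivWithinAt (fun y : E => (q.1, y)) (ContinuousLinearMap.inr ℝ F E)
      ((fun y => (q.1, y)) ⁻¹' D) q.2 :=
    (hasFDerivAt_prodMk_right q.1 q.2).hasFDerivWithinAt
  have h5 := h3.comp q.2 h4 (fun y hy => ⟨hy, hq.2.1, trivial⟩)
  exact (h5.hasFDerivAt ((hD.preimage (by fun_prop)).mem_nhds hq.1)).fderiv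

/-- The bilinear form `dα + α ⊗ α`, for `A` the derivative of `α`. -/
noncomputable def contactMap (a : E →L[ℝ] ℝ) (A : E →L[ℝ] E →L[ℝ] ℝ) : E →L[ℝ] E →L[ℝ] ℝ :=
  A - A.flip + a.smulRight a

theorem contactMap_apply (a : E →L[ℝ] ℝ) (A : E →L[ℝ] E →L[ℝ] ℝ) (v w : E) :
    contactMap a A v w = A v w - A w v + a v * a w := by
  simp [contactMap]

theorem contactMap_fderiv {α : E → E →L[ℝ] ℝ} {y : E} (hα : DifferentiableAt ℝ α y) (v w : E) :
    contactMap (α y) (fderiv ℝ α y) v w = flatD α y v w + α y v * α y w := by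
  rw [contactMap_apply, flatD_eq hα]

/-- Pairing a kernel vector with itself gives `α(v)² = 0`, since `dα` is alternating. So `v` lies in
the contact plane and is `dα`-orthogonal to it. -/
theorem contactMap_injective {α : E → E →L[ℝ] ℝ} {y : E} (hα : DifferentiableAt ℝ α y)
    (hc : IsFlatContactAt α y) : Function.Injective (contactMap (α y) (fderiv ℝ α y)) := by
  rw [injective_iff_map_eq_zero]
  intro v hv
  have h1 : ∀ w, flatD α y v w + α y v * α y w = 0 := fun w => by
    rw [← contactMap_fderiv hα, hv]; rfl
  have h2 : α y v = 0 := by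
    have := h1 v
    rw [flatD_eq hα, sub_self, zero_add, mul_self_eq_zero] at this
    exact this
  exact hc.2 v h2 fun w _ => by simpa [h2] using h1 w

theorem exists_equiv_contactMap [FiniteDimensional ℝ E] {α : E → E →L[ℝ] ℝ} {y : E}
    (hα : DifferentiableAt ℝ α y) (hc : IsFlatContactAt α y) :
    ∃ e : E ≃L[ℝ] (E →L[ℝ] ℝ), (e : E →L[ℝ] E →L[ℝ] ℝ) = contactMap (α y) (fderiv ℝ α y) := by
  have hfin : Module.finrank ℝ E = Module.finrank ℝ (E →L[ℝ] ℝ) := by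
    rw [← (LinearMap.toContinuousLinearMap (𝕜 := ℝ) (E := E) (F' := ℝ)).finrank_eq]
    exact (Subspace.dual_finrank_eq (K := ℝ) (V := E)).symm
  refine ⟨(LinearEquiv.ofInjectiveOfFinrankEq
    (contactMap (α y) (fderiv ℝ α y)).toLinearMap (contactMap_injective hα hc)
      hfin).toContinuousLinearEquiv, ?_⟩
  ext v w
  rfl

/-- The vector that `dα + α ⊗ α` maps to `α` is the Reeb vector of a contact form. -/
theorem flat_reeb {α : E → E →L[ℝ] ℝ} {y : E} (hα : DifferentiableAt ℝ α y)
    {R : E} (hR : contactMap (α y) (fderiv ℝ α y) R = α y) (h0 : α y R ≠ 0) :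
    α y R = 1 ∧ ∀ w, flatD α y R w = 0 := by
  have h1 : ∀ w, flatD α y R w + α y R * α y w = α y w := fun w => by
    rw [← contactMap_fderiv hα, hR]
  have h2 : α y R = 1 := by
    have := h1 R
    rw [flatD_eq hα, sub_self, zero_add] at this
    exact mul_left_cancel₀ h0 (by linarith)
  refine ⟨h2, fun w => ?_⟩
  have := h1 w
  rw [h2] at this
  linarith

/-- If `α(R) = 0`, then `R` lies in the contact plane and `dα(R, ·) = α` vanishes on it.
Nondegeneracy forces `R = 0`, hence `α = 0`. -/
theorem flat_reeb_ne_zero {α : E → E →L[ℝ] ℝ} {y : E} (hα : DifferentiableAt ℝ α y)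
    (hc : IsFlatContactAt α y) {R : E} (hR : contactMap (α y) (fderiv ℝ α y) R = α y) :
    α y R ≠ 0 := by
  intro h0
  have h1 : ∀ w, flatD α y R w + α y R * α y w = α y w := fun w => by
    rw [← contactMap_fderiv hα, hR]
  have : R = 0 := hc.2 R h0 fun w hw => by
    have := h1 w
    rw [hw, h0] at this
    linarith
  rw [this, map_zero] at hR
  exact hc.1 hR.symm

/-- The algebraic part of the solution of `L_X α + β = 0` with `α(X) = c`. -/
theorem contactMap_eq_iff {α : E → E →L[ℝ] ℝ} {y : E} (hα : DifferentiableAt ℝ α y) {R : E}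
    (hR1 : α y R = 1) (hR : ∀ w, flatD α y R w = 0) {X : E} {c : ℝ} {df b : E →L[ℝ] ℝ}
    (hdf : df R = -b R) :
    contactMap (α y) (fderiv ℝ α y) X = c • α y - df - b ↔
      α y X = c ∧ ∀ w, df w + flatD α y X w + b w = 0 := by
  constructor
  · intro h
    have h1 : ∀ w, flatD α y X w + α y X * α y w = c * α y w - df w - b w := fun w => by
      rw [← contactMap_fderiv hα, h]; simp
    -- Pairing with `R` removes the `dα` term, and the transport equation `hdf` cancels `df` against
    -- `b`: this is the compatibility condition that makes `c` equal to `α(X)`.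
    have h2 : α y X = c := by
      have := h1 R
      rw [flatD_swap hα, hR, hR1, hdf] at this
      linarith
    refine ⟨h2, fun w => ?_⟩
    have := h1 w
    rw [h2] at this
    linarith
  · rintro ⟨h1, h2⟩
    ext w
    rw [contactMap_fderiv hα, h1]
    simp only [sub_apply, smul_apply, smul_eq_mul]
    linarith [h2 w]

/-- The exterior derivative commutes with pullback. -/
theorem flatD_pullback {E' : Type*} [NormedAddCommGroup E'] [NormedSpace ℝ E'] {ψ : E' → E}
    {α : E → E →L[ℝ] ℝ} {y : E'} (hψ : ContDiffAt ℝ 2 ψ y) (hα : DifferentiableAt ℝ α (ψ y))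
    (v w : E') :
    flatD (fun z => (α (ψ z)).comp (fderiv ℝ ψ z)) y v w =
      flatD α (ψ y) (fderiv ℝ ψ y v) (fderiv ℝ ψ y w) := by
  have h1 : DifferentiableAt ℝ (fderiv ℝ ψ) y :=
    (hψ.fderiv_right (m := 1) (by norm_num)).differentiableAt one_ne_zero
  have h2 : DifferentiableAt ℝ ψ y := hψ.differentiableAt two_ne_zero
  have h3 : HasFDerivAt (fun z => α (ψ z)) ((fderiv ℝ α (ψ y)).comp (fderiv ℝ ψ y)) y :=
    hα.hasFDerivAt.comp y h2.hasFDerivAt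
  have h4 := h3.clm_comp h1.hasFDerivAt
  -- The second derivatives of `ψ` enter the two halves of `dα` alike and cancel.
  have h5 : IsSymmSndFDerivAt ℝ ψ y := hψ.isSymmSndFDerivAt (by simp)
  rw [flatD_eq h4.differentiableAt, flatD_eq hα, h4.fderiv]
  have h6 := h5.eq v w
  simp [h6]

/-- Naturality of the Lie derivative. -/
theorem flatLie_pullback {E' : Type*} [NormedAddCommGroup E'] [NormedSpace ℝ E'] {ψ : E' → E}
    {α : E → E →L[ℝ] ℝ} {X' : E' → E'} {X : E → E} {y : E'} (hψ : ContDiffAt ℝ 2 ψ y)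
    (hα : DifferentiableAt ℝ α (ψ y)) (hX : DifferentiableAt ℝ X (ψ y))
    (hX' : DifferentiableAt ℝ X' y) (hXX' : ∀ᶠ z in 𝓝 y, fderiv ℝ ψ z (X' z) = X (ψ z))
    (v : E') :
    flatLie X' (fun z => (α (ψ z)).comp (fderiv ℝ ψ z)) y v =
      flatLie X α (ψ y) (fderiv ℝ ψ y v) := by
  have h1 : DifferentiableAt ℝ (fderiv ℝ ψ) y :=
    (hψ.fderiv_right (m := 1) (by norm_num)).differentiableAt one_ne_zero
  have h2 : DifferentiableAt ℝ ψ y := hψ.differentiableAt two_ne_zero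
  have h3 : DifferentiableAt ℝ (fun z => (α (ψ z)).comp (fderiv ℝ ψ z)) y :=
    (hα.comp y h2).clm_comp h1
  have h4 : (fun z => (α (ψ z)).comp (fderiv ℝ ψ z) (X' z)) =ᶠ[𝓝 y]
      (fun z => α z (X z)) ∘ ψ := by
    filter_upwards [hXX'] with z hz
    simp [hz]
  rw [flatLie_eq hX' h3, flatLie_eq hX hα, flatD_pullback hψ hα, h4.fderiv_eq, hXX'.self_of_nhds,
    fderiv_comp y (hα.clm_apply hX) h2]
  simp

theorem flatD_congr {α α' : E → E →L[ℝ] ℝ} {y : E} (h : α =ᶠ[𝓝 y] α') (v w : E) :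
    flatD α y v w = flatD α' y v w := by
  unfold flatD
  rw [Filter.EventuallyEq.extDeriv_eq]
  filter_upwards [h] with z hz
  rw [hz]

theorem flatLie_congr {α α' : E → E →L[ℝ] ℝ} {X X' : E → E} {y : E} (h : α =ᶠ[𝓝 y] α')
    (hX : X =ᶠ[𝓝 y] X') (v : E) : flatLie X α y v = flatLie X' α' y v := by
  rw [flatLie, flatLie, h.fderiv_eq, hX.fderiv_eq, h.self_of_nhds, hX.self_of_nhds]

end FlatForms

/-! ### The Lie equation on a vector space: existence and uniqueness -/

section FlatSolution

open Metric

universe u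

theorem exists_isOpen_forall_restrictBase {F E : Type*} [TopologicalSpace F] [TopologicalSpace E]
    {S : Set F} {D : Set (F × E)} (hD : IsOpen D) {q₀ : F × E} (hq₀ : q₀ ∈ D)
    {P : F × E → Prop} (h : ∀ᶠ q in 𝓝[restrictBase S D] q₀, P q) :
    ∃ D' ⊆ D, IsOpen D' ∧ q₀ ∈ D' ∧ ∀ q ∈ restrictBase S D', P q := by
  obtain ⟨U, hU, hqU, h⟩ := mem_nhdsWithin.1 h
  exact ⟨D ∩ U, inter_subset_left, hD.inter hU, ⟨hq₀, hqU⟩, fun q hq =>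
    h ⟨hq.1.2, hq.1.1, hq.2⟩⟩

/-- The equation `L_X α + β = 0` on the set `B` of a normed space, together with the initial
condition `α(X) = h` where `ℓ = 0`. -/
def IsFlatSolution {E : Type*} [NormedAddCommGroup E] [NormedSpace ℝ E]
    (α β : E → E →L[ℝ] ℝ) (ℓ h : E → ℝ) (X : E → E) (B : Set E) : Prop :=
  ∀ y ∈ B, DifferentiableAt ℝ X y ∧ (∀ v, flatLie X α y v + β y v = 0) ∧
    (ℓ y = 0 → α y (X y) = h y)

variable {F : Type u} {E : Type} [NormedAddCommGroup F] [NormedSpace ℝ F] [CompleteSpace F]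
  [NormedAddCommGroup E] [NormedSpace ℝ E] [FiniteDimensional ℝ E]

/-- Local solutions, with parameters, of `L_X α + β = 0` with prescribed `α(X)` on a hypersurface
`{ℓ = 0}` that is transverse to the Reeb field. -/
theorem exists_flat_solution {S : Set F} (hS : Convex ℝ S) (hSu : UniqueDiffOn ℝ S)
    {D : Set (F × E)} (hD : IsOpen D) {a b : F × E → E →L[ℝ] ℝ} {ℓ h : F × E → ℝ}
    (ha : ContDiffOn ℝ ∞ a (restrictBase S D)) (hb : ContDiffOn ℝ ∞ b (restrictBase S D))
    (hℓ : ContDiffOn ℝ ∞ ℓ (restrictBase S D)) (hh : ContDiffOn ℝ ∞ h (restrictBase S D))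
    {q₀ : F × E} (hq₀ : q₀ ∈ restrictBase S D) (hℓ₀ : ℓ q₀ = 0)
    (hc : IsFlatContactAt (fun y => a (q₀.1, y)) q₀.2)
    (htr : ∀ v, a q₀ v = 1 → (∀ w, flatD (fun y => a (q₀.1, y)) q₀.2 v w = 0) →
      fderiv ℝ (fun y => ℓ (q₀.1, y)) q₀.2 v ≠ 0) :
    ∃ (O : Set (F × E)) (X : F × E → E) (C : ℝ), IsOpen O ∧ q₀ ∈ O ∧ O ⊆ D ∧ 0 ≤ C ∧
      ContDiffOn ℝ ∞ X (restrictBase S O) ∧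
      (∀ q ∈ restrictBase S O, IsFlatSolution (fun y => a (q.1, y)) (fun y => b (q.1, y))
        (fun y => ℓ (q.1, y)) (fun y => h (q.1, y)) (fun y => X (q.1, y)) {q.2}) ∧
      (∀ q ∈ restrictBase S O, ∀ y ∈ closedBall q.2 (C * |ℓ q|), (q.1, y) ∈ D) ∧
      ∀ q ∈ restrictBase S O, ∀ (B : Set E) (X' : E → E), IsOpen B →
        closedBall q.2 (C * |ℓ q|) ⊆ B →
        IsFlatSolution (fun y => a (q.1, y)) (fun y => b (q.1, y))
          (fun y => ℓ (q.1, y)) (fun y => h (q.1, y)) X' B → X' q.2 = X q := by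
  have : CompleteSpace E := FiniteDimensional.complete ℝ E
  have hda : ∀ q ∈ restrictBase S D, DifferentiableAt ℝ (fun y => a (q.1, y)) q.2 :=
    fun q hq => (ha.contDiffAt_slice hD hq).differentiableAt (by simp)
  set A : F × E → E →L[ℝ] E →L[ℝ] ℝ := fun q => fderiv ℝ (fun y => a (q.1, y)) q.2 with hA
  have hAs : ContDiffOn ℝ ∞ A (restrictBase S D) := ha.fderiv_slice hSu hD
  set β : F × E → E →L[ℝ] E →L[ℝ] ℝ := fun q => contactMap (a q) (A q) with hβ
  have hβs : ContDiffOn ℝ ∞ β (restrictBase S D) := by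
    have hflip : ContDiff ℝ ∞ fun B : E →L[ℝ] E →L[ℝ] ℝ => B.flip :=
      ContinuousLinearMap.contDiff (𝕜 := ℝ) (E := E →L[ℝ] E →L[ℝ] ℝ) (F := E →L[ℝ] E →L[ℝ] ℝ)
        (ContinuousLinearMap.flipₗᵢ ℝ E E ℝ).toContinuousLinearEquiv.toContinuousLinearMap
    exact (hAs.sub (hflip.comp_contDiffOn hAs)).add (ha.smulRight ha)
  obtain ⟨e₀, he₀⟩ := exists_equiv_contactMap (hda q₀ hq₀) hc
  have he₀' : (e₀ : E →L[ℝ] E →L[ℝ] ℝ) = β q₀ := he₀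
  -- invertibility near `q₀`
  obtain ⟨D₁, hD₁D, hD₁, hq₁, hinv⟩ : ∃ D₁ ⊆ D, IsOpen D₁ ∧ q₀ ∈ D₁ ∧
      ∀ q ∈ restrictBase S D₁, ∃ e : E ≃L[ℝ] (E →L[ℝ] ℝ), (e : E →L[ℝ] E →L[ℝ] ℝ) = β q := by
    refine exists_isOpen_forall_restrictBase hD hq₀.1 ?_
    have h1 := hβs.continuousOn q₀ hq₀
    have h2 := ContinuousLinearEquiv.nhds e₀
    rw [he₀'] at h2
    exact h1.eventually_mem h2
  have hsub₁ : restrictBase S D₁ ⊆ restrictBase S D := restrictBase_mono subset_rfl hD₁D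
  set J : F × E → (E →L[ℝ] ℝ) →L[ℝ] E := fun q => (β q).inverse with hJ
  have hJs : ContDiffOn ℝ ∞ J (restrictBase S D₁) := by
    intro q hq
    obtain ⟨e, he⟩ := hinv q hq
    have h1 : ContDiffAt ℝ ∞ ContinuousLinearMap.inverse (β q) := by
      rw [← he]; exact contDiffAt_map_inverse e
    exact h1.comp_contDiffWithinAt q ((hβs.mono hsub₁) q hq)
  have hβJ : ∀ q ∈ restrictBase S D₁, ∀ w, β q (J q w) = w := by
    intro q hq w
    obtain ⟨e, he⟩ := hinv q hq
    simp only [hJ, ← he, ContinuousLinearMap.inverse_equiv]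
    exact e.apply_symm_apply w
  have hJβ : ∀ q ∈ restrictBase S D₁, ∀ v, J q (β q v) = v := by
    intro q hq v
    obtain ⟨e, he⟩ := hinv q hq
    simp only [hJ, ← he, ContinuousLinearMap.inverse_equiv]
    exact e.symm_apply_apply v
  set R : F × E → E := fun q => J q (a q) with hR
  have hRs : ContDiffOn ℝ ∞ R (restrictBase S D₁) := hJs.clm_apply (ha.mono hsub₁)
  set dℓ : F × E → E →L[ℝ] ℝ := fun q => fderiv ℝ (fun y => ℓ (q.1, y)) q.2 with hdℓ
  have hdℓs : ContDiffOn ℝ ∞ dℓ (restrictBase S D) := hℓ.fderiv_slice hSu hD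
  have hq₁' : q₀ ∈ restrictBase S D₁ := ⟨hq₁, hq₀.2⟩
  have hR₀ : a q₀ (R q₀) ≠ 0 := flat_reeb_ne_zero (hda q₀ hq₀) hc (hβJ q₀ hq₁' _)
  have hR₀' := flat_reeb (hda q₀ hq₀) (hβJ q₀ hq₁' _) hR₀
  -- the Reeb field near `q₀`
  obtain ⟨D₂, hD₂D₁, hD₂, hq₂, hne⟩ : ∃ D₂ ⊆ D₁, IsOpen D₂ ∧ q₀ ∈ D₂ ∧
      ∀ q ∈ restrictBase S D₂, a q (R q) ≠ 0 ∧ dℓ q (R q) ≠ 0 := by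
    refine exists_isOpen_forall_restrictBase hD₁ hq₁ (Filter.Eventually.and ?_ ?_)
    · exact ((ha.mono hsub₁).clm_apply hRs).continuousOn q₀ hq₁' |>.eventually_ne hR₀
    · refine ((hdℓs.mono hsub₁).clm_apply hRs).continuousOn q₀ hq₁' |>.eventually_ne ?_
      exact htr _ hR₀'.1 hR₀'.2
  have hsub₂ : restrictBase S D₂ ⊆ restrictBase S D₁ := restrictBase_mono subset_rfl hD₂D₁
  have hsub₂' : restrictBase S D₂ ⊆ restrictBase S D := hsub₂.trans hsub₁
  have hreeb : ∀ q ∈ restrictBase S D₂, a q (R q) = 1 ∧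
      ∀ w, flatD (fun y => a (q.1, y)) q.2 (R q) w = 0 := fun q hq =>
    flat_reeb (hda q (hsub₂' hq)) (hβJ q (hsub₂ hq) _) (hne q hq).1
  have hRs₂ := hRs.mono hsub₂
  have hdℓR : ContDiffOn ℝ ∞ (fun q => (dℓ q (R q))⁻¹) (restrictBase S D₂) :=
    ((hdℓs.mono hsub₂').clm_apply hRs₂).inv fun q hq => (hne q hq).2
  -- Transversality means `dℓ(R) ≠ 0`. Dividing `R` by it normalises `T ℓ = 1`, and dividing the
  -- right-hand side by the same factor leaves the equation `df(R) = -b(R)`.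
  obtain ⟨O, f, C, hO, hqO, hOD, hC, hfs, hfT, hf0, hun⟩ := exists_transport hS hSu hD₂
    (T := fun q => (dℓ q (R q))⁻¹ • R q) (g := fun q => -((dℓ q (R q))⁻¹ * b q (R q))) (ℓ := ℓ)
    (h := h) (hdℓR.smul hRs₂) (hdℓR.mul ((hb.mono hsub₂').clm_apply hRs₂)).neg
    (hℓ.mono hsub₂') (hh.mono hsub₂') (fun q hq => by
      rw [map_smul, smul_eq_mul]
      exact inv_mul_cancel₀ (hne q hq).2) (q₀ := q₀) ⟨hq₂, hq₀.2⟩ hℓ₀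
  have hsubO : restrictBase S O ⊆ restrictBase S D₂ := restrictBase_mono subset_rfl hOD
  set df : F × E → E →L[ℝ] ℝ := fun q => fderiv ℝ (fun y => f (q.1, y)) q.2 with hdf
  have hdfs : ContDiffOn ℝ ∞ df (restrictBase S O) := hfs.fderiv_slice hSu hO
  have hdfR : ∀ q ∈ restrictBase S O, df q (R q) = -b q (R q) := by
    intro q hq
    have h1 := hfT q hq
    have h2 := (hne q (hsubO hq)).2
    rw [map_smul, smul_eq_mul] at h1
    change (dℓ q (R q))⁻¹ * df q (R q) = _ at h1
    field_simp at h1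
    exact h1
  set X : F × E → E := fun q => J q (f q • a q - df q - b q) with hX
  have hXs : ContDiffOn ℝ ∞ X (restrictBase S O) := by
    refine (hJs.mono (hsubO.trans hsub₂)).clm_apply ?_
    exact ((hfs.smul (ha.mono (hsubO.trans hsub₂'))).sub hdfs).sub
      (hb.mono (hsubO.trans hsub₂'))
  have hXf : ∀ q ∈ restrictBase S O, a q (X q) = f q ∧
      ∀ w, df q w + flatD (fun y => a (q.1, y)) q.2 (X q) w + b q w = 0 := by
    intro q hq
    have h2 := hreeb q (hsubO hq)
    exact (contactMap_eq_iff (hda q (hsub₂' (hsubO hq))) h2.1 h2.2 (hdfR q hq)).1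
      (hβJ q (hsub₂ (hsubO hq)) _)
  -- shrink `O` so that the relevant balls remain in it
  obtain ⟨O', hO'O, hO', hqO', hball⟩ : ∃ O' ⊆ O, IsOpen O' ∧ q₀ ∈ O' ∧
      ∀ q ∈ restrictBase S O', ∀ y ∈ closedBall q.2 (C * |ℓ q|), (q.1, y) ∈ O := by
    refine exists_isOpen_forall_restrictBase hO hqO ?_
    obtain ⟨r, hr, hrO⟩ := Metric.isOpen_iff.1 hO q₀ hqO
    have h1 : ContinuousWithinAt (fun q => C * |ℓ q| + dist q q₀) (restrictBase S O) q₀ := by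
      have h2 := (hℓ.mono (hsubO.trans hsub₂')).continuousOn q₀ ⟨hqO, hq₀.2⟩
      exact (continuousWithinAt_const.mul h2.abs).add (by fun_prop)
    filter_upwards [h1.eventually_lt_const (show C * |ℓ q₀| + dist q₀ q₀ < r by
      simpa [hℓ₀] using hr)] with q hq y hy
    refine hrO ?_
    rw [mem_closedBall] at hy
    have h3 : dist (q.1, y) q = dist y q.2 := by
      rw [Prod.dist_eq]; simp
    rw [mem_ball]
    linarith [dist_triangle (q.1, y) q q₀]
  have hsubO' : restrictBase S O' ⊆ restrictBase S O := restrictBase_mono subset_rfl hO'O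
  refine ⟨O', X, C, hO', hqO', hO'O.trans (hOD.trans (hD₂D₁.trans hD₁D)), hC,
    hXs.mono hsubO', ?_, ?_, ?_⟩
  · rintro q hq' y (rfl : y = q.2)
    have hq := hsubO' hq'
    have hXd : DifferentiableAt ℝ (fun y => X (q.1, y)) q.2 :=
      (hXs.contDiffAt_slice hO hq).differentiableAt (by simp)
    refine ⟨hXd, fun v => ?_, fun h0 => ?_⟩
    · rw [flatLie_eq hXd (hda q (hsub₂' (hsubO hq)))]
      have h1 : (fun z => a (q.1, z) (X (q.1, z))) =ᶠ[𝓝 q.2] fun z => f (q.1, z) := by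
        have : (fun z => (q.1, z)) ⁻¹' O ∈ 𝓝 q.2 :=
          (hO.preimage (by fun_prop)).mem_nhds hq.1
        filter_upwards [this] with z hz
        exact (hXf (q.1, z) ⟨hz, hq.2.1, trivial⟩).1
      rw [h1.fderiv_eq]
      exact (hXf q hq).2 v
    · exact (hXf q hq).1.trans (hf0 q hq h0)
  · exact fun q hq y hy => hD₁D (hD₂D₁ (hOD (hball q hq y hy)))
  · intro q hq' B X' hB hCB hX'
    have hq := hsubO' hq'
    -- the function `α(X') - f` vanishes near `q`
    set B' := B ∩ (fun y => (q.1, y)) ⁻¹' O with hB'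
    have hB'o : IsOpen B' := hB.inter (hO.preimage (by fun_prop))
    have hslice : ∀ y ∈ B', (q.1, y) ∈ restrictBase S O :=
      fun y hy => ⟨hy.2, hq.2.1, trivial⟩
    have haX' : ∀ y ∈ B', DifferentiableAt ℝ (fun y => a (q.1, y) (X' y)) y := fun y hy =>
      (hda (q.1, y) (hsub₂' (hsubO (hslice y hy)))).clm_apply (hX' y hy.1).1
    have hcartan : ∀ y ∈ B', ∀ w,
        fderiv ℝ (fun y => a (q.1, y) (X' y)) y w + flatD (fun y => a (q.1, y)) y (X' y) w
          + b (q.1, y) w = 0 := by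
      intro y hy w
      rw [← flatLie_eq (hX' y hy.1).1 (hda (q.1, y) (hsub₂' (hsubO (hslice y hy))))]
      exact (hX' y hy.1).2.1 w
    -- As `df` enters the formula for `X`, the functions `α(X')` and `f` must agree near `q`, not
    -- only at `q`. Compactness of the closed ball leaves room for the balls about nearby points.
    have hnear : ∀ᶠ x in 𝓝 q.2, (q.1, x) ∈ O ∧ closedBall x (C * |ℓ (q.1, x)|) ⊆ B' := by
      refine Filter.Eventually.and ((hO.preimage (by fun_prop)).mem_nhds hq.1) ?_
      obtain ⟨ε, hε, hεB⟩ := (isCompact_closedBall q.2 (C * |ℓ q|)).exists_thickening_subset_open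
        hB'o (fun y hy => ⟨hCB hy, hball q hq' y hy⟩)
      have hcont : ContinuousAt (fun x => C * |ℓ (q.1, x)| + dist x q.2) q.2 := by
        have h1 := (hℓ.contDiffAt_slice hD (hsub₂' (hsubO hq))).continuousAt
        exact (continuousAt_const.mul h1.abs).add (by fun_prop)
      have hlt : ∀ᶠ x in 𝓝 q.2, C * |ℓ (q.1, x)| + dist x q.2 < C * |ℓ q| + ε := by
        refine hcont.eventually_lt_const ?_
        simpa using hε
      filter_upwards [hlt] with x hx y hy
      refine hεB ?_
      rw [thickening_closedBall hε (by positivity), add_comm]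
      rw [mem_closedBall] at hy
      rw [mem_ball]
      linarith [dist_triangle y x q.2]
    have hkey : ∀ᶠ x in 𝓝 q.2, a (q.1, x) (X' x) = f (q.1, x) := by
      filter_upwards [hnear] with x hx
      have hqx : (q.1, x) ∈ restrictBase S O := ⟨hx.1, hq.2.1, trivial⟩
      have hfd : ∀ y ∈ B', DifferentiableAt ℝ (fun y => f (q.1, y)) y := fun y hy =>
        (hfs.contDiffAt_slice hO (hslice y hy)).differentiableAt (by simp)
      have := hun (q.1, x) hqx B' (fun y => a (q.1, y) (X' y) - f (q.1, y)) hx.2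
        (fun y hy => (haX' y hy).sub (hfd y hy))
        -- By Cartan's formula any solution `X'` obeys the same transport equation as `f` in the
        -- direction of `R`, so the difference is annihilated by `T`.
        (fun y hy _ => by
          have h1 := hcartan y hy (R (q.1, y))
          have h2 := hreeb _ (hsubO (hslice y hy))
          rw [flatD_swap (hda (q.1, y) (hsub₂' (hsubO (hslice y hy)))), h2.2] at h1
          have h3 := hdfR _ (hslice y hy)
          change fderiv ℝ (fun y => f (q.1, y)) y (R (q.1, y)) = _ at h3
          rw [fderiv_fun_sub (haX' y hy) (hfd y hy), map_smul, sub_apply, h3]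
          rw [show fderiv ℝ (fun y => a (q.1, y) (X' y)) y (R (q.1, y)) = -b (q.1, y) (R (q.1, y))
            by linarith]
          simp)
        (fun y hy _ h0 => by
          rw [(hX' y hy.1).2.2 h0, hf0 _ (hslice y hy) h0, sub_self])
      exact sub_eq_zero.1 this
    have h1 : fderiv ℝ (fun y => a (q.1, y) (X' y)) q.2 = df q :=
      Filter.EventuallyEq.fderiv_eq hkey
    have h2 := hreeb q (hsubO hq)
    have hqB : q.2 ∈ B' := ⟨hCB (mem_closedBall_self (by positivity)), hq.1⟩
    have h3 := (contactMap_eq_iff (hda q (hsub₂' (hsubO hq))) h2.1 h2.2 (hdfR q hq)).2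
      ⟨hkey.self_of_nhds, fun w => by rw [← h1]; exact hcartan q.2 hqB w⟩
    have h4 := congrArg (J q) h3
    rw [← hJβ q (hsub₂ (hsubO hq)) (X' q.2)]
    exact h4

end FlatSolution

/-! ### Parameters in a manifold with corners -/

section ParameterManifold

open Metric

/-- The points of `D` whose time lies in `[0, 1]`. -/
def timeRestrict {P V : Type*} (D : Set (P × ℝ × V)) : Set (P × ℝ × V) :=
  {q | q ∈ D ∧ q.2.1 ∈ Icc (0 : ℝ) 1}

theorem timeDomain_eq_timeRestrict {P V : Type*} (W : Set (P × V)) :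
    timeDomain W = timeRestrict {q : P × ℝ × V | (q.1, q.2.2) ∈ W} := by
  ext q; simp [timeDomain, timeRestrict, and_comm]

theorem timeRestrict_mono {P V : Type*} {D D' : Set (P × ℝ × V)} (h : D ⊆ D') :
    timeRestrict D ⊆ timeRestrict D' := fun _ hq => ⟨h hq.1, hq.2⟩

variable {F K P : Type*} {E : Type*} [NormedAddCommGroup F] [NormedSpace ℝ F]
  [TopologicalSpace K] (J : ModelWithCorners ℝ F K) [TopologicalSpace P] [ChartedSpace K P]
  [IsManifold J ∞ P] [NormedAddCommGroup E] [NormedSpace ℝ E] {H : Type*} [NormedAddCommGroup H]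
  [NormedSpace ℝ H]

theorem ContMDiffOn.contDiffOn_extChartAt_symm {f : P × ℝ × E → H} {A : Set (P × ℝ × E)}
    (hf : ContMDiffOn (J.prod (𝓘(ℝ, ℝ).prod 𝓘(ℝ, E))) 𝓘(ℝ, H) ∞ f A) (u₀ : P)
    {B : Set ((F × ℝ) × E)} (hB : ∀ q ∈ B, q.1.1 ∈ (extChartAt J u₀).target ∧
      ((extChartAt J u₀).symm q.1.1, q.1.2, q.2) ∈ A) :
    ContDiffOn ℝ ∞ (fun q : (F × ℝ) × E => f ((extChartAt J u₀).symm q.1.1, q.1.2, q.2)) B := by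
  rw [← contMDiffOn_iff_contDiffOn]
  have h1 : ContMDiffOn 𝓘(ℝ, (F × ℝ) × E) 𝓘(ℝ, F) ∞ (fun q : (F × ℝ) × E => q.1.1) B :=
    (contDiff_fst.comp contDiff_fst).contDiffOn.contMDiffOn
  have h2 : ContMDiffOn 𝓘(ℝ, (F × ℝ) × E) 𝓘(ℝ, ℝ) ∞ (fun q : (F × ℝ) × E => q.1.2) B :=
    (contDiff_snd.comp contDiff_fst).contDiffOn.contMDiffOn
  have h3 : ContMDiffOn 𝓘(ℝ, (F × ℝ) × E) 𝓘(ℝ, E) ∞ (fun q : (F × ℝ) × E => q.2) B :=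
    contDiff_snd.contDiffOn.contMDiffOn
  have h4 : ContMDiffOn 𝓘(ℝ, (F × ℝ) × E) J ∞
      (fun q : (F × ℝ) × E => (extChartAt J u₀).symm q.1.1) B :=
    (contMDiffOn_extChartAt_symm (n := ∞) u₀).comp h1 (fun q hq => (hB q hq).1)
  exact hf.comp (h4.prodMk (h2.prodMk h3)) (fun q hq => (hB q hq).2)

theorem ContDiffOn.contMDiffOn_comp_extChartAt {f : (F × ℝ) × E → H} {B : Set ((F × ℝ) × E)}
    (hf : ContDiffOn ℝ ∞ f B) (u₀ : P) {A : Set (P × ℝ × E)}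
    (hA : ∀ q ∈ A, q.1 ∈ (extChartAt J u₀).source ∧
      ((extChartAt J u₀ q.1, q.2.1), q.2.2) ∈ B) :
    ContMDiffOn (J.prod (𝓘(ℝ, ℝ).prod 𝓘(ℝ, E))) 𝓘(ℝ, H) ∞
      (fun q : P × ℝ × E => f ((extChartAt J u₀ q.1, q.2.1), q.2.2)) A := by
  have h1 : ContMDiffOn (J.prod (𝓘(ℝ, ℝ).prod 𝓘(ℝ, E))) J ∞ (fun q : P × ℝ × E => q.1) A :=
    contMDiffOn_fst
  have h2 : ContMDiffOn (J.prod (𝓘(ℝ, ℝ).prod 𝓘(ℝ, E))) 𝓘(ℝ, ℝ) ∞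
      (fun q : P × ℝ × E => q.2.1) A := (contMDiff_fst.comp contMDiff_snd).contMDiffOn
  have h3 : ContMDiffOn (J.prod (𝓘(ℝ, ℝ).prod 𝓘(ℝ, E))) 𝓘(ℝ, E) ∞
      (fun q : P × ℝ × E => q.2.2) A := (contMDiff_snd.comp contMDiff_snd).contMDiffOn
  have h4 : ContMDiffOn (J.prod (𝓘(ℝ, ℝ).prod 𝓘(ℝ, E))) 𝓘(ℝ, F) ∞
      (fun q : P × ℝ × E => extChartAt J u₀ q.1) A :=
    (contMDiffOn_extChartAt (n := ∞) (x := u₀)).comp h1 (fun q hq => by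
      simpa using (hA q hq).1)
  have h5 := (h4.prodMk_space h2).prodMk_space h3
  exact hf.contMDiffOn.comp h5 (fun q hq => (hA q hq).2)

end ParameterManifold

section LocalSolution

open Metric

/-- A box around a point in the chart of the parameter manifold. -/
theorem exists_chart_box {F K P E : Type*} [NormedAddCommGroup F] [NormedSpace ℝ F]
    [TopologicalSpace K] (J : ModelWithCorners ℝ F K) [TopologicalSpace P] [ChartedSpace K P]
    [PseudoMetricSpace E] {D : Set (P × ℝ × E)} (hD : IsOpen D) {q₀ : P × ℝ × E} (hq₀ : q₀ ∈ D) :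
    ∃ ε > 0, ∀ z ∈ range J ∩ ball (extChartAt J q₀.1 q₀.1) ε,
      z ∈ (extChartAt J q₀.1).target ∧ ∀ t ∈ ball q₀.2.1 ε, ∀ y ∈ ball q₀.2.2 ε,
        ((extChartAt J q₀.1).symm z, t, y) ∈ D := by
  set κ := extChartAt J q₀.1
  obtain ⟨A, hA, B, hB, hAB⟩ := mem_nhds_prod_iff.1 (hD.mem_nhds hq₀)
  obtain ⟨ε₁, hε₁, hB⟩ := Metric.mem_nhds_iff.1 hB
  have h1 : ∀ᶠ z in 𝓝[range J] (κ q₀.1), z ∈ κ.target ∧ κ.symm z ∈ A := by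
    refine Filter.Eventually.and (extChartAt_target_mem_nhdsWithin q₀.1) ?_
    have : ContinuousWithinAt κ.symm (range J) (κ q₀.1) :=
      (continuousAt_extChartAt_symm q₀.1).continuousWithinAt
    refine this.eventually_mem ?_
    rw [extChartAt_to_inv]
    exact hA
  obtain ⟨ε₂, hε₂, h2⟩ := Metric.mem_nhdsWithin_iff.1 h1
  refine ⟨min ε₁ ε₂, lt_min hε₁ hε₂, fun z hz => ?_⟩
  have h3 := h2 ⟨ball_subset_ball (min_le_right _ _) hz.2, hz.1⟩
  refine ⟨h3.1, fun t ht y hy => hAB ⟨h3.2, hB ?_⟩⟩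
  rw [← ball_prod_same (x := q₀.2.1) (y := q₀.2.2)]
  exact ⟨ball_subset_ball (min_le_left _ _) ht, ball_subset_ball (min_le_left _ _) hy⟩

universe u

variable {F : Type u} {K P : Type*} {E : Type} [NormedAddCommGroup F] [NormedSpace ℝ F]
  [CompleteSpace F] [TopologicalSpace K] (J : ModelWithCorners ℝ F K) [TopologicalSpace P]
  [ChartedSpace K P] [IsManifold J ∞ P] [NormedAddCommGroup E] [NormedSpace ℝ E]
  [FiniteDimensional ℝ E]

/-- Local solutions, with parameters in a manifold with corners, of `L_X α + β = 0` with prescribed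
`α(X)` on a hypersurface `{ℓ = 0}` that is transverse to the Reeb field. -/
theorem exists_local_flat_solution {D : Set (P × ℝ × E)} (hD : IsOpen D)
    {a b : P × ℝ × E → E →L[ℝ] ℝ} {ℓ h : P × ℝ × E → ℝ}
    (ha : ContMDiffOn (J.prod (𝓘(ℝ, ℝ).prod 𝓘(ℝ, E))) 𝓘(ℝ, E →L[ℝ] ℝ) ∞ a (timeRestrict D))
    (hb : ContMDiffOn (J.prod (𝓘(ℝ, ℝ).prod 𝓘(ℝ, E))) 𝓘(ℝ, E →L[ℝ] ℝ) ∞ b (timeRestrict D))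
    (hℓ : ContMDiffOn (J.prod (𝓘(ℝ, ℝ).prod 𝓘(ℝ, E))) 𝓘(ℝ, ℝ) ∞ ℓ (timeRestrict D))
    (hh : ContMDiffOn (J.prod (𝓘(ℝ, ℝ).prod 𝓘(ℝ, E))) 𝓘(ℝ, ℝ) ∞ h (timeRestrict D))
    {q₀ : P × ℝ × E} (hq₀ : q₀ ∈ timeRestrict D) (hℓ₀ : ℓ q₀ = 0)
    (hc : IsFlatContactAt (fun y => a (q₀.1, q₀.2.1, y)) q₀.2.2)
    (htr : ∀ v, a q₀ v = 1 → (∀ w, flatD (fun y => a (q₀.1, q₀.2.1, y)) q₀.2.2 v w = 0) →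
      fderiv ℝ (fun y => ℓ (q₀.1, q₀.2.1, y)) q₀.2.2 v ≠ 0) :
    ∃ (O : Set (P × ℝ × E)) (X : P × ℝ × E → E) (C : ℝ), IsOpen O ∧ q₀ ∈ O ∧ O ⊆ D ∧ 0 ≤ C ∧
      ContMDiffOn (J.prod (𝓘(ℝ, ℝ).prod 𝓘(ℝ, E))) 𝓘(ℝ, E) ∞ X (timeRestrict O) ∧
      (∀ q ∈ timeRestrict O, IsFlatSolution (fun y => a (q.1, q.2.1, y))
        (fun y => b (q.1, q.2.1, y)) (fun y => ℓ (q.1, q.2.1, y)) (fun y => h (q.1, q.2.1, y))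
        (fun y => X (q.1, q.2.1, y)) {q.2.2}) ∧
      (∀ q ∈ timeRestrict O, ∀ y ∈ closedBall q.2.2 (C * |ℓ q|), (q.1, q.2.1, y) ∈ D) ∧
      ∀ q ∈ timeRestrict O, ∀ (B : Set E) (X' : E → E), IsOpen B →
        closedBall q.2.2 (C * |ℓ q|) ⊆ B →
        IsFlatSolution (fun y => a (q.1, q.2.1, y)) (fun y => b (q.1, q.2.1, y))
          (fun y => ℓ (q.1, q.2.1, y)) (fun y => h (q.1, q.2.1, y)) X' B → X' q.2.2 = X q := by
  set κ := extChartAt J q₀.1 with hκ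
  obtain ⟨ε, hε, hbox⟩ := exists_chart_box J hD hq₀.1
  -- Time is treated as one more parameter. In the chart, the parameter set is the convex range of
  -- `J` cut by a ball, times `[0, 1]`, so corners and the end points of time are handled in the
  -- same way.
  set S : Set (F × ℝ) := (range J ∩ ball (κ q₀.1) ε) ×ˢ Icc (0 : ℝ) 1 with hS
  set D' : Set ((F × ℝ) × E) := (univ ×ˢ ball q₀.2.1 ε) ×ˢ ball q₀.2.2 ε with hD'
  have hD'o : IsOpen D' := (isOpen_univ.prod isOpen_ball).prod isOpen_ball
  have hSc : Convex ℝ S := (J.convex_range.inter (convex_ball _ _)).prod (convex_Icc 0 1)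
  have hSu : UniqueDiffOn ℝ S :=
    (J.uniqueDiffOn.inter isOpen_ball).prod (uniqueDiffOn_Icc zero_lt_one)
  have hmem : ∀ q ∈ restrictBase S D', q.1.1 ∈ κ.target ∧
      (κ.symm q.1.1, q.1.2, q.2) ∈ timeRestrict D := fun q hq => by
    have h1 := hbox q.1.1 hq.2.1.1
    exact ⟨h1.1, h1.2 _ hq.1.1.2 _ hq.1.2, hq.2.1.2⟩
  have hκq₀ : κ.symm (κ q₀.1) = q₀.1 := extChartAt_to_inv q₀.1
  have hq₀' : ((κ q₀.1, q₀.2.1), q₀.2.2) ∈ restrictBase S D' :=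
    ⟨⟨⟨trivial, mem_ball_self hε⟩, mem_ball_self hε⟩,
      ⟨⟨by rw [hκ, extChartAt_coe]; exact mem_range_self _, mem_ball_self hε⟩, hq₀.2⟩, trivial⟩
  obtain ⟨O, X, C, hO, hqO, hOD, hC, hXs, hX, hball, hun⟩ := exists_flat_solution hSc hSu hD'o
    (a := fun q => a (κ.symm q.1.1, q.1.2, q.2)) (b := fun q => b (κ.symm q.1.1, q.1.2, q.2))
    (ℓ := fun q => ℓ (κ.symm q.1.1, q.1.2, q.2)) (h := fun q => h (κ.symm q.1.1, q.1.2, q.2))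
    (ha.contDiffOn_extChartAt_symm J q₀.1 hmem) (hb.contDiffOn_extChartAt_symm J q₀.1 hmem)
    (hℓ.contDiffOn_extChartAt_symm J q₀.1 hmem) (hh.contDiffOn_extChartAt_symm J q₀.1 hmem)
    hq₀' (by simpa [hκq₀] using hℓ₀) (by simpa [hκq₀] using hc) (by simpa [hκq₀] using htr)
  set Φ : P × ℝ × E → (F × ℝ) × E := fun q => ((κ q.1, q.2.1), q.2.2) with hΦ
  have hsrc : IsOpen (κ.source ×ˢ (univ : Set (ℝ × E))) :=
    (isOpen_extChartAt_source q₀.1).prod isOpen_univ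
  have hΦc : ContinuousOn Φ (κ.source ×ˢ univ) := by
    have h1 : ContinuousOn (fun q : P × ℝ × E => κ q.1) (κ.source ×ˢ univ) :=
      (continuousOn_extChartAt q₀.1).comp continuousOn_fst (fun q hq => hq.1)
    exact (h1.prodMk (by fun_prop)).prodMk (by fun_prop)
  set O' : Set (P × ℝ × E) := (κ.source ×ˢ univ) ∩
    Φ ⁻¹' (O ∩ ((ball (κ q₀.1) ε ×ˢ univ) ×ˢ univ)) with hO'
  have hO'o : IsOpen O' :=
    hΦc.isOpen_inter_preimage hsrc (hO.inter ((isOpen_ball.prod isOpen_univ).prod isOpen_univ))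
  have hO'mem : ∀ q ∈ timeRestrict O', q.1 ∈ κ.source ∧ Φ q ∈ restrictBase S O := by
    intro q hq
    refine ⟨hq.1.1.1, hq.1.2.1, ⟨⟨?_, hq.1.2.2.1.1⟩, hq.2⟩, trivial⟩
    change κ q.1 ∈ range J
    rw [hκ, extChartAt_coe]; exact mem_range_self _
  have hinv : ∀ q ∈ timeRestrict O', κ.symm (κ q.1) = q.1 := fun q hq =>
    κ.left_inv (hO'mem q hq).1
  refine ⟨O', fun q => X (Φ q), C, hO'o, ?_, ?_, hC, ?_, ?_, ?_, ?_⟩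
  · exact ⟨⟨mem_extChartAt_source q₀.1, trivial⟩, hqO, ⟨mem_ball_self hε, trivial⟩, trivial⟩
  · intro q hq
    have h1 := hbox (κ q.1) ⟨by rw [hκ, extChartAt_coe]; exact mem_range_self _, hq.2.2.1.1⟩
    rw [← hκ, κ.left_inv hq.1.1] at h1
    have h2 := hOD hq.2.1
    exact h1.2 _ h2.1.2 _ h2.2
  · exact hXs.contMDiffOn_comp_extChartAt J q₀.1 hO'mem
  · intro q hq
    have := hX _ (hO'mem q hq).2
    simpa only [hΦ, hinv q hq] using this
  · intro q hq y hy
    have h1 := hball _ (hO'mem q hq).2 y (by simpa only [hΦ, hinv q hq] using hy)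
    have h2 := (hO'mem q hq).2.2.1.1
    have := (hbox _ h2).2 _ h1.1.2 _ h1.2
    rwa [← hκ, hinv q hq] at this
  · intro q hq B X' hB hBC hX'
    have := hun _ (hO'mem q hq).2 B X' hB
    simp only [hΦ, hinv q hq] at this
    exact this hBC hX'

end LocalSolution

/-! ### Gluing by local uniqueness -/

section Gluing

/-- A choice of an index for every point that, near each point, only uses finitely many indices,
all of them of sets that contain the point. -/
theorem exists_locally_finite_choice {M ι : Type*} [TopologicalSpace M]
    [TopologicalSpace.MetrizableSpace M] [Nonempty ι] {O : ι → Set M} (hO : ∀ i, IsOpen (O i)) :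
    ∃ j : M → ι, ∀ q ∈ ⋃ i, O i, ∃ s : Set ι, s.Finite ∧ j q ∈ s ∧ (∀ i ∈ s, q ∈ O i) ∧
      ∀ᶠ q' in 𝓝 q, j q' ∈ s := by
  classical
  let := TopologicalSpace.metrizableSpaceMetric M
  set W : Set M := ⋃ i, O i with hW
  have hWo : IsOpen W := isOpen_iUnion hO
  obtain ⟨v, hvo, hvc, hvf, hvO⟩ := precise_refinement (X := W) (fun i => (↑) ⁻¹' O i)
    (fun i => (hO i).preimage continuous_subtype_val) (by
      rw [← preimage_iUnion, ← hW]; exact Subtype.coe_preimage_self W)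
  obtain ⟨w, hwc, hwo, hwv⟩ := exists_iUnion_eq_closure_subset hvo hvf.point_finite hvc
  have hwf : LocallyFinite fun i => closure (w i) := hvf.subset hwv
  have hj : ∀ q : W, ∃ i, q ∈ w i := fun q => mem_iUnion.1 (hwc ▸ mem_univ q)
  choose j hj using hj
  refine ⟨fun q => if h : q ∈ W then j ⟨q, h⟩ else Classical.arbitrary ι, fun q hq => ?_⟩
  -- The closures form a locally finite family, so those missing `q` also miss all points near `q`;
  -- an index chosen nearby must therefore belong to a closure that contains `q`.
  refine ⟨{i | (⟨q, hq⟩ : W) ∈ closure (w i)}, hwf.point_finite _, ?_, fun i hi => ?_, ?_⟩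
  · simp only [dif_pos hq, mem_ofPred_eq]
    exact subset_closure (hj _)
  · exact hvO i (hwv i hi)
  · have h1 := hwf.iInter_compl_mem_nhds (fun i => isClosed_closure) (⟨q, hq⟩ : W)
    rw [← map_nhds_subtype_coe_eq_nhds hq (hWo.mem_nhds hq), Filter.eventually_map]
    filter_upwards [h1] with q' hq'
    simp only [Subtype.coe_prop, dif_pos, Subtype.coe_eta]
    by_contra hcon
    have := mem_iInter₂.1 hq' _ hcon
    exact this (subset_closure (hj q'))

/-- Local sections that agree near each point of `L` can be glued near `L`. -/
theorem exists_glue {M ι : Type*} [TopologicalSpace M] [TopologicalSpace.MetrizableSpace M]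
    {T : M → Type*} {D L : Set M} [Nonempty ι] {O : ι → Set M} (hO : ∀ i, IsOpen (O i))
    (X : ι → (q : M) → T q) (hL : L ⊆ ⋃ i, O i)
    (hX : ∀ i j, ∀ q ∈ L, q ∈ O i → q ∈ O j → ∀ᶠ q' in 𝓝[D] q, X i q' = X j q') :
    ∃ (U : Set M) (Y : (q : M) → T q), IsOpen U ∧ L ⊆ U ∧
      ∀ q ∈ U, ∃ i, q ∈ O i ∧ ∀ᶠ q' in 𝓝[D] q, Y q' = X i q' := by
  obtain ⟨j, hj⟩ := exists_locally_finite_choice hO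
  have key : ∀ q ∈ L, ∃ N, IsOpen N ∧ q ∈ N ∧ ∃ i, N ⊆ O i ∧ ∀ q' ∈ N, q' ∈ D →
      X (j q') q' = X i q' := by
    intro q hq
    obtain ⟨s, hs, hjs, hsO, hev⟩ := hj q (hL hq)
    -- Only finitely many sections occur near `q`, so their pairwise agreements hold on one common
    -- neighbourhood, where the choice of index no longer matters.
    have h1 : ∀ᶠ q' in 𝓝 q, ∀ i ∈ s, q' ∈ D → X i q' = X (j q) q' := by
      rw [Filter.eventually_all_finite hs]
      intro i hi
      exact eventually_nhdsWithin_iff.1 (hX i (j q) q hq (hsO i hi) (hsO _ hjs))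
    obtain ⟨N, hN, hNo, hqN⟩ := eventually_nhds_iff.1
      ((h1.and hev).and ((hO (j q)).mem_nhds (hsO _ hjs)))
    exact ⟨N, hNo, hqN, j q, fun q' hq' => (hN q' hq').2, fun q' hq' hD =>
      (hN q' hq').1.1 _ (hN q' hq').1.2 hD⟩
  choose! N hNo hqN hN using key
  refine ⟨⋃ q ∈ L, N q, fun q => X (j q) q, isOpen_biUnion hNo,
    fun q hq => mem_iUnion₂.2 ⟨q, hq, hqN q hq⟩, fun q hq => ?_⟩
  obtain ⟨q₁, hq₁, hqq₁⟩ := mem_iUnion₂.1 hq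
  obtain ⟨i, hi, hXi⟩ := hN q₁ hq₁
  refine ⟨i, hi hqq₁, ?_⟩
  rw [eventually_nhdsWithin_iff]
  filter_upwards [(hNo q₁ hq₁).mem_nhds hqq₁] with q' hq' hD
  exact hXi q' hq' hD

/-- The set of all `(u, x)` such that `(u, t, x) ∈ U` for all `t ∈ [0, 1]` is open if `U` is. -/
theorem isOpen_forall_time {P V : Type*} [TopologicalSpace P] [TopologicalSpace V]
    {U : Set (P × ℝ × V)} (hU : IsOpen U) :
    IsOpen {q : P × V | ∀ t ∈ Icc (0 : ℝ) 1, (q.1, t, q.2) ∈ U} := by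
  have h1 : IsOpen ((fun z : (P × V) × ℝ => (z.1.1, z.2, z.1.2)) ⁻¹' U) :=
    hU.preimage (by fun_prop)
  rw [isOpen_iff_mem_nhds]
  intro q hq
  obtain ⟨A, B, hA, hB, hqA, hIB, hAB⟩ := generalized_tube_lemma (isCompact_singleton (x := q))
    (isCompact_Icc (a := (0 : ℝ)) (b := 1)) h1 (by
      rintro ⟨q', t⟩ ⟨hq', ht⟩
      rw [mem_singleton_iff] at hq'
      subst hq'
      exact hq t ht)
  filter_upwards [hA.mem_nhds (hqA rfl)] with q' hq' t ht
  exact hAB (mk_mem_prod hq' (hIB ht))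

end Gluing

/-! ### Smoothness of the time derivative up to the ends of the interval -/

section TimeDerivative

open Metric

variable {F K P : Type*} {E : Type*} [NormedAddCommGroup F] [NormedSpace ℝ F]
  [TopologicalSpace K] (J : ModelWithCorners ℝ F K) [TopologicalSpace P] [ChartedSpace K P]
  [IsManifold J ∞ P] [NormedAddCommGroup E] [NormedSpace ℝ E] {H : Type*} [NormedAddCommGroup H]
  [NormedSpace ℝ H]

theorem hasDerivWithinAt_time_of_hasFDerivWithinAt {f : (F × ℝ) × E → H}
    {f' : (F × ℝ) × E →L[ℝ] H} {B : Set ((F × ℝ) × E)} {z : F} {t : ℝ} {y : E}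
    (hf : HasFDerivWithinAt f f' B ((z, t), y)) {I : Set ℝ} (hI : ∀ s ∈ I, ((z, s), y) ∈ B) :
    HasDerivWithinAt (fun s => f ((z, s), y)) (f' ((0, 1), 0)) I t := by
  have h1 : HasDerivWithinAt (fun s : ℝ => (((z, s), y) : (F × ℝ) × E)) ((0, 1), 0) I t :=
    ((hasDerivWithinAt_const _ _ _).prodMk (hasDerivWithinAt_id _ _)).prodMk
      (hasDerivWithinAt_const _ _ _)
  exact hf.comp_hasDerivWithinAt t h1 hI

/-- The time derivative of a smooth family is smooth. -/
theorem ContMDiffOn.time_derivWithin {f : P × ℝ × E → H} {D : Set (P × ℝ × E)} (hD : IsOpen D)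
    (hf : ContMDiffOn (J.prod (𝓘(ℝ, ℝ).prod 𝓘(ℝ, E))) 𝓘(ℝ, H) ∞ f (timeRestrict D)) :
    ContMDiffOn (J.prod (𝓘(ℝ, ℝ).prod 𝓘(ℝ, E))) 𝓘(ℝ, H) ∞
      (fun q => derivWithin (fun s => f (q.1, s, q.2.2)) (Icc 0 1) q.2.1) (timeRestrict D) ∧
    ∀ q ∈ timeRestrict D,
      DifferentiableWithinAt ℝ (fun s => f (q.1, s, q.2.2)) (Icc 0 1) q.2.1 := by
  have key : ∀ q₀ ∈ timeRestrict D, ∃ A, IsOpen A ∧ q₀ ∈ A ∧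
      ContMDiffOn (J.prod (𝓘(ℝ, ℝ).prod 𝓘(ℝ, E))) 𝓘(ℝ, H) ∞
        (fun q => derivWithin (fun s => f (q.1, s, q.2.2)) (Icc 0 1) q.2.1)
        (timeRestrict D ∩ A) ∧
      DifferentiableWithinAt ℝ (fun s => f (q₀.1, s, q₀.2.2)) (Icc 0 1) q₀.2.1 := by
    intro q₀ hq₀
    obtain ⟨ε, hε, hbox⟩ := exists_chart_box J hD hq₀.1
    set κ := extChartAt J q₀.1 with hκ
    set B : Set ((F × ℝ) × E) :=
      ((range J ∩ ball (κ q₀.1) ε) ×ˢ (Icc (0 : ℝ) 1 ∩ ball q₀.2.1 ε)) ×ˢ ball q₀.2.2 ε with hB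
    have hBu : UniqueDiffOn ℝ B :=
      ((J.uniqueDiffOn.inter isOpen_ball).prod
        ((uniqueDiffOn_Icc zero_lt_one).inter isOpen_ball)).prod isOpen_ball.uniqueDiffOn
    have hmem : ∀ q ∈ B, q.1.1 ∈ κ.target ∧
        (κ.symm q.1.1, q.1.2, q.2) ∈ timeRestrict D := fun q hq => by
      have h1 := hbox q.1.1 hq.1.1
      exact ⟨h1.1, h1.2 _ hq.1.2.2 _ hq.2, hq.1.2.1⟩
    set g : (F × ℝ) × E → H := fun q => f (κ.symm q.1.1, q.1.2, q.2) with hg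
    have hgs : ContDiffOn ℝ ∞ g B := hf.contDiffOn_extChartAt_symm J q₀.1 hmem
    have hg's : ContDiffOn ℝ ∞ (fun q => fderivWithin ℝ g B q ((0, 1), 0)) B :=
      (hgs.fderivWithin hBu (by simp)).clm_apply contDiffOn_const
    -- The time derivative is the total derivative within `B` applied to the time direction, so
    -- smoothness of the latter is all that is needed.
    have hder : ∀ q ∈ B, HasDerivWithinAt (fun s => g ((q.1.1, s), q.2))
        (fderivWithin ℝ g B q ((0, 1), 0)) (Icc 0 1) q.1.2 := by
      intro q hq
      have h1 := hasDerivWithinAt_time_of_hasFDerivWithinAt (f := g) (z := q.1.1) (t := q.1.2)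
        (y := q.2) (hgs.differentiableOn (by simp) q hq).hasFDerivWithinAt
        (I := Icc 0 1 ∩ ball q₀.2.1 ε) (fun s hs => ⟨⟨hq.1.1, hs⟩, hq.2⟩)
      exact (hasDerivWithinAt_inter (isOpen_ball.mem_nhds hq.1.2.2)).1 h1
    set A : Set (P × ℝ × E) := (κ.source ∩ κ ⁻¹' ball (κ q₀.1) ε) ×ˢ
      (ball q₀.2.1 ε ×ˢ ball q₀.2.2 ε) with hA
    have hAo : IsOpen A := ((continuousOn_extChartAt q₀.1).isOpen_inter_preimage
      (isOpen_extChartAt_source q₀.1) isOpen_ball).prod (isOpen_ball.prod isOpen_ball)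
    have hAB : ∀ q ∈ timeRestrict D ∩ A, q.1 ∈ κ.source ∧ ((κ q.1, q.2.1), q.2.2) ∈ B := by
      intro q hq
      refine ⟨hq.2.1.1, ⟨⟨?_, hq.2.1.2⟩, hq.1.2, hq.2.2.1⟩, hq.2.2.2⟩
      rw [hκ, extChartAt_coe]; exact mem_range_self _
    have hq₀A : q₀ ∈ A := ⟨⟨mem_extChartAt_source q₀.1, mem_ball_self hε⟩, mem_ball_self hε,
      mem_ball_self hε⟩
    have hslice : ∀ q ∈ timeRestrict D ∩ A, ∀ s, g ((κ q.1, s), q.2.2) = f (q.1, s, q.2.2) := by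
      intro q hq s
      simp only [hg, κ.left_inv (hAB q hq).1]
    refine ⟨A, hAo, hq₀A, ?_, ?_⟩
    · refine (hg's.contMDiffOn_comp_extChartAt J q₀.1 hAB).congr fun q hq => ?_
      have h1 := hder _ (hAB q hq).2
      simp only [hslice q hq] at h1
      exact h1.derivWithin (uniqueDiffOn_Icc zero_lt_one _ hq.1.2)
    · have h1 := hder _ (hAB q₀ ⟨hq₀, hq₀A⟩).2
      simp only [hslice q₀ ⟨hq₀, hq₀A⟩] at h1
      exact h1.differentiableWithinAt
  refine ⟨contMDiffOn_of_locally_contMDiffOn fun q hq => ?_, fun q hq => ?_⟩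
  · obtain ⟨A, hA, hqA, h, -⟩ := key q hq
    exact ⟨A, hA, hqA, h⟩
  · obtain ⟨A, hA, hqA, -, h⟩ := key q hq
    exact h

end TimeDerivative

/-! ### Forms, fields and Lie derivatives in a chart -/

section Coordinates

variable {n : ℕ} {V : Type*} [TopologicalSpace V] [ChartedSpace (EuclideanSpace ℝ (Fin n)) V]
  [IsManifold (𝓡 n) ∞ V]

local notation "𝔼" => EuclideanSpace ℝ (Fin n)

/-- The differential at `x` of the chart at `x₀`. -/
noncomputable def chartD (x₀ x : V) : TangentSpace (𝓡 n) x →L[ℝ] 𝔼 :=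
  (trivializationAt 𝔼 (TangentSpace (𝓡 n)) x₀).continuousLinearMapAt ℝ x

/-- The inverse of the differential at `x` of the chart at `x₀`. -/
noncomputable def chartDInv (x₀ x : V) : 𝔼 →L[ℝ] TangentSpace (𝓡 n) x :=
  (trivializationAt 𝔼 (TangentSpace (𝓡 n)) x₀).symmL ℝ x

theorem mem_baseSet_of_mem_source {x₀ x : V} (hx : x ∈ (extChartAt (𝓡 n) x₀).source) :
    x ∈ (trivializationAt 𝔼 (TangentSpace (𝓡 n)) x₀).baseSet := by
  rw [extChartAt_source] at hx
  simpa using hx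

theorem chartD_chartDInv {x₀ x : V} (hx : x ∈ (extChartAt (𝓡 n) x₀).source) (v : 𝔼) :
    chartD x₀ x (chartDInv x₀ x v) = v :=
  (trivializationAt 𝔼 (TangentSpace (𝓡 n)) x₀).continuousLinearMapAt_symmL
    (mem_baseSet_of_mem_source hx) v

theorem chartDInv_chartD {x₀ x : V} (hx : x ∈ (extChartAt (𝓡 n) x₀).source)
    (v : TangentSpace (𝓡 n) x) : chartDInv x₀ x (chartD x₀ x v) = v :=
  (trivializationAt 𝔼 (TangentSpace (𝓡 n)) x₀).symmL_continuousLinearMapAt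
    (mem_baseSet_of_mem_source hx) v

theorem mfderiv_extChartAt_eq_chartD {x₀ x : V} (hx : x ∈ (extChartAt (𝓡 n) x₀).source) :
    mfderiv (𝓡 n) 𝓘(ℝ, 𝔼) (extChartAt (𝓡 n) x₀) x = chartD x₀ x := by
  rw [extChartAt_source] at hx
  exact (TangentBundle.continuousLinearMapAt_trivializationAt hx).symm

theorem mfderiv_extChartAt_symm_eq_chartDInv {x₀ x : V}
    (hx : x ∈ (extChartAt (𝓡 n) x₀).source) :
    mfderiv 𝓘(ℝ, 𝔼) (𝓡 n) (extChartAt (𝓡 n) x₀).symm (extChartAt (𝓡 n) x₀ x) =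
      chartDInv x₀ x := by
  rw [extChartAt_source] at hx
  have := TangentBundle.symmL_trivializationAt (I := 𝓡 n) hx
  rw [modelWithCornersSelf_coe, range_id, mfderivWithin_univ] at this
  exact this.symm

theorem coordForm_extChartAt (α : (x : V) → TangentSpace (𝓡 n) x →L[ℝ] ℝ) {x₀ x : V}
    (hx : x ∈ (extChartAt (𝓡 n) x₀).source) :
    coordForm α x₀ (extChartAt (𝓡 n) x₀ x) = (α x).comp (chartDInv x₀ x) := by
  -- The inverse chart returns a point that is only provably equal to `x`. Tangent spaces at all
  -- points are the same model space by definition, so the point can be generalised and substituted.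
  have key : ∀ x' (_ : x' = x) (A : 𝔼 →L[ℝ] 𝔼),
      ContinuousLinearMap.comp (α x' : 𝔼 →L[ℝ] ℝ) A =
        ContinuousLinearMap.comp (α x : 𝔼 →L[ℝ] ℝ) A := by
    rintro _ rfl A; rfl
  rw [← mfderiv_extChartAt_symm_eq_chartDInv hx]
  exact key _ ((extChartAt (𝓡 n) x₀).left_inv hx) _

theorem coordField_extChartAt (X : (x : V) → TangentSpace (𝓡 n) x) {x₀ x : V}
    (hx : x ∈ (extChartAt (𝓡 n) x₀).source) :
    coordField X x₀ (extChartAt (𝓡 n) x₀ x) = chartD x₀ x (X x) := by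
  have h1 : (chartDInv (n := n) x₀ x).inverse = chartD (n := n) x₀ x := by
    refine ContinuousLinearMap.inverse_eq ?_ ?_
    · ext1 v; exact chartDInv_chartD hx v
    · ext1 v; exact chartD_chartDInv hx v
  have key : ∀ x' (_ : x' = x) (A : 𝔼 →L[ℝ] 𝔼), A (X x') = A (X x) := by
    rintro _ rfl A; rfl
  rw [← h1, ← mfderiv_extChartAt_symm_eq_chartDInv hx]
  exact key _ ((extChartAt (𝓡 n) x₀).left_inv hx) _

theorem coordVec_eq_chartD (x : V) (v : TangentSpace (𝓡 n) x) : coordVec x v = chartD x x v := by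
  rw [coordVec, mfderiv_extChartAt_eq_chartD (mem_extChartAt_source x)]
  rfl

section Smoothness

variable {F K Q : Type*} [NormedAddCommGroup F] [NormedSpace ℝ F] [TopologicalSpace K]
  {J : ModelWithCorners ℝ F K} [TopologicalSpace Q] [ChartedSpace K Q]

/-- The trivialisation at `x₀` is the differential of the chart, so over one chart domain smoothness
into the bundle can be tested in a fixed vector space. -/
theorem smoothFieldsOn_iff {π : Q → V} {X : (q : Q) → TangentSpace (𝓡 n) (π q)} {S : Set Q}
    (x₀ : V) (hS : ∀ q ∈ S, π q ∈ (extChartAt (𝓡 n) x₀).source) :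
    SmoothFieldsOn J π X S ↔ ContMDiffOn J (𝓡 n) ∞ π S ∧ ContMDiffOn J 𝓘(ℝ, 𝔼) ∞
      (fun q => chartD x₀ (π q) (X q)) S := by
  have he : MapsTo (fun q => Bundle.TotalSpace.mk' (E := fun x : V => TangentSpace (𝓡 n) x)
      𝔼 (π q) (X q)) S (trivializationAt 𝔼 (TangentSpace (𝓡 n)) x₀).source := by
    intro q hq
    have := mem_baseSet_of_mem_source (hS q hq)
    simpa using this
  refine ((trivializationAt 𝔼 (TangentSpace (𝓡 n)) x₀).contMDiffOn_iff he).trans ?_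
  refine and_congr_right fun _ => contMDiffOn_congr fun q hq => ?_
  have h1 := mem_baseSet_of_mem_source (hS q hq)
  rw [chartD, Bundle.Trivialization.continuousLinearMapAt_apply,
    Bundle.Trivialization.coe_linearMapAt_of_mem _ h1]

theorem smoothFormsOn_iff {π : Q → V} {α : (q : Q) → TangentSpace (𝓡 n) (π q) →L[ℝ] ℝ} {S : Set Q}
    (x₀ : V) (hS : ∀ q ∈ S, π q ∈ (extChartAt (𝓡 n) x₀).source) :
    SmoothFormsOn J π α S ↔ ContMDiffOn J (𝓡 n) ∞ π S ∧ ContMDiffOn J 𝓘(ℝ, 𝔼 →L[ℝ] ℝ) ∞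
      (fun q => (α q).comp (chartDInv x₀ (π q))) S := by
  have he : MapsTo (fun q => Bundle.TotalSpace.mk'
      (E := fun x : V => TangentSpace (𝓡 n) x →L[ℝ] ℝ) (𝔼 →L[ℝ] ℝ) (π q) (α q)) S
      (trivializationAt (𝔼 →L[ℝ] ℝ)
        (fun x : V => TangentSpace (𝓡 n) x →L[ℝ] Bundle.Trivial V ℝ x) x₀).source := by
    intro q hq
    have := mem_baseSet_of_mem_source (hS q hq)
    rw [hom_trivializationAt_source]
    simpa using this
  refine ((trivializationAt (𝔼 →L[ℝ] ℝ)
    (fun x : V => TangentSpace (𝓡 n) x →L[ℝ] Bundle.Trivial V ℝ x) x₀).contMDiffOn_iff he).trans ?_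
  refine and_congr_right fun _ => contMDiffOn_congr fun q hq => ?_
  rw [hom_trivializationAt, Bundle.Trivialization.continuousLinearMap_apply]
  ext v
  simp [chartDInv]

end Smoothness

theorem contDiffAt_extChartAt_comp_symm {x₀ x p : V} (hx₀ : p ∈ (extChartAt (𝓡 n) x₀).source)
    (hx : p ∈ (extChartAt (𝓡 n) x).source) :
    ContDiffAt ℝ ∞ (extChartAt (𝓡 n) x₀ ∘ (extChartAt (𝓡 n) x).symm)
      (extChartAt (𝓡 n) x p) := by
  have := contDiffWithinAt_ext_coord_change (I := 𝓡 n) (n := ∞) x₀ x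
    (y := extChartAt (𝓡 n) x p) (by
      rw [PartialEquiv.trans_source]
      refine ⟨(extChartAt (𝓡 n) x).map_source hx, ?_⟩
      change (extChartAt (𝓡 n) x).symm (extChartAt (𝓡 n) x p) ∈ (extChartAt (𝓡 n) x₀).source
      rwa [(extChartAt (𝓡 n) x).left_inv hx])
  rwa [modelWithCornersSelf_coe, range_id, contDiffWithinAt_univ] at this

theorem fderiv_extChartAt_comp_symm {x₀ x p : V} (hx₀ : p ∈ (extChartAt (𝓡 n) x₀).source)
    (hx : p ∈ (extChartAt (𝓡 n) x).source) :
    fderiv ℝ (extChartAt (𝓡 n) x₀ ∘ (extChartAt (𝓡 n) x).symm) (extChartAt (𝓡 n) x p) =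
      (chartD x₀ p).comp (chartDInv x p) := by
  have h0 := (extChartAt (𝓡 n) x).left_inv hx
  have h1 : MDifferentiableAt (𝓡 n) 𝓘(ℝ, 𝔼) (extChartAt (𝓡 n) x₀)
      ((extChartAt (𝓡 n) x).symm (extChartAt (𝓡 n) x p)) := by
    rw [h0]
    rw [extChartAt_source] at hx₀
    exact mdifferentiableAt_extChartAt hx₀
  have h2 : MDifferentiableAt 𝓘(ℝ, 𝔼) (𝓡 n) (extChartAt (𝓡 n) x).symm
      (extChartAt (𝓡 n) x p) := by
    have := mdifferentiableWithinAt_extChartAt_symm (I := 𝓡 n)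
      ((extChartAt (𝓡 n) x).map_source hx)
    rwa [modelWithCornersSelf_coe, range_id, mdifferentiableWithinAt_univ] at this
  have h3 := mfderiv_comp (extChartAt (𝓡 n) x p) h1 h2
  rw [mfderiv_eq_fderiv, mfderiv_extChartAt_symm_eq_chartDInv hx] at h3
  have key : ∀ p' (_ : p' = p) (A : 𝔼 →L[ℝ] 𝔼),
      ContinuousLinearMap.comp (mfderiv (𝓡 n) 𝓘(ℝ, 𝔼) (extChartAt (𝓡 n) x₀) p' : 𝔼 →L[ℝ] 𝔼) A =
        ContinuousLinearMap.comp
          (mfderiv (𝓡 n) 𝓘(ℝ, 𝔼) (extChartAt (𝓡 n) x₀) p : 𝔼 →L[ℝ] 𝔼) A := by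
    rintro _ rfl A; rfl
  rw [← mfderiv_extChartAt_eq_chartD hx₀]
  exact h3.trans (key _ h0 _)

/-- The Lie derivative, computed in the chart at another point. -/
theorem lieForm_eq_flatLie {X : (x : V) → TangentSpace (𝓡 n) x}
    {α : (x : V) → TangentSpace (𝓡 n) x →L[ℝ] ℝ} {x₀ x : V}
    (hx : x ∈ (extChartAt (𝓡 n) x₀).source)
    (hα : DifferentiableAt ℝ (coordForm α x₀) (extChartAt (𝓡 n) x₀ x))
    (hX : DifferentiableAt ℝ (coordField X x₀) (extChartAt (𝓡 n) x₀ x))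
    (v : TangentSpace (𝓡 n) x) :
    lieForm X α x v = flatLie (coordField X x₀) (coordForm α x₀) (extChartAt (𝓡 n) x₀ x)
      (chartD x₀ x v) := by
  have hxx := mem_extChartAt_source (I := 𝓡 n) x
  -- The definition of `lieForm` uses the chart at the point itself, which varies with the point.
  -- The transition map `ψ` and naturality of the flat Lie derivative bring everything to the fixed
  -- chart at `x₀`.
  set ψ := extChartAt (𝓡 n) x₀ ∘ (extChartAt (𝓡 n) x).symm with hψ
  set φ := extChartAt (𝓡 n) x ∘ (extChartAt (𝓡 n) x₀).symm with hφ
  set y := extChartAt (𝓡 n) x x with hy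
  have hψy : ψ y = extChartAt (𝓡 n) x₀ x := by
    rw [hψ, hy, Function.comp_apply, extChartAt_to_inv]
  have hev : ∀ᶠ z in 𝓝 y, ∃ p, p ∈ (extChartAt (𝓡 n) x₀).source ∧
      p ∈ (extChartAt (𝓡 n) x).source ∧ extChartAt (𝓡 n) x p = z := by
    have h1 : ∀ᶠ z in 𝓝 y, z ∈ (extChartAt (𝓡 n) x).target := extChartAt_target_mem_nhds x
    have h2 : ∀ᶠ z in 𝓝 y, (extChartAt (𝓡 n) x).symm z ∈ (extChartAt (𝓡 n) x₀).source := by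
      refine (continuousAt_extChartAt_symm x).eventually_mem ?_
      rw [extChartAt_to_inv]
      exact (isOpen_extChartAt_source x₀).mem_nhds hx
    filter_upwards [h1, h2] with z hz1 hz2
    exact ⟨_, hz2, (extChartAt (𝓡 n) x).map_target hz1, (extChartAt (𝓡 n) x).right_inv hz1⟩
  have hform : coordForm α x =ᶠ[𝓝 y] fun z => (coordForm α x₀ (ψ z)).comp (fderiv ℝ ψ z) := by
    filter_upwards [hev] with z hz
    obtain ⟨p, hp₀, hp, rfl⟩ := hz
    rw [fderiv_extChartAt_comp_symm hp₀ hp, hψ, Function.comp_apply,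
      (extChartAt (𝓡 n) x).left_inv hp, coordForm_extChartAt α hp, coordForm_extChartAt α hp₀]
    ext1 w
    change α p (chartDInv x p w) = α p (chartDInv x₀ p (chartD x₀ p (chartDInv x p w)))
    rw [chartDInv_chartD hp₀]
  have hfield : ∀ᶠ z in 𝓝 y, fderiv ℝ ψ z (coordField X x z) = coordField X x₀ (ψ z) := by
    filter_upwards [hev] with z hz
    obtain ⟨p, hp₀, hp, rfl⟩ := hz
    rw [fderiv_extChartAt_comp_symm hp₀ hp, hψ, Function.comp_apply,
      (extChartAt (𝓡 n) x).left_inv hp, coordField_extChartAt X hp, coordField_extChartAt X hp₀]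
    change chartD x₀ p (chartDInv x p (chartD x p (X p))) = _
    rw [chartDInv_chartD hp]
  -- This inverse form of the relation is what gives differentiability of the field in the chart at
  -- `x`.
  have hfield' : coordField X x =ᶠ[𝓝 y] fun z => fderiv ℝ φ (ψ z) (coordField X x₀ (ψ z)) := by
    filter_upwards [hev] with z hz
    obtain ⟨p, hp₀, hp, rfl⟩ := hz
    have h1 : ψ (extChartAt (𝓡 n) x p) = extChartAt (𝓡 n) x₀ p := by
      rw [hψ, Function.comp_apply, (extChartAt (𝓡 n) x).left_inv hp]
    rw [h1, fderiv_extChartAt_comp_symm hp hp₀, coordField_extChartAt X hp,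
      coordField_extChartAt X hp₀]
    change _ = chartD x p (chartDInv x₀ p (chartD x₀ p (X p)))
    rw [chartDInv_chartD hp₀]
  have hψs : ContDiffAt ℝ ∞ ψ y := contDiffAt_extChartAt_comp_symm hx hxx
  have hφs : ContDiffAt ℝ ∞ φ (ψ y) := by
    rw [hψy]; exact contDiffAt_extChartAt_comp_symm hxx hx
  have hψd : DifferentiableAt ℝ ψ y := hψs.differentiableAt (by simp)
  rw [← hψy] at hα hX
  have hX' : DifferentiableAt ℝ (coordField X x) y := by
    refine hfield'.differentiableAt_iff.2 ?_
    have h1 : DifferentiableAt ℝ (fderiv ℝ φ) (ψ y) :=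
      (hφs.fderiv_right (m := 1) (WithTop.coe_le_coe.2 le_top)).differentiableAt one_ne_zero
    exact (h1.clm_apply hX).comp y hψd
  rw [lieForm, flatLie_congr hform (Filter.EventuallyEq.refl _ _),
    flatLie_pullback (hψs.of_le (WithTop.coe_le_coe.2 le_top)) hα hX hX' hfield, hψy, coordVec_eq_chartD,
    fderiv_extChartAt_comp_symm hx hxx]
  change flatLie _ _ _ (chartD x₀ x (chartDInv x x (chartD x x v))) = _
  rw [chartDInv_chartD hxx]

end Coordinates

/-! ### Moving domains and smooth families in and out of a chart -/

section ChartTransfer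

variable {n : ℕ} {V : Type*} [TopologicalSpace V] [ChartedSpace (EuclideanSpace ℝ (Fin n)) V]
  {P : Type*} [TopologicalSpace P]

local notation "𝔼" => EuclideanSpace ℝ (Fin n)

/-- The part of `O` over the domain of the chart at `x₀`, in that chart. -/
def chartPush (x₀ : V) (O : Set (P × ℝ × V)) : Set (P × ℝ × 𝔼) :=
  {q | q.2.2 ∈ (extChartAt (𝓡 n) x₀).target ∧
    (q.1, q.2.1, (extChartAt (𝓡 n) x₀).symm q.2.2) ∈ O}

/-- The set of points over the domain of the chart at `x₀` that lie in `O` in that chart. -/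
def chartPull (x₀ : V) (O : Set (P × ℝ × 𝔼)) : Set (P × ℝ × V) :=
  {q | q.2.2 ∈ (extChartAt (𝓡 n) x₀).source ∧
    (q.1, q.2.1, extChartAt (𝓡 n) x₀ q.2.2) ∈ O}

theorem isOpen_chartPush (x₀ : V) {O : Set (P × ℝ × V)} (hO : IsOpen O) :
    IsOpen (chartPush (n := n) x₀ O) := by
  have h1 : ContinuousOn (fun q : P × ℝ × 𝔼 => (q.1, q.2.1, (extChartAt (𝓡 n) x₀).symm q.2.2))
      {q | q.2.2 ∈ (extChartAt (𝓡 n) x₀).target} := by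
    have := (continuousOn_extChartAt_symm (I := 𝓡 n) x₀).comp
      (f := fun q : P × ℝ × 𝔼 => q.2.2) (s := {q | q.2.2 ∈ (extChartAt (𝓡 n) x₀).target})
      (by fun_prop) (fun q hq => hq)
    exact continuousOn_fst.prodMk ((by fun_prop : Continuous fun q : P × ℝ × 𝔼 =>
      q.2.1).continuousOn.prodMk this)
  exact h1.isOpen_inter_preimage ((isOpen_extChartAt_target x₀).preimage (by fun_prop)) hO

theorem continuousOn_chartPull (x₀ : V) :
    ContinuousOn (fun q : P × ℝ × V => (q.1, q.2.1, extChartAt (𝓡 n) x₀ q.2.2))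
      {q | q.2.2 ∈ (extChartAt (𝓡 n) x₀).source} := by
  have := (continuousOn_extChartAt (I := 𝓡 n) x₀).comp
    (f := fun q : P × ℝ × V => q.2.2) (s := {q | q.2.2 ∈ (extChartAt (𝓡 n) x₀).source})
    (by fun_prop) (fun q hq => hq)
  exact continuousOn_fst.prodMk ((by fun_prop : Continuous fun q : P × ℝ × V =>
    q.2.1).continuousOn.prodMk this)

theorem isOpen_chartPull (x₀ : V) {O : Set (P × ℝ × 𝔼)} (hO : IsOpen O) :
    IsOpen (chartPull x₀ O) :=
  (continuousOn_chartPull x₀).isOpen_inter_preimage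
    ((isOpen_extChartAt_source x₀).preimage (by fun_prop)) hO

variable [IsManifold (𝓡 n) ∞ V] {F K : Type*} [NormedAddCommGroup F] [NormedSpace ℝ F]
  [TopologicalSpace K] {J : ModelWithCorners ℝ F K} [ChartedSpace K P]

theorem contMDiffOn_chartPush (x₀ : V) (O : Set (P × ℝ × V)) :
    ContMDiffOn (J.prod (𝓘(ℝ, ℝ).prod 𝓘(ℝ, 𝔼))) (J.prod (𝓘(ℝ, ℝ).prod (𝓡 n))) ∞
      (fun q : P × ℝ × 𝔼 => (q.1, q.2.1, (extChartAt (𝓡 n) x₀).symm q.2.2))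
      (timeRestrict (chartPush x₀ O)) := by
  have h1 : ContMDiffOn (J.prod (𝓘(ℝ, ℝ).prod 𝓘(ℝ, 𝔼))) (𝓡 n) ∞
      (fun q : P × ℝ × 𝔼 => (extChartAt (𝓡 n) x₀).symm q.2.2) (timeRestrict (chartPush x₀ O)) :=
    (contMDiffOn_extChartAt_symm (I := 𝓡 n) (n := ∞) x₀).comp
      (contMDiff_snd.comp contMDiff_snd).contMDiffOn (fun q hq => hq.1.1)
  exact contMDiffOn_fst.prodMk ((contMDiff_fst.comp contMDiff_snd).contMDiffOn.prodMk h1)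

theorem contMDiffOn_chartPull (x₀ : V) (O : Set (P × ℝ × 𝔼)) :
    ContMDiffOn (J.prod (𝓘(ℝ, ℝ).prod (𝓡 n))) (J.prod (𝓘(ℝ, ℝ).prod 𝓘(ℝ, 𝔼))) ∞
      (fun q : P × ℝ × V => (q.1, q.2.1, extChartAt (𝓡 n) x₀ q.2.2))
      (timeRestrict (chartPull x₀ O)) := by
  have h1 : ContMDiffOn (J.prod (𝓘(ℝ, ℝ).prod (𝓡 n))) 𝓘(ℝ, 𝔼) ∞
      (fun q : P × ℝ × V => extChartAt (𝓡 n) x₀ q.2.2) (timeRestrict (chartPull x₀ O)) :=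
    (contMDiffOn_extChartAt (I := 𝓡 n) (n := ∞) (x := x₀)).comp
      (contMDiff_snd.comp contMDiff_snd).contMDiffOn
      (fun q hq => by simpa using hq.1.1)
  exact contMDiffOn_fst.prodMk ((contMDiff_fst.comp contMDiff_snd).contMDiffOn.prodMk h1)

theorem SmoothFormsOn.contMDiffOn_coordForm {α : P → ℝ → (x : V) → TangentSpace (𝓡 n) x →L[ℝ] ℝ}
    {O : Set (P × ℝ × V)} (hα : SmoothFormsOn (J.prod (𝓘(ℝ, ℝ).prod (𝓡 n)))
      (fun q : P × ℝ × V => q.2.2) (fun q => α q.1 q.2.1 q.2.2) (timeRestrict O)) (x₀ : V) :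
    ContMDiffOn (J.prod (𝓘(ℝ, ℝ).prod 𝓘(ℝ, 𝔼))) 𝓘(ℝ, 𝔼 →L[ℝ] ℝ) ∞
      (fun q : P × ℝ × 𝔼 => coordForm (α q.1 q.2.1) x₀ q.2.2)
      (timeRestrict (chartPush x₀ O)) := by
  have hS : ∀ q ∈ timeRestrict (O ∩ {q | q.2.2 ∈ (extChartAt (𝓡 n) x₀).source}),
      q.2.2 ∈ (extChartAt (𝓡 n) x₀).source := fun q hq => hq.1.2
  have h1 := (smoothFormsOn_iff x₀ hS).1
    (ContMDiffOn.mono hα (timeRestrict_mono inter_subset_left))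
  refine (h1.2.comp (contMDiffOn_chartPush x₀ O) fun q hq =>
    ⟨⟨hq.1.2, (extChartAt (𝓡 n) x₀).map_target hq.1.1⟩, hq.2⟩).congr fun q hq => ?_
  have := coordForm_extChartAt (α q.1 q.2.1) ((extChartAt (𝓡 n) x₀).map_target hq.1.1)
  rwa [(extChartAt (𝓡 n) x₀).right_inv hq.1.1] at this

theorem SmoothFieldsOn.contMDiffOn_coordField {X : P → ℝ → (x : V) → TangentSpace (𝓡 n) x}
    {O : Set (P × ℝ × V)} (hX : SmoothFieldsOn (J.prod (𝓘(ℝ, ℝ).prod (𝓡 n)))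
      (fun q : P × ℝ × V => q.2.2) (fun q => X q.1 q.2.1 q.2.2) (timeRestrict O)) (x₀ : V) :
    ContMDiffOn (J.prod (𝓘(ℝ, ℝ).prod 𝓘(ℝ, 𝔼))) 𝓘(ℝ, 𝔼) ∞
      (fun q : P × ℝ × 𝔼 => coordField (X q.1 q.2.1) x₀ q.2.2)
      (timeRestrict (chartPush x₀ O)) := by
  have hS : ∀ q ∈ timeRestrict (O ∩ {q | q.2.2 ∈ (extChartAt (𝓡 n) x₀).source}),
      q.2.2 ∈ (extChartAt (𝓡 n) x₀).source := fun q hq => hq.1.2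
  have h1 := (smoothFieldsOn_iff x₀ hS).1
    (ContMDiffOn.mono hX (timeRestrict_mono inter_subset_left))
  refine (h1.2.comp (contMDiffOn_chartPush x₀ O) fun q hq =>
    ⟨⟨hq.1.2, (extChartAt (𝓡 n) x₀).map_target hq.1.1⟩, hq.2⟩).congr fun q hq => ?_
  have := coordField_extChartAt (X q.1 q.2.1) ((extChartAt (𝓡 n) x₀).map_target hq.1.1)
  rwa [(extChartAt (𝓡 n) x₀).right_inv hq.1.1] at this

/-- The vector field on the domain of the chart at `x₀` that is `X` in that chart. -/
noncomputable def fieldOfChart (x₀ : V) (X : 𝔼 → 𝔼) (x : V) : TangentSpace (𝓡 n) x :=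
  chartDInv x₀ x (X (extChartAt (𝓡 n) x₀ x))

theorem coordField_fieldOfChart (x₀ : V) (X : 𝔼 → 𝔼) {y : 𝔼}
    (hy : y ∈ (extChartAt (𝓡 n) x₀).target) : coordField (fieldOfChart x₀ X) x₀ y = X y := by
  have h1 := (extChartAt (𝓡 n) x₀).map_target hy
  have := coordField_extChartAt (fieldOfChart x₀ X) h1
  rwa [fieldOfChart, chartD_chartDInv h1, (extChartAt (𝓡 n) x₀).right_inv hy] at this

theorem eq_fieldOfChart_of_coordField_eq {X : (x : V) → TangentSpace (𝓡 n) x} {x₀ x : V}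
    (hx : x ∈ (extChartAt (𝓡 n) x₀).source) {Y : 𝔼 → 𝔼}
    (h : coordField X x₀ (extChartAt (𝓡 n) x₀ x) = Y (extChartAt (𝓡 n) x₀ x)) :
    X x = fieldOfChart x₀ Y x := by
  rw [fieldOfChart, ← h, coordField_extChartAt X hx, chartDInv_chartD hx]

theorem smoothFieldsOn_fieldOfChart (x₀ : V) {X : P × ℝ × 𝔼 → 𝔼} {O : Set (P × ℝ × 𝔼)}
    (hX : ContMDiffOn (J.prod (𝓘(ℝ, ℝ).prod 𝓘(ℝ, 𝔼))) 𝓘(ℝ, 𝔼) ∞ X (timeRestrict O)) :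
    SmoothFieldsOn (J.prod (𝓘(ℝ, ℝ).prod (𝓡 n))) (fun q : P × ℝ × V => q.2.2)
      (fun q => fieldOfChart x₀ (fun y => X (q.1, q.2.1, y)) q.2.2)
      (timeRestrict (chartPull x₀ O)) := by
  rw [smoothFieldsOn_iff x₀ (fun q hq => hq.1.1)]
  refine ⟨(contMDiff_snd.comp contMDiff_snd).contMDiffOn, ?_⟩
  refine (hX.comp (contMDiffOn_chartPull x₀ O) (fun q hq => ⟨hq.1.2, hq.2⟩)).congr fun q hq => ?_
  rw [fieldOfChart, chartD_chartDInv hq.1.1]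
  rfl

end ChartTransfer

/-! ### Contact, transversality and the Lie equation read in a chart -/

section LocalSolutionOnManifold

variable {n : ℕ} {V : Type*} [TopologicalSpace V] [ChartedSpace (EuclideanSpace ℝ (Fin n)) V]
  [IsManifold (𝓡 n) ∞ V]

local notation "𝔼" => EuclideanSpace ℝ (Fin n)

theorem derivWithin_form_apply {α : ℝ → (x : V) → TangentSpace (𝓡 n) x →L[ℝ] ℝ} {x₀ x : V}
    (hx : x ∈ (extChartAt (𝓡 n) x₀).source) {t : ℝ} (ht : t ∈ Icc (0 : ℝ) 1)
    (hd : DifferentiableWithinAt ℝ (fun s => coordForm (α s) x₀ (extChartAt (𝓡 n) x₀ x))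
      (Icc 0 1) t) (v : TangentSpace (𝓡 n) x) :
    derivWithin (fun s => α s x v) (Icc 0 1) t =
      derivWithin (fun s => coordForm (α s) x₀ (extChartAt (𝓡 n) x₀ x)) (Icc 0 1) t
        (chartD x₀ x v) := by
  have h1 := (hd.hasDerivWithinAt.clm_apply
    (hasDerivWithinAt_const t (Icc (0 : ℝ) 1) (chartD x₀ x v)))
  have h2 : (fun s => α s x v) = fun s => coordForm (α s) x₀ (extChartAt (𝓡 n) x₀ x)
      (chartD x₀ x v) := by
    ext s
    rw [coordForm_extChartAt (α s) hx]
    change _ = α s x (chartDInv x₀ x (chartD x₀ x v))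
    rw [chartDInv_chartD hx]
  rw [h2, h1.derivWithin (uniqueDiffOn_Icc zero_lt_one t ht)]
  simp

/-- The equation `L_X α + (d/dt) α = 0` at a point, in the chart at another point. -/
theorem lieEquation_iff_flat {α : ℝ → (x : V) → TangentSpace (𝓡 n) x →L[ℝ] ℝ}
    {X : (x : V) → TangentSpace (𝓡 n) x} {x₀ x : V}
    (hx : x ∈ (extChartAt (𝓡 n) x₀).source) {t : ℝ} (ht : t ∈ Icc (0 : ℝ) 1)
    (hα : DifferentiableAt ℝ (coordForm (α t) x₀) (extChartAt (𝓡 n) x₀ x))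
    (hX : DifferentiableAt ℝ (coordField X x₀) (extChartAt (𝓡 n) x₀ x))
    (hd : DifferentiableWithinAt ℝ (fun s => coordForm (α s) x₀ (extChartAt (𝓡 n) x₀ x))
      (Icc 0 1) t) :
    (∀ v : TangentSpace (𝓡 n) x,
      lieForm X (α t) x v + derivWithin (fun s => α s x v) (Icc 0 1) t = 0) ↔
    ∀ w : 𝔼, flatLie (coordField X x₀) (coordForm (α t) x₀) (extChartAt (𝓡 n) x₀ x) w +
      derivWithin (fun s => coordForm (α s) x₀ (extChartAt (𝓡 n) x₀ x)) (Icc 0 1) t w = 0 := by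
  constructor
  · intro h w
    have := h (chartDInv x₀ x w)
    rwa [lieForm_eq_flatLie hx hα hX, derivWithin_form_apply hx ht hd, chartD_chartDInv hx] at this
  · intro h v
    rw [lieForm_eq_flatLie hx hα hX, derivWithin_form_apply hx ht hd]
    exact h _

theorem coordForm_apply_coordField {α : (x : V) → TangentSpace (𝓡 n) x →L[ℝ] ℝ}
    {X : (x : V) → TangentSpace (𝓡 n) x} {x₀ x : V}
    (hx : x ∈ (extChartAt (𝓡 n) x₀).source) :
    coordForm α x₀ (extChartAt (𝓡 n) x₀ x) (coordField X x₀ (extChartAt (𝓡 n) x₀ x)) =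
      α x (X x) := by
  rw [coordForm_extChartAt α hx, coordField_extChartAt X hx]
  change α x (chartDInv x₀ x (chartD x₀ x (X x))) = _
  rw [chartDInv_chartD hx]

theorem fderiv_comp_extChartAt_symm {f : V → ℝ} {x : V}
    (hf : MDifferentiableAt (𝓡 n) 𝓘(ℝ, ℝ) f x) (v : 𝔼) :
    fderiv ℝ (fun y => f ((extChartAt (𝓡 n) x).symm y)) (extChartAt (𝓡 n) x x) v =
      mfderiv (𝓡 n) 𝓘(ℝ, ℝ) f x (chartDInv x x v) := by
  have hx := mem_extChartAt_source (I := 𝓡 n) x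
  have h0 := extChartAt_to_inv (I := 𝓡 n) x
  have h2 : MDifferentiableAt 𝓘(ℝ, 𝔼) (𝓡 n) (extChartAt (𝓡 n) x).symm
      (extChartAt (𝓡 n) x x) := by
    have := mdifferentiableWithinAt_extChartAt_symm (I := 𝓡 n)
      ((extChartAt (𝓡 n) x).map_source hx)
    rwa [modelWithCornersSelf_coe, range_id, mdifferentiableWithinAt_univ] at this
  have h3 := mfderiv_comp (extChartAt (𝓡 n) x x) (g := f) (by rwa [h0]) h2
  rw [mfderiv_eq_fderiv, mfderiv_extChartAt_symm_eq_chartDInv hx] at h3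
  have key : ∀ x' (_ : x' = x) (w : 𝔼), (mfderiv (𝓡 n) 𝓘(ℝ, ℝ) f x' : 𝔼 →L[ℝ] ℝ) w =
      (mfderiv (𝓡 n) 𝓘(ℝ, ℝ) f x : 𝔼 →L[ℝ] ℝ) w := by
    rintro _ rfl A; rfl
  exact (congrArg (fun A : 𝔼 →L[ℝ] ℝ => A v) h3).trans (key _ h0 _)

/-- A vector that looks like the Reeb vector in coordinates comes from a Reeb vector on the
manifold; if it annihilated the defining function, that vector would be tangent to `L`. -/
theorem flat_transversality {α : (x : V) → TangentSpace (𝓡 n) x →L[ℝ] ℝ} {L O : Set V} {f : V → ℝ}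
    {x : V} (hxO : x ∈ O) (hf : IsDefiningFunction (n := n) L O f)
    (h : ∀ v, IsReebVector α x v → ¬ IsTangentTo L x v) (v : 𝔼)
    (h1 : coordForm α x (extChartAt (𝓡 n) x x) v = 1)
    (h2 : ∀ w, flatD (coordForm α x) (extChartAt (𝓡 n) x x) v w = 0) :
    fderiv ℝ (fun y => f ((extChartAt (𝓡 n) x).symm y)) (extChartAt (𝓡 n) x x) v ≠ 0 := by
  have hx := mem_extChartAt_source (I := 𝓡 n) x
  intro h0
  rw [fderiv_comp_extChartAt_symm ((hf.smooth.contMDiffAt (hf.isOpen.mem_nhds hxO)).mdifferentiableAt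
    (by simp))] at h0
  refine h (chartDInv x x v) ⟨?_, fun w => ?_⟩ ⟨O, f, hxO, hf, h0⟩
  · rw [coordForm_extChartAt α hx] at h1
    exact h1
  · rw [dForm, coordVec_eq_chartD, chartD_chartDInv hx]
    exact h2 _

theorem isFlatContactAt_coordForm {α : (x : V) → TangentSpace (𝓡 n) x →L[ℝ] ℝ}
    {x : V} (h : IsContactPair (α x) (dForm α x)) :
    IsFlatContactAt (coordForm α x) (extChartAt (𝓡 n) x x) := by
  have hx := mem_extChartAt_source (I := 𝓡 n) x
  have hα : ∀ w, coordForm α x (extChartAt (𝓡 n) x x) w = α x (chartDInv x x w) := fun w => by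
    rw [coordForm_extChartAt α hx]; rfl
  refine ⟨fun h0 => h.1 ?_, fun v hv hvw => ?_⟩
  · ext v
    have := hα (chartD x x v)
    rw [h0, chartDInv_chartD hx] at this
    exact this.symm
  · rw [hα] at hv
    have := h.2 _ hv fun w hw => by
      rw [dForm, coordVec_eq_chartD, coordVec_eq_chartD, chartD_chartDInv hx]
      refine hvw _ ?_
      rwa [hα, chartDInv_chartD hx]
    rw [← chartD_chartDInv hx v, this, map_zero]

end LocalSolutionOnManifold

/-! ### Local solutions on a manifold, with uniqueness near the hypersurface -/

section LocalLieSolution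

open Metric

universe u

variable {n : ℕ} {V : Type*} [TopologicalSpace V] [ChartedSpace (EuclideanSpace ℝ (Fin n)) V]
  [IsManifold (𝓡 n) ∞ V] {F : Type u} {K P : Type*} [NormedAddCommGroup F] [NormedSpace ℝ F]
  [TopologicalSpace K] (J : ModelWithCorners ℝ F K) [TopologicalSpace P]
  [ChartedSpace K P] [IsManifold J ∞ P]

local notation "𝔼" => EuclideanSpace ℝ (Fin n)

/-- On `O`, the smooth family `X` of vector fields solves `L_X α + (d/dt) α = 0`, with `α(X) = h`
on the hypersurfaces `L`. -/
structure IsLieSolution (α : P → ℝ → (x : V) → TangentSpace (𝓡 n) x →L[ℝ] ℝ) (L : Set (P × V))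
    (h : P × ℝ × V → ℝ) (X : P → ℝ → (x : V) → TangentSpace (𝓡 n) x)
    (O : Set (P × ℝ × V)) : Prop where
  smooth : SmoothFieldsOn (J.prod (𝓘(ℝ, ℝ).prod (𝓡 n))) (fun q : P × ℝ × V => q.2.2)
    (fun q => X q.1 q.2.1 q.2.2) (timeRestrict O)
  solves : ∀ q ∈ timeRestrict O, ∀ v : TangentSpace (𝓡 n) q.2.2,
    lieForm (X q.1 q.2.1) (α q.1 q.2.1) q.2.2 v +
      derivWithin (fun s => α q.1 s q.2.2 v) (Icc 0 1) q.2.1 = 0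
  initial : ∀ q ∈ timeRestrict O, (q.1, q.2.2) ∈ L → α q.1 q.2.1 q.2.2 (X q.1 q.2.1 q.2.2) = h q

theorem ContMDiffOn.contDiffAt_of_slice {F K P E H : Type*} [NormedAddCommGroup F]
    [NormedSpace ℝ F] [TopologicalSpace K] (J : ModelWithCorners ℝ F K) [TopologicalSpace P]
    [ChartedSpace K P] [NormedAddCommGroup E] [NormedSpace ℝ E] [NormedAddCommGroup H]
    [NormedSpace ℝ H] {f : P × ℝ × E → H} {D : Set (P × ℝ × E)}
    (hf : ContMDiffOn (J.prod (𝓘(ℝ, ℝ).prod 𝓘(ℝ, E))) 𝓘(ℝ, H) ∞ f (timeRestrict D))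
    (hD : IsOpen D) {q : P × ℝ × E} (hq : q ∈ timeRestrict D) :
    ContDiffAt ℝ ∞ (fun y => f (q.1, q.2.1, y)) q.2.2 := by
  have h1 : ContMDiffOn 𝓘(ℝ, E) 𝓘(ℝ, H) ∞ (fun y => f (q.1, q.2.1, y))
      ((fun y => (q.1, q.2.1, y)) ⁻¹' D) :=
    hf.comp (contMDiff_const.prodMk (contMDiff_const.prodMk contMDiff_id)).contMDiffOn
      (fun y hy => ⟨hy, hq.2⟩)
  exact (contMDiffOn_iff_contDiffOn.1 h1).contDiffAt ((hD.preimage (by fun_prop)).mem_nhds hq.1)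

variable {J} {α : P → ℝ → (x : V) → TangentSpace (𝓡 n) x →L[ℝ] ℝ} {L : Set (P × V)}
  {h : P × ℝ × V → ℝ}

/-- The data `α`, `(d/dt) α` in the chart at `x₀`. -/
theorem smooth_chart_data
    (hα : SmoothFormsOn (J.prod (𝓘(ℝ, ℝ).prod (𝓡 n))) (fun q : P × ℝ × V => q.2.2)
      (fun q => α q.1 q.2.1 q.2.2) (timeDomain univ)) (x₀ : V) {O : Set (P × ℝ × V)}
    (hO : IsOpen O) :
    ContMDiffOn (J.prod (𝓘(ℝ, ℝ).prod 𝓘(ℝ, 𝔼))) 𝓘(ℝ, 𝔼 →L[ℝ] ℝ) ∞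
      (fun q : P × ℝ × 𝔼 => coordForm (α q.1 q.2.1) x₀ q.2.2) (timeRestrict (chartPush x₀ O)) ∧
    ContMDiffOn (J.prod (𝓘(ℝ, ℝ).prod 𝓘(ℝ, 𝔼))) 𝓘(ℝ, 𝔼 →L[ℝ] ℝ) ∞
      (fun q : P × ℝ × 𝔼 => derivWithin (fun s => coordForm (α q.1 s) x₀ q.2.2) (Icc 0 1) q.2.1)
      (timeRestrict (chartPush x₀ O)) ∧
    ∀ q ∈ timeRestrict (chartPush x₀ O),
      DifferentiableWithinAt ℝ (fun s => coordForm (α q.1 s) x₀ q.2.2) (Icc 0 1) q.2.1 ∧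
      DifferentiableAt ℝ (coordForm (α q.1 q.2.1) x₀) q.2.2 := by
  have h1 := SmoothFormsOn.contMDiffOn_coordForm (O := O)
    (ContMDiffOn.mono hα (fun q hq => ⟨hq.2, trivial⟩)) x₀
  have h2 := h1.time_derivWithin J (isOpen_chartPush x₀ hO)
  refine ⟨h1, h2.1, fun q hq => ⟨h2.2 q hq, ?_⟩⟩
  exact (h1.contDiffAt_of_slice J (isOpen_chartPush x₀ hO) hq).differentiableAt (by simp)

/-- Every solution on the manifold thereby becomes a competitor in the uniqueness clause of the flat
problem. -/
theorem IsLieSolution.isFlatSolution {X : P → ℝ → (x : V) → TangentSpace (𝓡 n) x}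
    {O : Set (P × ℝ × V)} (hX : IsLieSolution J α L h X O) (hO : IsOpen O)
    (hα : SmoothFormsOn (J.prod (𝓘(ℝ, ℝ).prod (𝓡 n))) (fun q : P × ℝ × V => q.2.2)
      (fun q => α q.1 q.2.1 q.2.2) (timeDomain univ)) (x₀ : V)
    {W : Set (P × V)} {f : P × V → ℝ} (hf : ∀ q ∈ W, q ∈ L ↔ f q = 0) {u : P} {t : ℝ}
    (ht : t ∈ Icc (0 : ℝ) 1) {B : Set 𝔼} (hB : ∀ y ∈ B, (u, t, y) ∈ chartPush x₀ O ∧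
      (u, (extChartAt (𝓡 n) x₀).symm y) ∈ W) :
    IsFlatSolution (coordForm (α u t) x₀)
      (fun y => derivWithin (fun s => coordForm (α u s) x₀ y) (Icc 0 1) t)
      (fun y => f (u, (extChartAt (𝓡 n) x₀).symm y))
      (fun y => h (u, t, (extChartAt (𝓡 n) x₀).symm y)) (coordField (X u t) x₀) B := by
  intro y hy
  obtain ⟨hyO, hyW⟩ := hB y hy
  obtain ⟨-, -, hdata⟩ := smooth_chart_data hα x₀ hO
  obtain ⟨hd1, hd2⟩ := hdata (u, t, y) ⟨hyO, ht⟩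
  have hXd : DifferentiableAt ℝ (coordField (X u t) x₀) y :=
    ((hX.smooth.contMDiffOn_coordField x₀).contDiffAt_of_slice J (isOpen_chartPush x₀ hO)
      (q := (u, t, y)) ⟨hyO, ht⟩).differentiableAt (by simp)
  set x := (extChartAt (𝓡 n) x₀).symm y with hx
  have hxs : x ∈ (extChartAt (𝓡 n) x₀).source := (extChartAt (𝓡 n) x₀).map_target hyO.1
  have hxy : extChartAt (𝓡 n) x₀ x = y := (extChartAt (𝓡 n) x₀).right_inv hyO.1
  have h1 := lieEquation_iff_flat (α := α u) (X := X u t) hxs ht (by rwa [hxy]) (by rwa [hxy])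
    (by rwa [hxy])
  rw [hxy] at h1
  refine ⟨hXd, h1.1 (hX.solves (u, t, x) ⟨hyO.2, ht⟩), fun h0 => ?_⟩
  have h2 := coordForm_apply_coordField (α := α u t) (X := X u t) hxs
  rw [hxy] at h2
  rw [h2]
  exact hX.initial (u, t, x) ⟨hyO.2, ht⟩ ((hf _ hyW).2 h0)

/-- Local solutions near a hypersurface that is transverse to the Reeb field. -/
theorem exists_local_lie_solution [CompleteSpace F]
    (hα : SmoothFormsOn (J.prod (𝓘(ℝ, ℝ).prod (𝓡 n))) (fun q : P × ℝ × V => q.2.2)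
      (fun q => α q.1 q.2.1 q.2.2) (timeDomain univ))
    (hh : ContMDiffOn (J.prod (𝓘(ℝ, ℝ).prod (𝓡 n))) 𝓘(ℝ, ℝ) ∞ h (timeDomain univ))
    {u₀ : P} {t₀ : ℝ} {x₀ : V} (ht₀ : t₀ ∈ Icc (0 : ℝ) 1) (hL₀ : (u₀, x₀) ∈ L)
    (hc : IsContactForm (α u₀ t₀))
    (htr : ∀ v, IsReebVector (α u₀ t₀) x₀ v → ¬ IsTangentTo (slice L u₀) x₀ v)
    (hL : IsHypersurfaceFamily (n := n) J L) :
    ∃ (O : Set (P × ℝ × V)) (X : P → ℝ → (x : V) → TangentSpace (𝓡 n) x), IsOpen O ∧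
      (u₀, t₀, x₀) ∈ O ∧ IsLieSolution J α L h X O ∧
      (∀ O' X', IsOpen O' → IsLieSolution J α L h X' O' → ∀ q ∈ timeRestrict O,
        (q.1, q.2.2) ∈ L → q ∈ O' → ∀ᶠ q' in 𝓝[{q' | q'.2.1 ∈ Icc (0 : ℝ) 1}] q,
          X' q'.1 q'.2.1 q'.2.2 = X q'.1 q'.2.1 q'.2.2) ∧
      ∀ q ∈ timeRestrict O, (∀ s ∈ Icc (0 : ℝ) 1, α q.1 s = α q.1 0) →
        (∀ x, h (q.1, q.2.1, x) = 0) → X q.1 q.2.1 q.2.2 = 0 := by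
  obtain ⟨W, f, hW₀, hWo, hfs, hfr, hfL⟩ := hL _ hL₀
  set κ := extChartAt (𝓡 n) x₀ with hκ
  set D₀ : Set (P × ℝ × V) := {q | (q.1, q.2.2) ∈ W} with hD₀
  have hD₀o : IsOpen D₀ := hWo.preimage (by fun_prop)
  set D := chartPush (n := n) x₀ D₀ with hD
  have hDo : IsOpen D := isOpen_chartPush x₀ hD₀o
  obtain ⟨ha, hb, hdata⟩ := smooth_chart_data hα x₀ hD₀o
  have hpush := contMDiffOn_chartPush (n := n) (J := J) x₀ D₀
  have hℓ : ContMDiffOn (J.prod (𝓘(ℝ, ℝ).prod 𝓘(ℝ, 𝔼))) 𝓘(ℝ, ℝ) ∞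
      (fun q : P × ℝ × 𝔼 => f (q.1, κ.symm q.2.2)) (timeRestrict D) := by
    have h1 : ContMDiffOn (J.prod (𝓘(ℝ, ℝ).prod (𝓡 n))) 𝓘(ℝ, ℝ) ∞
        (fun q : P × ℝ × V => f (q.1, q.2.2)) D₀ :=
      hfs.comp (contMDiff_fst.prodMk (contMDiff_snd.comp contMDiff_snd)).contMDiffOn
        (fun q hq => hq)
    exact h1.comp hpush (fun q hq => hq.1.2)
  have hhc : ContMDiffOn (J.prod (𝓘(ℝ, ℝ).prod 𝓘(ℝ, 𝔼))) 𝓘(ℝ, ℝ) ∞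
      (fun q : P × ℝ × 𝔼 => h (q.1, q.2.1, κ.symm q.2.2)) (timeRestrict D) :=
    hh.comp hpush (fun q hq => ⟨hq.2, trivial⟩)
  have hx₀ := mem_extChartAt_source (I := 𝓡 n) x₀
  have hinv : κ.symm (κ x₀) = x₀ := κ.left_inv hx₀
  have hq₀ : (u₀, t₀, κ x₀) ∈ timeRestrict D := by
    refine ⟨⟨κ.map_source hx₀, ?_⟩, ht₀⟩
    change (u₀, κ.symm (κ x₀)) ∈ W
    rwa [hinv]
  have hxW : x₀ ∈ slice W u₀ := hW₀
  have hslice : IsDefiningFunction (n := n) (slice L u₀) (slice W u₀) (fun x => f (u₀, x)) := by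
    refine ⟨hWo.preimage (by fun_prop), ?_, fun x hx => hfr (u₀, x) hx,
      fun x hx => hfL (u₀, x) hx⟩
    exact hfs.comp (contMDiff_const.prodMk contMDiff_id).contMDiffOn (fun x hx => hx)
  have hc' : IsFlatContactAt (fun y => coordForm (α u₀ t₀) x₀ y) (κ x₀) :=
    isFlatContactAt_coordForm (hc x₀)
  have htr' : ∀ v, coordForm (α u₀ t₀) x₀ (κ x₀) v = 1 →
      (∀ w, flatD (fun y => coordForm (α u₀ t₀) x₀ y) (κ x₀) v w = 0) →
      fderiv ℝ (fun y => f (u₀, κ.symm y)) (κ x₀) v ≠ 0 :=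
    flat_transversality (x := x₀) (O := slice W u₀) (f := fun x => f (u₀, x)) hxW hslice htr
  have hℓ₀ : f (u₀, κ.symm (κ x₀)) = 0 := by rw [hinv]; exact (hfL _ hW₀).1 hL₀
  obtain ⟨O, X, C, hO, hqO, hOD, hC, hXs, hX, hball, hun⟩ :=
    exists_local_flat_solution J hDo ha hb hℓ hhc hq₀ hℓ₀ hc' htr'
  have hmem : ∀ q ∈ timeRestrict (chartPull x₀ O), q.2.2 ∈ κ.source ∧
      (q.1, q.2.1, κ q.2.2) ∈ timeRestrict O ∧ κ.symm (κ q.2.2) = q.2.2 ∧ (q.1, q.2.2) ∈ W := by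
    intro q hq
    have h1 := κ.left_inv hq.1.1
    have h2 : (q.1, κ.symm (κ q.2.2)) ∈ W := (hOD hq.1.2).2
    exact ⟨hq.1.1, ⟨hq.1.2, hq.2⟩, h1, h1 ▸ h2⟩
  refine ⟨chartPull x₀ O, fun u t => fieldOfChart x₀ (fun y => X (u, t, y)),
    isOpen_chartPull x₀ hO, ⟨hx₀, hqO⟩, ⟨smoothFieldsOn_fieldOfChart x₀ hXs, ?_, ?_⟩, ?_, ?_⟩
  · intro q hq
    obtain ⟨h1, h2, h3, h4⟩ := hmem q hq
    obtain ⟨hd1, hd2⟩ := hdata _ (timeRestrict_mono hOD h2)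
    obtain ⟨hX1, hX2, -⟩ := hX _ h2 _ rfl
    have hev : coordField (fieldOfChart x₀ fun y => X (q.1, q.2.1, y)) x₀ =ᶠ[𝓝 (κ q.2.2)]
        fun y => X (q.1, q.2.1, y) := by
      filter_upwards [(isOpen_extChartAt_target x₀).mem_nhds (κ.map_source h1)] with y hy
      exact coordField_fieldOfChart x₀ _ hy
    refine (lieEquation_iff_flat (α := α q.1) h1 hq.2 hd2 (hev.differentiableAt_iff.2 hX1) hd1).2
      fun w => ?_
    rw [flatLie_congr (Filter.EventuallyEq.refl _ _) hev]
    exact hX2 w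
  · intro q hq hqL
    obtain ⟨h1, h2, h3, h4⟩ := hmem q hq
    have h5 := (hX _ h2 _ rfl).2.2
    simp only [h3] at h5
    rw [← h5 ((hfL _ h4).1 hqL), coordForm_extChartAt _ h1]
    rfl
  -- On `L` the defining function vanishes, so the balls of radius `C |f|` over which uniqueness
  -- compares solutions shrink towards the point and enter the common domain.
  · intro O' X' hO' hX' q hq hqL hqO'
    obtain ⟨h1, h2, h3, h4⟩ := hmem q hq
    have hT : Filter.Tendsto (fun q' : P × ℝ × V => (q'.1, q'.2.1, κ q'.2.2))
        (𝓝 q) (𝓝 (q.1, q.2.1, κ q.2.2)) :=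
      (continuousOn_chartPull x₀).continuousAt
        (((isOpen_extChartAt_source x₀).preimage (by fun_prop)).mem_nhds h1)
    have hB : chartPush (n := n) x₀ O' ∈ 𝓝 (q.1, q.2.1, κ q.2.2) :=
      (isOpen_chartPush x₀ hO').mem_nhds ⟨κ.map_source h1, by
        change (q.1, q.2.1, κ.symm (κ q.2.2)) ∈ O'
        rwa [h3]⟩
    rw [nhds_prod_eq, nhds_prod_eq, ← Filter.prod_assoc] at hB
    obtain ⟨A, hA, B, hB, hAB⟩ := Filter.mem_prod_iff.1 hB
    obtain ⟨ε, hε, hBε⟩ := Metric.mem_nhds_iff.1 hB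
    have hfq : Filter.Tendsto (fun q' : P × ℝ × V => C * |f (q'.1, q'.2.2)|) (𝓝 q) (𝓝 0) := by
      have h5 : ContinuousAt f (q.1, q.2.2) := hfs.continuousOn.continuousAt (hWo.mem_nhds h4)
      have h6 : Filter.Tendsto (fun q' : P × ℝ × V => f (q'.1, q'.2.2)) (𝓝 q)
          (𝓝 (f (q.1, q.2.2))) :=
        h5.tendsto.comp (by fun_prop : Continuous fun q' : P × ℝ × V =>
          (q'.1, q'.2.2)).continuousAt
      have h7 := (h6.abs).const_mul C
      rwa [(hfL _ h4).1 hqL, abs_zero, mul_zero] at h7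
    have hκq : ∀ᶠ q' : P × ℝ × V in 𝓝 q, dist (κ q'.2.2) (κ q.2.2) < ε / 2 :=
      ((hT.snd_nhds).snd_nhds).eventually (ball_mem_nhds _ (half_pos hε))
    have hAq : ∀ᶠ q' : P × ℝ × V in 𝓝 q, (q'.1, q'.2.1) ∈ A :=
      (hT.fst_nhds.prodMk hT.snd_nhds.fst_nhds).eventually hA
    rw [eventually_nhdsWithin_iff]
    filter_upwards [(isOpen_chartPull x₀ hO).mem_nhds hq.1, hκq, hAq,
      hfq.eventually (gt_mem_nhds (half_pos hε))] with q' hq'1 hq'2 hq'3 hq'4 hq't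
    obtain ⟨h1', h2', h3', h4'⟩ := hmem q' ⟨hq'1, hq't⟩
    have hcb := hball _ h2'
    simp only [h3'] at hcb
    refine eq_fieldOfChart_of_coordField_eq (X := X' q'.1 q'.2.1) (x₀ := x₀) h1'
      (Y := fun y => X (q'.1, q'.2.1, y)) ?_
    have hun' := hun _ h2' {y | (q'.1, q'.2.1, y) ∈ D ∩ chartPush x₀ O'}
      (coordField (X' q'.1 q'.2.1) x₀)
      ((hDo.inter (isOpen_chartPush x₀ hO')).preimage (by fun_prop))
    refine hun' ?_ ?_
    · simp only [h3']
      intro y hy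
      refine ⟨hcb y hy, hAB (show ((q'.1, q'.2.1), y) ∈ A ×ˢ B from ⟨hq'3, hBε ?_⟩)⟩
      rw [mem_closedBall] at hy
      rw [mem_ball]
      linarith [dist_triangle y (κ q'.2.2) (κ q.2.2)]
    · exact hX'.isFlatSolution hO' hα x₀ hfL hq't (fun y hy => ⟨hy.2, hy.1.2⟩)
  -- The zero field solves the problem on the whole slice through `q`, so uniqueness makes `X` zero
  -- at `q`, even off `L`.
  · intro q hq hqα hqh
    obtain ⟨h1, h2, h3, h4⟩ := hmem q hq
    have hb0 : ∀ y, derivWithin (fun s => coordForm (α q.1 s) x₀ y) (Icc 0 1) q.2.1 = 0 := by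
      intro y
      rw [derivWithin_congr (f := fun _ => coordForm (α q.1 0) x₀ y)
        (fun s hs => by rw [hqα s hs]) (by rw [hqα _ hq.2])]
      simp
    have h5 : (0 : 𝔼) = X (q.1, q.2.1, κ q.2.2) := by
      refine hun _ h2 {y | (q.1, q.2.1, y) ∈ D} (fun _ => 0) (hDo.preimage (by fun_prop))
        (fun y hy => hball _ h2 y hy) fun y _ => ⟨differentiableAt_const _, fun v => ?_, fun _ => ?_⟩
      · simp [flatLie, hb0]
      · simp [hqh]
    change chartDInv x₀ q.2.2 (X (q.1, q.2.1, κ q.2.2)) = 0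
    rw [← h5, map_zero]

end LocalLieSolution

/-! ### Cutoffs and locality -/

section Cutoff

/-- A smooth cutoff function, with support in the open set `N`, equal to one near `A`. -/
theorem exists_smooth_cutoff {F K M : Type*} [NormedAddCommGroup F] [NormedSpace ℝ F]
    [FiniteDimensional ℝ F] [TopologicalSpace K] (J : ModelWithCorners ℝ F K) [TopologicalSpace M]
    [ChartedSpace K M] [IsManifold J ∞ M] [T2Space M] [SecondCountableTopology M] {A N : Set M}
    (hA : IsClosed A) (hN : IsOpen N) (hAN : A ⊆ N) :
    ∃ χ : M → ℝ, ContMDiff J 𝓘(ℝ, ℝ) ∞ χ ∧ (∃ O, IsOpen O ∧ A ⊆ O ∧ ∀ x ∈ O, χ x = 1) ∧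
      tsupport χ ⊆ N ∧ ∀ x, χ x ∈ Icc (0 : ℝ) 1 := by
  have := J.locallyCompactSpace
  have := ChartedSpace.locallyCompactSpace K M
  have := TopologicalSpace.metrizableSpace_of_t3_secondCountable M
  obtain ⟨χ, h0, h1, hχ⟩ := exists_contMDiffMap_zero_one_nhds_of_isClosed (n := ⊤) J
    hN.isClosed_compl hA (disjoint_compl_left_iff_subset.2 hAN)
  refine ⟨χ, χ.contMDiff, ?_, ?_, hχ⟩
  · obtain ⟨O, hO, hAO, hO1⟩ := mem_nhdsSet_iff_exists.1 h1
    exact ⟨O, hO, hAO, fun x hx => hO1 hx⟩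
  · intro x hx
    by_contra hxN
    rw [eventually_nhdsSet_iff_forall] at h0
    exact notMem_tsupport_iff_eventuallyEq.2 (h0 x hxN) hx

end Cutoff

section Locality

variable {n : ℕ} {V : Type*} [TopologicalSpace V] [ChartedSpace (EuclideanSpace ℝ (Fin n)) V]

theorem lieForm_congr {X X' : (x : V) → TangentSpace (𝓡 n) x}
    {α : (x : V) → TangentSpace (𝓡 n) x →L[ℝ] ℝ} {x : V} (h : ∀ᶠ x' in 𝓝 x, X x' = X' x')
    (v : TangentSpace (𝓡 n) x) : lieForm X α x v = lieForm X' α x v := by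
  refine flatLie_congr (Filter.EventuallyEq.refl _ _) ?_ _
  have h1 : Filter.Tendsto (extChartAt (𝓡 n) x).symm (𝓝 (extChartAt (𝓡 n) x x)) (𝓝 x) := by
    have := continuousAt_extChartAt_symm (I := 𝓡 n) x
    rwa [ContinuousAt, extChartAt_to_inv] at this
  filter_upwards [h1.eventually h] with y hy
  rw [coordField, coordField, VectorField.mpullback_apply, VectorField.mpullback_apply, hy]

variable [IsManifold (𝓡 n) ∞ V] {F K Q : Type*} [NormedAddCommGroup F] [NormedSpace ℝ F]
  [TopologicalSpace K] {J : ModelWithCorners ℝ F K} [TopologicalSpace Q] [ChartedSpace K Q]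

theorem SmoothFormsOn.contMDiffOn_apply {π : Q → V} {α : (q : Q) → TangentSpace (𝓡 n) (π q) →L[ℝ] ℝ}
    {X : (q : Q) → TangentSpace (𝓡 n) (π q)} {S : Set Q} (hπ : Continuous π)
    (hα : SmoothFormsOn J π α S) (hX : SmoothFieldsOn J π X S) :
    ContMDiffOn J 𝓘(ℝ, ℝ) ∞ (fun q => α q (X q)) S := by
  refine contMDiffOn_of_locally_contMDiffOn fun q hq => ?_
  have hS : ∀ q' ∈ S ∩ π ⁻¹' (extChartAt (𝓡 n) (π q)).source,
      π q' ∈ (extChartAt (𝓡 n) (π q)).source := fun q' hq' => hq'.2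
  refine ⟨_, (isOpen_extChartAt_source (I := 𝓡 n) (π q)).preimage hπ, mem_extChartAt_source _, ?_⟩
  have h1 := ((smoothFormsOn_iff _ hS).1 (ContMDiffOn.mono hα inter_subset_left)).2
  have h2 := ((smoothFieldsOn_iff _ hS).1 (ContMDiffOn.mono hX inter_subset_left)).2
  refine (h1.clm_apply h2).congr fun q' hq' => ?_
  change _ = α q' (chartDInv (π q) (π q') (chartD (π q) (π q') (X q')))
  rw [chartDInv_chartD hq'.2]

end Locality

/-! ### The relative solution near a family of hypersurfaces -/

section RelativeLieSolution

universe u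

variable {n : ℕ} {V : Type*} [TopologicalSpace V] [ChartedSpace (EuclideanSpace ℝ (Fin n)) V]
  [IsManifold (𝓡 n) ∞ V] [T2Space V] [SecondCountableTopology V] {F : Type u} {K P : Type*}
  [NormedAddCommGroup F] [NormedSpace ℝ F] [FiniteDimensional ℝ F] [TopologicalSpace K]
  (J : ModelWithCorners ℝ F K) [TopologicalSpace P] [ChartedSpace K P] [IsManifold J ∞ P]
  [T2Space P] [SecondCountableTopology P]

/-- A smooth initial condition `χ α(X₀)`, where `χ` is equal to one near `A`. -/
theorem exists_initial_condition {α : P → ℝ → (x : V) → TangentSpace (𝓡 n) x →L[ℝ] ℝ}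
    {A N : Set (P × V)} {X₀ : P → ℝ → (x : V) → TangentSpace (𝓡 n) x}
    (hα : SmoothFormsOn (J.prod (𝓘(ℝ, ℝ).prod (𝓡 n))) (fun q : P × ℝ × V => q.2.2)
      (fun q => α q.1 q.2.1 q.2.2) (timeDomain univ))
    (hA : IsClosed A) (hN : IsOpen N) (hAN : A ⊆ N)
    (hX₀ : SmoothFieldsOn (J.prod (𝓘(ℝ, ℝ).prod (𝓡 n))) (fun q : P × ℝ × V => q.2.2)
      (fun q => X₀ q.1 q.2.1 q.2.2) (timeDomain N)) :
    ∃ h : P × ℝ × V → ℝ,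
      ContMDiffOn (J.prod (𝓘(ℝ, ℝ).prod (𝓡 n))) 𝓘(ℝ, ℝ) ∞ h (timeDomain univ) ∧
      (∃ O : Set (P × V), IsOpen O ∧ A ⊆ O ∧ O ⊆ N ∧ ∀ q : P × ℝ × V, (q.1, q.2.2) ∈ O →
        h q = α q.1 q.2.1 q.2.2 (X₀ q.1 q.2.1 q.2.2)) ∧
      ∀ q : P × ℝ × V, ((q.1, q.2.2) ∈ N → X₀ q.1 q.2.1 q.2.2 = 0) → h q = 0 := by
  obtain ⟨χ, hχs, ⟨O, hO, hAO, hχ1⟩, hχN, -⟩ := exists_smooth_cutoff (J.prod (𝓡 n)) hA hN hAN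
  have hpr : ContMDiff (J.prod (𝓘(ℝ, ℝ).prod (𝓡 n))) (J.prod (𝓡 n)) ∞
      (fun q : P × ℝ × V => (q.1, q.2.2)) :=
    contMDiff_fst.prodMk (contMDiff_snd.comp contMDiff_snd)
  refine ⟨fun q => χ (q.1, q.2.2) * α q.1 q.2.1 q.2.2 (X₀ q.1 q.2.1 q.2.2), ?_,
    ⟨O ∩ N, hO.inter hN, subset_inter hAO hAN, inter_subset_right, fun q hq => ?_⟩, fun q hq => ?_⟩
  · refine contMDiffOn_of_locally_contMDiffOn fun q hq => ?_
    by_cases hqN : (q.1, q.2.2) ∈ N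
    · refine ⟨{q | (q.1, q.2.2) ∈ N}, hN.preimage (by fun_prop), hqN, ?_⟩
      have hsub : timeDomain univ ∩ {q : P × ℝ × V | (q.1, q.2.2) ∈ N} ⊆ timeDomain N :=
        fun q hq => ⟨hq.1.1, hq.2⟩
      refine ((hχs.comp hpr).contMDiffOn).mul ?_
      exact SmoothFormsOn.contMDiffOn_apply (by fun_prop)
        (ContMDiffOn.mono hα inter_subset_left) (ContMDiffOn.mono hX₀ hsub)
    -- Nothing is assumed about `X₀` outside `N`, but near such a point `χ` vanishes identically.
    · refine ⟨{q | (q.1, q.2.2) ∈ (tsupport χ)ᶜ},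
        (isClosed_tsupport χ).isOpen_compl.preimage (by fun_prop), fun h => hqN (hχN h), ?_⟩
      refine (contMDiffOn_const (c := (0 : ℝ))).congr fun q hq => ?_
      rw [image_eq_zero_of_notMem_tsupport hq.2, zero_mul]
  · simp only [hχ1 _ hq.1, one_mul]
  · by_cases hqN : (q.1, q.2.2) ∈ N
    · simp only [hq hqN, map_zero, mul_zero]
    · simp only [image_eq_zero_of_notMem_tsupport fun h => hqN (hχN h), zero_mul]

/-- The equation `L_X α + (d/dt) α = 0` near a family of hypersurfaces transverse to the Reeb
fields, with parameters and relative to a closed set. -/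
theorem exists_relative_lie_solution {α : P → ℝ → (x : V) → TangentSpace (𝓡 n) x →L[ℝ] ℝ}
    {L A N : Set (P × V)} {X₀ : P → ℝ → (x : V) → TangentSpace (𝓡 n) x}
    (hα : SmoothFormsOn (J.prod (𝓘(ℝ, ℝ).prod (𝓡 n))) (fun q : P × ℝ × V => q.2.2)
      (fun q => α q.1 q.2.1 q.2.2) (timeDomain univ))
    (hc : ∀ u, ∀ t ∈ Icc (0 : ℝ) 1, IsContactForm (α u t))
    (hL : IsHypersurfaceFamily (n := n) J L)
    (htr : ∀ u, ∀ t ∈ Icc (0 : ℝ) 1, ∀ x ∈ slice L u, ∀ v, IsReebVector (α u t) x v →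
      ¬ IsTangentTo (slice L u) x v)
    (hA : IsClosed A) (hN : IsOpen N) (hAN : A ⊆ N)
    (hX₀ : SmoothFieldsOn (J.prod (𝓘(ℝ, ℝ).prod (𝓡 n))) (fun q : P × ℝ × V => q.2.2)
      (fun q => X₀ q.1 q.2.1 q.2.2) (timeDomain N))
    (hX₀s : ∀ u, SolvesLieEquation (α u) (X₀ u) (slice N u)) :
    ∃ (U : Set (P × V)) (X : P → ℝ → (x : V) → TangentSpace (𝓡 n) x), IsOpen U ∧ L ⊆ U ∧
      SmoothFieldsOn (J.prod (𝓘(ℝ, ℝ).prod (𝓡 n))) (fun q : P × ℝ × V => q.2.2)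
        (fun q => X q.1 q.2.1 q.2.2) (timeDomain U) ∧
      (∀ u, SolvesLieEquation (α u) (X u) (slice U u)) ∧
      (∃ O : Set (P × V), IsOpen O ∧ A ∩ U ⊆ O ∧ O ⊆ N ∩ U ∧
        ∀ q ∈ O, ∀ t ∈ Icc (0 : ℝ) 1, X q.1 t q.2 = X₀ q.1 t q.2) ∧
      (∀ u, (∀ t ∈ Icc (0 : ℝ) 1, α u t = α u 0) →
        (∀ t ∈ Icc (0 : ℝ) 1, ∀ x ∈ slice N u, X₀ u t x = 0) →
        ∀ t ∈ Icc (0 : ℝ) 1, ∀ x ∈ slice U u, X u t x = 0) := by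
  have : CompleteSpace F := FiniteDimensional.complete ℝ F
  obtain ⟨h, hh, ⟨O₀, hO₀, hAO₀, hO₀N, hhO₀⟩, hh0⟩ := exists_initial_condition J hα hA hN hAN hX₀
  -- Near `A` the given field has the very initial values `h`, so uniqueness will identify it with
  -- the new solution near `A ∩ L`.
  have hX₀' : IsLieSolution J α L h X₀ {q | (q.1, q.2.2) ∈ O₀} :=
    ⟨ContMDiffOn.mono hX₀ fun q hq => ⟨hq.2, hO₀N hq.1⟩,
      fun q hq => hX₀s q.1 q.2.1 hq.2 q.2.2 (hO₀N hq.1), fun q hq _ => (hhO₀ q hq.1).symm⟩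
  have hO₀' : IsOpen {q : P × ℝ × V | (q.1, q.2.2) ∈ O₀} := hO₀.preimage (by fun_prop)
  rcases L.eq_empty_or_nonempty with rfl | hLne
  · refine ⟨∅, fun _ _ _ => 0, isOpen_empty, subset_rfl, fun q hq => hq.2.elim,
      fun u t ht x hx => hx.elim, ⟨∅, isOpen_empty, by simp, by simp, by simp⟩,
      fun _ _ _ _ _ _ _ => rfl⟩
  set M := {q : P × ℝ × V // q.2.1 ∈ Icc (0 : ℝ) 1 ∧ (q.1, q.2.2) ∈ L} with hM
  have : Nonempty M := by
    obtain ⟨q, hq⟩ := hLne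
    exact ⟨⟨(q.1, 0, q.2), ⟨le_rfl, zero_le_one⟩, hq⟩⟩
  have key := fun q : M => exists_local_lie_solution hα hh q.2.1 q.2.2 (hc q.1.1 _ q.2.1)
    (htr q.1.1 _ q.2.1 _ q.2.2) hL
  choose O Xl hO hqO hX hun hzero using key
  have := J.locallyCompactSpace
  have := ChartedSpace.locallyCompactSpace K P
  have := ChartedSpace.locallyCompactSpace (EuclideanSpace ℝ (Fin n)) V
  have := TopologicalSpace.metrizableSpace_of_t3_secondCountable (P × ℝ × V)
  set T : Set (P × ℝ × V) := {q | q.2.1 ∈ Icc (0 : ℝ) 1} with hT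
  obtain ⟨U', Y, hU', hLU', hY⟩ := exists_glue (D := T) (T := fun q => TangentSpace (𝓡 n) q.2.2)
    (L := {q : P × ℝ × V | q.2.1 ∈ Icc (0 : ℝ) 1 ∧ (q.1, q.2.2) ∈ L}) hO
    (fun i q => Xl i q.1 q.2.1 q.2.2) (fun q hq => mem_iUnion.2 ⟨⟨q, hq⟩, hqO _⟩)
    (fun i j q hq hqi hqj => hun j _ _ (hO i) (hX i) q ⟨hqj, hq.1⟩ hq.2 hqi)
  set X : P → ℝ → (x : V) → TangentSpace (𝓡 n) x := fun u t x => Y (u, t, x) with hXdef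
  set U₁ : Set (P × V) := {q | ∀ t ∈ Icc (0 : ℝ) 1, (q.1, t, q.2) ∈ U'} with hU₁
  have hU₁o : IsOpen U₁ := isOpen_forall_time hU'
  have hLU₁ : L ⊆ U₁ := fun q hq t ht => hLU' ⟨ht, hq⟩
  -- Agreement is required near each `(u, t, x)` and for every `t` in the compact interval, which
  -- makes `O₁` open.
  set O₁ : Set (P × V) := {q | ∀ t ∈ Icc (0 : ℝ) 1, (q.1, t, q.2) ∈
    {q' : P × ℝ × V | ∀ᶠ q'' in 𝓝 q', q'' ∈ T →
      X q''.1 q''.2.1 q''.2.2 = X₀ q''.1 q''.2.1 q''.2.2}} ∩ (U₁ ∩ N) with hO₁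
  have hO₁o : IsOpen O₁ :=
    (isOpen_forall_time isOpen_setOfPred_eventually_nhds).inter (hU₁o.inter hN)
  have hALO₁ : A ∩ L ⊆ O₁ := by
    rintro q ⟨hqA, hqL⟩
    refine ⟨fun t ht => ?_, hLU₁ hqL, hAN hqA⟩
    obtain ⟨i, hi, hYi⟩ := hY _ (hLU₁ hqL t ht)
    have h1 := hun i _ _ hO₀' hX₀' (q.1, t, q.2) ⟨hi, ht⟩ hqL (hAO₀ hqA)
    filter_upwards [eventually_nhdsWithin_iff.1 h1, eventually_nhdsWithin_iff.1 hYi]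
      with q' h2 h3 hq'
    rw [h2 hq']
    exact h3 hq'
  -- Agreement with `X₀` is known only near `A ∩ L`. The rest of `A` is removed from the domain, and
  -- `L` stays covered.
  set U : Set (P × V) := (U₁ ∩ Aᶜ) ∪ O₁ with hU
  have hUU₁ : U ⊆ U₁ := union_subset inter_subset_left (inter_subset_right.trans inter_subset_left)
  have hLU : L ⊆ U := fun q hq => by
    by_cases hqA : q ∈ A
    · exact Or.inr (hALO₁ ⟨hqA, hq⟩)
    · exact Or.inl ⟨hLU₁ hq, hqA⟩
  refine ⟨U, X, (hU₁o.inter hA.isOpen_compl).union hO₁o, hLU, ?_, ?_, ⟨O₁, hO₁o, ?_, ?_, ?_⟩, ?_⟩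
  · intro q hq
    obtain ⟨i, hi, hYi⟩ := hY q (hUU₁ hq.2 _ hq.1)
    have h1 : timeRestrict (O i) ∈ 𝓝[timeDomain U] q := by
      refine mem_nhdsWithin.2 ⟨O i, hO i, hi, fun q' hq' => ⟨hq'.1, hq'.2.1⟩⟩
    refine (((hX i).smooth q ⟨hi, hq.1⟩).mono_of_mem_nhdsWithin h1).congr_of_eventuallyEq ?_ ?_
    · filter_upwards [nhdsWithin_mono q (fun q' hq' => hq'.1) hYi] with q' hq'
      exact congrArg (Bundle.TotalSpace.mk q'.2.2) hq'
    · exact congrArg (Bundle.TotalSpace.mk q.2.2) (hYi.self_of_nhdsWithin hq.1)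
  · intro u t ht x hx v
    obtain ⟨i, hi, hYi⟩ := hY (u, t, x) (hUU₁ hx _ ht)
    have h1 : ∀ᶠ x' in 𝓝 x, X u t x' = Xl i u t x' := by
      have h2 : Filter.Tendsto (fun x' : V => (u, t, x')) (𝓝 x) (𝓝 (u, t, x)) :=
        (by fun_prop : Continuous fun x' : V => (u, t, x')).continuousAt
      filter_upwards [h2.eventually (eventually_nhdsWithin_iff.1 hYi)] with x' hx'
      exact hx' ht
    rw [lieForm_congr h1]
    exact (hX i).solves (u, t, x) ⟨hi, ht⟩ v
  · rintro q ⟨hqA, hq | hq⟩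
    · exact (hq.2 hqA).elim
    · exact hq
  · exact fun q hq => ⟨hq.2.2, Or.inr hq⟩
  · exact fun q hq t ht => (hq.1 t ht).self_of_nhds ht
  · intro u hαu hXu t ht x hx
    obtain ⟨i, hi, hYi⟩ := hY (u, t, x) (hUU₁ hx _ ht)
    exact (hYi.self_of_nhdsWithin ht).trans (hzero i (u, t, x) ⟨hi, ht⟩ hαu
      fun x' => hh0 (u, t, x') fun hx' => hXu t ht x' hx')

end RelativeLieSolution

/-! ### Time-dependent equations: uniqueness, existence and smoothness -/

section TimeDependentODE

open Metric
open scoped NNReal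

variable {E : Type*} [NormedAddCommGroup E] [NormedSpace ℝ E]

/-- `γ` solves the time-dependent equation `γ' = X(t, γ)` on `[0, 1]` and stays in `B`. -/
def IsTimeSolution (X : ℝ → E → E) (B : Set E) (γ : ℝ → E) : Prop :=
  ∀ s ∈ Icc (0 : ℝ) 1, HasDerivWithinAt γ (X s (γ s)) (Icc 0 1) s ∧ γ s ∈ B

theorem IsTimeSolution.continuousOn {X : ℝ → E → E} {B : Set E} {γ : ℝ → E}
    (h : IsTimeSolution X B γ) : ContinuousOn γ (Icc 0 1) :=
  fun s hs => (h s hs).1.continuousWithinAt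

/-- Local Lipschitz bounds come from small balls, which are convex; compactness makes them uniform,
so `K` itself need not be convex. -/
theorem exists_lipschitzOnWith_of_isCompact {B K : Set E} (hB : IsOpen B) {X : ℝ → E → E}
    (hX : ContDiffOn ℝ 1 (fun q : ℝ × E => X q.1 q.2) (Icc 0 1 ×ˢ B)) (hK : IsCompact K)
    (hKB : K ⊆ B) : ∃ C : ℝ≥0, ∀ s ∈ Icc (0 : ℝ) 1, LipschitzOnWith C (X s) K := by
  have h1 : LocallyLipschitzOn (Icc (0 : ℝ) 1 ×ˢ K) (fun q : ℝ × E => X q.1 q.2) := by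
    intro q hq
    obtain ⟨r, hr, hrB⟩ := Metric.isOpen_iff.1 hB q.2 (hKB hq.2)
    have h2 : ContDiffOn ℝ 1 (fun q : ℝ × E => X q.1 q.2) (Icc 0 1 ×ˢ ball q.2 r) :=
      hX.mono (prod_mono_right hrB)
    obtain ⟨C, t, ht, htC⟩ := h2.locallyLipschitzOn ((convex_Icc 0 1).prod (convex_ball _ _))
      (x := q) ⟨hq.1, mem_ball_self hr⟩
    refine ⟨C, t, nhdsWithin_le_of_mem ?_ ht, htC⟩
    filter_upwards [self_mem_nhdsWithin, mem_nhdsWithin_of_mem_nhds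
      ((isOpen_ball.preimage continuous_snd).mem_nhds (mem_ball_self hr))] with q' h3 h4
    exact ⟨h3.1, h4⟩
  obtain ⟨C, hC⟩ := h1.exists_lipschitzOnWith_of_compact (isCompact_Icc.prod hK)
  refine ⟨C, fun s hs x hx y hy => ?_⟩
  have := hC (x := (s, x)) ⟨hs, hx⟩ (y := (s, y)) ⟨hs, hy⟩
  simpa [Prod.edist_eq] using this

/-- Uniqueness of solutions, from a common value at any time. -/
theorem IsTimeSolution.eqOn {B : Set E} (hB : IsOpen B) {X : ℝ → E → E}
    (hX : ContDiffOn ℝ 1 (fun q : ℝ × E => X q.1 q.2) (Icc 0 1 ×ˢ B)) {γ δ : ℝ → E}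
    (hγ : IsTimeSolution X B γ) (hδ : IsTimeSolution X B δ) {t : ℝ} (ht : t ∈ Icc (0 : ℝ) 1)
    (h : γ t = δ t) : EqOn γ δ (Icc 0 1) := by
  -- A Lipschitz constant is needed only on the two trajectories, whose union is compact.
  set K := γ '' Icc 0 1 ∪ δ '' Icc 0 1 with hK
  have hKc : IsCompact K := (isCompact_Icc.image_of_continuousOn hγ.continuousOn).union
    (isCompact_Icc.image_of_continuousOn hδ.continuousOn)
  have hKB : K ⊆ B := by
    rintro _ (⟨s, hs, rfl⟩ | ⟨s, hs, rfl⟩)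
    exacts [(hγ s hs).2, (hδ s hs).2]
  obtain ⟨C, hC⟩ := exists_lipschitzOnWith_of_isCompact hB hX hKc hKB
  have hl : Icc 0 t ⊆ Icc (0 : ℝ) 1 := Icc_subset_Icc_right ht.2
  have hr : Icc t 1 ⊆ Icc (0 : ℝ) 1 := Icc_subset_Icc_left ht.1
  have hγK : ∀ s ∈ Icc (0 : ℝ) 1, γ s ∈ K := fun s hs => Or.inl (mem_image_of_mem _ hs)
  have hδK : ∀ s ∈ Icc (0 : ℝ) 1, δ s ∈ K := fun s hs => Or.inr (mem_image_of_mem _ hs)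
  have hleft : ∀ {η : ℝ → E}, IsTimeSolution X B η → ∀ s ∈ Ioc 0 t,
      HasDerivWithinAt η (X s (η s)) (Iic s) s := fun hη s hs =>
    ((hη s (hl ⟨hs.1.le, hs.2⟩)).1.mono (Icc_subset_Icc_right (hs.2.trans ht.2))).mono_of_mem_nhdsWithin
      (Icc_mem_nhdsLE hs.1)
  have hright : ∀ {η : ℝ → E}, IsTimeSolution X B η → ∀ s ∈ Ico t 1,
      HasDerivWithinAt η (X s (η s)) (Ici s) s := fun hη s hs =>
    ((hη s (hr ⟨hs.1, hs.2.le⟩)).1.mono (Icc_subset_Icc_left (ht.1.trans hs.1))).mono_of_mem_nhdsWithin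
      (Icc_mem_nhdsGE hs.2)
  rw [← Icc_union_Icc_eq_Icc ht.1 ht.2]
  refine EqOn.union ?_ ?_
  · exact ODE_solution_unique_of_mem_Icc_left (s := fun _ => K)
      (fun s hs => hC s (hl ⟨hs.1.le, hs.2⟩)) (hγ.continuousOn.mono hl) (hleft hγ)
      (fun s hs => hγK s (hl ⟨hs.1.le, hs.2⟩)) (hδ.continuousOn.mono hl) (hleft hδ)
      (fun s hs => hδK s (hl ⟨hs.1.le, hs.2⟩)) h
  · exact ODE_solution_unique_of_mem_Icc_right (s := fun _ => K)
      (fun s hs => hC s (hr ⟨hs.1, hs.2.le⟩)) (hγ.continuousOn.mono hr) (hright hγ)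
      (fun s hs => hγK s (hr ⟨hs.1, hs.2.le⟩)) (hδ.continuousOn.mono hr) (hright hδ)
      (fun s hs => hδK s (hr ⟨hs.1, hs.2.le⟩)) h

/-- Solutions that start near a common zero exist up to time one. -/
theorem exists_isTimeSolution_of_lipschitzOnWith [FiniteDimensional ℝ E] {K : ℝ≥0} {r : ℝ}
    (hr : 0 < r) : ∃ η > 0, ∀ X : ℝ → E → E,
      (∀ s ∈ Icc (0 : ℝ) 1, LipschitzOnWith K (X s) (ball 0 r)) →
      (∀ x ∈ ball (0 : E) r, ContinuousOn (fun s => X s x) (Icc 0 1)) →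
      (∀ s ∈ Icc (0 : ℝ) 1, X s 0 = 0) →
      ∀ x ∈ ball (0 : E) η, ∃ γ, γ 0 = x ∧ IsTimeSolution X (ball 0 r) γ := by
  -- Precomposition with `ρ`, which is the identity on the ball of radius `r / 4` and maps into the
  -- ball of radius `r`, makes the field globally Lipschitz. A solution starting within `(r / 4) exp
  -- (-(K + 1))` never leaves the smaller ball, so it solves the original equation. This radius
  -- depends only on `K` and `r`, hence serves all parameters at once.
  let b : ContDiffBump (0 : E) := ⟨r / 4, r / 2, by linarith, by linarith⟩
  set ρ : E → E := fun y => b y • y with hρ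
  have hρs : ContDiff ℝ 1 ρ := b.contDiff.smul contDiff_id
  obtain ⟨Kρ, hKρ⟩ := hρs.lipschitzWith_of_hasCompactSupport
    (b.hasCompactSupport.smul_right (f' := fun y : E => y)) one_ne_zero
  have hρle : ∀ y, ‖ρ y‖ ≤ ‖y‖ := fun y => by
    rw [hρ, norm_smul, Real.norm_of_nonneg b.nonneg]
    exact mul_le_of_le_one_left (norm_nonneg _) b.le_one
  have hρr : ∀ y, ρ y ∈ ball (0 : E) r := fun y => by
    rw [mem_ball_zero_iff]
    by_cases hy : r / 2 ≤ ‖y‖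
    · have : b y = 0 := b.zero_of_le_dist (by simpa using hy)
      rw [hρ]; simpa [this] using hr
    · linarith [hρle y, not_le.1 hy]
  have hρid : ∀ y, ‖y‖ ≤ r / 4 → ρ y = y := fun y hy => by
    have : b y = 1 := b.one_of_mem_closedBall (by simpa using hy)
    rw [hρ]; simp [this]
  have hη : 0 < r / 4 * Real.exp (-((K : ℝ) + 1)) := by positivity
  refine ⟨_, hη, fun X hX hXc hX0 x hx => ?_⟩
  obtain ⟨γ, hγ0, hγ⟩ := exists_solution_of_lipschitzWith (f := fun s y => X s (ρ y))
    (K := K * Kρ) (fun s hs => by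
      have := (hX s hs).comp (hKρ.lipschitzOnWith (s := univ)) (fun y _ => hρr y)
      exact lipschitzOnWith_univ.1 this)
    (fun y => hXc _ (hρr y)) x
  have hb := norm_le_mul_exp_of_norm_deriv_le hη K.coe_nonneg hγ
    (by rw [hγ0]; exact (mem_ball_zero_iff.1 hx).le) (fun s hs _ _ => by
      have := (hX s hs).norm_sub_le (hρr (γ s)) (mem_ball_self hr)
      rw [hX0 s hs, sub_zero, sub_zero] at this
      exact this.trans (mul_le_mul_of_nonneg_left (hρle _) K.coe_nonneg))
  rw [mul_assoc, ← Real.exp_add, neg_add_cancel, Real.exp_zero, mul_one] at hb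
  refine ⟨γ, hγ0, fun s hs => ⟨?_, ?_⟩⟩
  · have := hγ s hs
    rwa [hρid _ (hb s hs)] at this
  · rw [mem_ball_zero_iff]
    linarith [hb s hs]

/-- A smooth time-dependent vector field is Lipschitz near a point, uniformly in time. -/
theorem exists_uniform_lipschitzOnWith {F H : Type*} [NormedAddCommGroup F] [NormedSpace ℝ F]
    [NormedAddCommGroup H] [NormedSpace ℝ H] {S : Set F} (hS : Convex ℝ S) {ε : ℝ} (hε : 0 < ε)
    {g : (F × ℝ) × E → H} {y₀ : E} (hg : ContDiffOn ℝ 1 g ((S ×ˢ Icc 0 1) ×ˢ ball y₀ ε)) {z₀ : F}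
    (hz₀ : z₀ ∈ S) :
    ∃ r > 0, r ≤ ε ∧ ∃ K : ℝ≥0, ∀ z ∈ S ∩ ball z₀ r, ∀ t ∈ Icc (0 : ℝ) 1,
      LipschitzOnWith K (fun y => g ((z, t), y)) (ball y₀ r) := by
  have key : ∃ r > 0, r ≤ ε ∧ ∃ K : ℝ≥0, ∀ z ∈ S ∩ ball z₀ r, ∀ t ∈ Icc (0 : ℝ) 1,
      t ∈ Icc (0 : ℝ) 1 → LipschitzOnWith K (fun y => g ((z, t), y)) (ball y₀ r) := by
    -- The local radii and constants come from boxes around single times; compactness leaves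
    -- finitely many, with a smallest radius and a largest constant.
    refine isCompact_Icc.induction_on (p := fun I : Set ℝ => ∃ r > 0, r ≤ ε ∧ ∃ K : ℝ≥0,
      ∀ z ∈ S ∩ ball z₀ r, ∀ t ∈ I, t ∈ Icc (0 : ℝ) 1 →
        LipschitzOnWith K (fun y => g ((z, t), y)) (ball y₀ r)) ?_ ?_ ?_ ?_
    · exact ⟨ε, hε, le_rfl, 0, fun z _ t ht => ht.elim⟩
    · rintro I I' hI ⟨r, hr, hrε, K, h⟩
      exact ⟨r, hr, hrε, K, fun z hz t ht => h z hz t (hI ht)⟩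
    · rintro I I' ⟨r, hr, hrε, K, h⟩ ⟨r', hr', hrε', K', h'⟩
      refine ⟨min r r', lt_min hr hr', (min_le_left _ _).trans hrε, max K K', ?_⟩
      rintro z hz t (ht | ht) ht1
      · exact ((h z ⟨hz.1, ball_subset_ball (min_le_left _ _) hz.2⟩ t ht ht1).weaken
          (le_max_left _ _)).mono (ball_subset_ball (min_le_left _ _))
      · exact ((h' z ⟨hz.1, ball_subset_ball (min_le_right _ _) hz.2⟩ t ht ht1).weaken
          (le_max_right _ _)).mono (ball_subset_ball (min_le_right _ _))
    · intro t ht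
      obtain ⟨r, hr, K, -, -, -, hK, -⟩ := exists_box_lipschitzOnWith
        (hS.prod (convex_Icc (0 : ℝ) 1)) (isOpen_univ.prod (isOpen_ball (x := y₀) (ε := ε)))
        (f := g) (hg.mono fun q hq => ⟨hq.2.1, hq.1.2⟩) (q := ((z₀, t), y₀))
        ⟨⟨trivial, mem_ball_self hε⟩, ⟨hz₀, ht⟩, trivial⟩
      refine ⟨ball t r, mem_nhdsWithin_of_mem_nhds (ball_mem_nhds _ hr), min r ε, lt_min hr hε,
        min_le_right _ _, K, fun z hz t' ht' ht1 => ?_⟩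
      refine (hK (z, t') ⟨⟨hz.1, ht1⟩, ?_⟩).mono (ball_subset_ball (min_le_left _ _))
      rw [← ball_prod_same]
      exact ⟨ball_subset_ball (min_le_left _ _) hz.2, ht'⟩
  obtain ⟨r, hr, hrε, K, h⟩ := key
  exact ⟨r, hr, hrε, K, fun z hz t ht => h z hz t ht ht⟩

universe u

/-- Smooth dependence on time, the initial value and parameters of a time-dependent equation. -/
theorem contDiffOn_timeSolution {F : Type u} {E : Type} [NormedAddCommGroup F] [NormedSpace ℝ F]
    [CompleteSpace F] [NormedAddCommGroup E] [NormedSpace ℝ E] [CompleteSpace E] {S : Set F}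
    (hS : Convex ℝ S) (hSu : UniqueDiffOn ℝ S) {r η : ℝ} {g : (F × ℝ) × E → E}
    (hg : ContDiffOn ℝ ∞ g ((S ×ˢ Icc 0 1) ×ˢ ball 0 r)) {γ : F → E → ℝ → E}
    (hγ : ∀ z ∈ S, ∀ x ∈ ball (0 : E) η, γ z x 0 = x ∧
      IsTimeSolution (fun t y => g ((z, t), y)) (ball 0 r) (γ z x)) :
    ContDiffOn ℝ ∞ (fun q : (F × ℝ) × E => γ q.1.1 q.2 q.1.2)
      ((S ×ˢ Icc 0 1) ×ˢ ball 0 η) := by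
  set B : Set ((F × ℝ) × E) := (S ×ˢ Icc 0 1) ×ˢ ball 0 η with hB
  have hIu := uniqueDiffOn_Icc (zero_lt_one (α := ℝ))
  have hBu : UniqueDiffOn ℝ B := (hSu.prod hIu).prod isOpen_ball.uniqueDiffOn
  set C : Set (((F × ℝ) × ℝ) × E) := ((S ×ˢ Icc 0 1) ×ˢ Icc 0 1) ×ˢ ball 0 r with hC
  have hCc : Convex ℝ C := ((hS.prod (convex_Icc 0 1)).prod (convex_Icc 0 1)).prod (convex_ball _ _)
  have hCu : UniqueDiffOn ℝ C := ((hSu.prod hIu).prod hIu).prod isOpen_ball.uniqueDiffOn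
  -- This autonomous field has the parameter and the end time `t` as frozen coordinates, and a clock
  -- that runs at speed `t`. At time one the clock shows `t`, so smooth dependence on `t` becomes
  -- dependence on the initial value.
  set W : ((F × ℝ) × ℝ) × E → ((F × ℝ) × ℝ) × E := fun p =>
    (((0, 0), p.1.1.2), p.1.1.2 • g ((p.1.1.1, p.1.2), p.2)) with hW
  have hWs : ContDiffOn ℝ ∞ W C := by
    have h1 : ContDiffOn ℝ ∞ (fun p : ((F × ℝ) × ℝ) × E => g ((p.1.1.1, p.1.2), p.2)) C :=
      hg.comp (by fun_prop) (fun p hp => ⟨⟨hp.1.1.1, hp.1.2⟩, hp.2⟩)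
    have h2 : ContDiffOn ℝ ∞ (fun p : ((F × ℝ) × ℝ) × E => p.1.1.2) C := by fun_prop
    exact (contDiffOn_const.prodMk h2).prodMk (h2.smul h1)
  set δ : (F × ℝ) × E → ℝ → ((F × ℝ) × ℝ) × E := fun q s =>
    ((q.1, q.1.2 * s), γ q.1.1 q.2 (q.1.2 * s)) with hδ
  have hts : ∀ q ∈ B, ∀ s ∈ Icc (0 : ℝ) 1, q.1.2 * s ∈ Icc (0 : ℝ) 1 := fun q hq s hs =>
    ⟨mul_nonneg hq.1.2.1 hs.1, mul_le_one₀ hq.1.2.2 hs.1 hs.2⟩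
  have hδf : ∀ q ∈ B, IsFlowLine W C (δ q) := by
    intro q hq s hs
    obtain ⟨-, h2⟩ := hγ q.1.1 hq.1.1 q.2 hq.2
    have h3 := h2 _ (hts q hq s hs)
    refine ⟨?_, ⟨⟨hq.1, hts q hq s hs⟩, h3.2⟩⟩
    have h4 : HasDerivWithinAt (fun s : ℝ => q.1.2 * s) q.1.2 (Icc 0 1) s := by
      simpa using (hasDerivWithinAt_id s (Icc (0 : ℝ) 1)).const_mul q.1.2
    have h5 := h3.1.scomp s h4 (hts q hq)
    exact ((hasDerivWithinAt_const s _ q.1).prodMk h4).prodMk h5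
  have h0 : ContDiffOn ℝ ∞ (fun q => δ q 0) B := by
    have h1 : ContDiffOn ℝ ∞ (fun q : (F × ℝ) × E => (((q.1, 0), q.2) : ((F × ℝ) × ℝ) × E)) B := by
      fun_prop
    refine h1.congr fun q hq => ?_
    simp only [hδ, mul_zero, (hγ q.1.1 hq.1.1 q.2 hq.2).1]
  have h1 := contDiffOn_flow hBu hCc hCu hWs hδf h0 (s := 1) (by simp)
  refine (contDiff_snd.comp_contDiffOn h1).congr fun q hq => ?_
  simp [hδ]

end TimeDependentODE

/-! ### The flow of a family of vector fields vanishing at the origin -/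

section GermFlow

open Metric

universe u

variable {F : Type u} {K P : Type*} {E : Type} [NormedAddCommGroup F] [NormedSpace ℝ F]
  [CompleteSpace F] [TopologicalSpace K] (J : ModelWithCorners ℝ F K) [TopologicalSpace P]
  [ChartedSpace K P] [IsManifold J ∞ P] [NormedAddCommGroup E] [NormedSpace ℝ E]
  [FiniteDimensional ℝ E]

theorem ContMDiffOn.contDiffOn_timeSlice {F K P E H : Type*} [NormedAddCommGroup F]
    [NormedSpace ℝ F] [TopologicalSpace K] (J : ModelWithCorners ℝ F K) [TopologicalSpace P]
    [ChartedSpace K P] [NormedAddCommGroup E] [NormedSpace ℝ E] [NormedAddCommGroup H]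
    [NormedSpace ℝ H] {f : P × ℝ × E → H} {W : Set (P × E)}
    (hf : ContMDiffOn (J.prod (𝓘(ℝ, ℝ).prod 𝓘(ℝ, E))) 𝓘(ℝ, H) ∞ f (timeDomain W)) (u : P) :
    ContDiffOn ℝ ∞ (fun q : ℝ × E => f (u, q.1, q.2)) (Icc 0 1 ×ˢ slice W u) := by
  have h1 : ContMDiff 𝓘(ℝ, ℝ × E) (J.prod (𝓘(ℝ, ℝ).prod 𝓘(ℝ, E))) ∞
      (fun q : ℝ × E => (u, q.1, q.2)) :=
    contMDiff_const.prodMk (contDiff_fst.contMDiff.prodMk contDiff_snd.contMDiff)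
  exact contMDiffOn_iff_contDiffOn.1 (hf.comp h1.contMDiffOn fun q hq => hq)

/-- The flow of a family of time-dependent vector fields that vanish at the origin. -/
theorem exists_germ_flow {X : P → ℝ → E → E} {U : Set (P × E)} (hU : IsOpen U)
    (hU0 : ∀ u, (u, 0) ∈ U)
    (hX : ContMDiffOn (J.prod (𝓘(ℝ, ℝ).prod 𝓘(ℝ, E))) 𝓘(ℝ, E) ∞
      (fun q : P × ℝ × E => X q.1 q.2.1 q.2.2) (timeDomain U))
    (hX0 : ∀ u, ∀ t ∈ Icc (0 : ℝ) 1, X u t 0 = 0) :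
    ∃ (W : Set (P × E)) (θ : P → ℝ → E → E), IsOpen W ∧ (∀ u, (u, 0) ∈ W) ∧
      ContMDiffOn (J.prod (𝓘(ℝ, ℝ).prod 𝓘(ℝ, E))) 𝓘(ℝ, E) ∞
        (fun q : P × ℝ × E => θ q.1 q.2.1 q.2.2) (timeDomain W) ∧
      ∀ q ∈ W, θ q.1 0 q.2 = q.2 ∧
        IsTimeSolution (X q.1) (slice U q.1) (fun t => θ q.1 t q.2) := by
  classical
  -- One flow is chosen for all parameters, with a junk value where no solution exists. By
  -- uniqueness it equals each local smooth flow on its domain, so nothing has to be glued.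
  set θ : P → ℝ → E → E := fun u t x =>
    if h : ∃ γ : ℝ → E, γ 0 = x ∧ IsTimeSolution (X u) (slice U u) γ then h.choose t else x with hθ
  have hUs : ∀ u, IsOpen (slice U u) := fun u => hU.preimage (by fun_prop)
  have hθγ : ∀ u x γ, γ 0 = x → IsTimeSolution (X u) (slice U u) γ →
      θ u 0 x = x ∧ IsTimeSolution (X u) (slice U u) (fun t => θ u t x) ∧
        ∀ t ∈ Icc (0 : ℝ) 1, θ u t x = γ t := by
    intro u x γ h0 hγ
    have h : ∃ γ : ℝ → E, γ 0 = x ∧ IsTimeSolution (X u) (slice U u) γ := ⟨γ, h0, hγ⟩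
    have h1 : ∀ t, θ u t x = h.choose t := fun t => by simp only [hθ, dif_pos h]
    simp only [h1]
    exact ⟨h.choose_spec.1, h.choose_spec.2, h.choose_spec.2.eqOn (hUs u)
      ((hX.contDiffOn_timeSlice J u).of_le (by simp)) hγ (by simp : (0 : ℝ) ∈ Icc (0 : ℝ) 1)
      (h.choose_spec.1.trans h0.symm)⟩
  have key : ∀ u₀ : P, ∃ W : Set (P × E), IsOpen W ∧ (u₀, 0) ∈ W ∧
      ContMDiffOn (J.prod (𝓘(ℝ, ℝ).prod 𝓘(ℝ, E))) 𝓘(ℝ, E) ∞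
        (fun q : P × ℝ × E => θ q.1 q.2.1 q.2.2) (timeDomain W) ∧
      ∀ q ∈ W, θ q.1 0 q.2 = q.2 ∧
        IsTimeSolution (X q.1) (slice U q.1) (fun t => θ q.1 t q.2) := by
    intro u₀
    obtain ⟨ε, hε, hbox⟩ := exists_chart_box J
      (hU.preimage (by fun_prop : Continuous fun q : P × ℝ × E => (q.1, q.2.2)))
      (q₀ := (u₀, 0, 0)) (hU0 u₀)
    set κ := extChartAt J u₀ with hκ
    set S : Set F := range J ∩ ball (κ u₀) ε with hS
    have hz₀ : κ u₀ ∈ S := by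
      refine ⟨?_, mem_ball_self hε⟩
      rw [hκ, extChartAt_coe]; exact mem_range_self _
    set g : (F × ℝ) × E → E := fun q => X (κ.symm q.1.1) q.1.2 q.2 with hg
    have hmem : ∀ z ∈ S, z ∈ κ.target ∧ ∀ y ∈ ball (0 : E) ε, (κ.symm z, y) ∈ U := fun z hz =>
      ⟨(hbox z hz).1, fun y hy => (hbox z hz).2 0 (mem_ball_self hε) y hy⟩
    have hgs : ContDiffOn ℝ ∞ g ((S ×ˢ Icc 0 1) ×ˢ ball 0 ε) :=
      hX.contDiffOn_extChartAt_symm J u₀ fun q hq =>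
        ⟨(hmem _ hq.1.1).1, hq.1.2, (hmem _ hq.1.1).2 _ hq.2⟩
    obtain ⟨r, hr, hrε, k, hk⟩ := exists_uniform_lipschitzOnWith
      (J.convex_range.inter (convex_ball _ _)) hε (hgs.of_le (by simp)) hz₀
    obtain ⟨η, hη, hex⟩ := exists_isTimeSolution_of_lipschitzOnWith (E := E) (K := k) hr
    have hbr : ball (0 : E) r ⊆ ball 0 ε := ball_subset_ball hrε
    have hsol : ∀ z ∈ S ∩ ball (κ u₀) r, ∀ x ∈ ball (0 : E) η, ∃ γ : ℝ → E, γ 0 = x ∧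
        IsTimeSolution (fun t y => g ((z, t), y)) (ball 0 r) γ := by
      intro z hz
      refine hex _ (hk z hz) (fun x hx => ?_) (fun s hs => hX0 _ s hs)
      exact hgs.continuousOn.comp (by fun_prop) fun s hs => ⟨⟨hz.1, hs⟩, hbr hx⟩
    choose! γ hγ using hsol
    have hγs := contDiffOn_timeSolution (S := S ∩ ball (κ u₀) r)
      ((J.convex_range.inter (convex_ball _ _)).inter (convex_ball _ _))
      ((J.uniqueDiffOn.inter isOpen_ball).inter isOpen_ball)
      (hgs.mono (prod_mono (prod_mono_left inter_subset_left) hbr)) hγ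
    set W : Set (P × E) :=
      (κ.source ∩ κ ⁻¹' (ball (κ u₀) ε ∩ ball (κ u₀) r)) ×ˢ ball 0 η with hW
    have hWmem : ∀ q ∈ W, q.1 ∈ κ.source ∧ κ q.1 ∈ S ∩ ball (κ u₀) r ∧ q.2 ∈ ball (0 : E) η ∧
        κ.symm (κ q.1) = q.1 := by
      rintro q ⟨⟨hq1, hq2, hq3⟩, hq4⟩
      refine ⟨hq1, ⟨⟨?_, hq2⟩, hq3⟩, hq4, κ.left_inv hq1⟩
      rw [hκ, extChartAt_coe]; exact mem_range_self _
    have hWγ : ∀ q ∈ W, θ q.1 0 q.2 = q.2 ∧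
        IsTimeSolution (X q.1) (slice U q.1) (fun t => θ q.1 t q.2) ∧
        ∀ t ∈ Icc (0 : ℝ) 1, θ q.1 t q.2 = γ (κ q.1) q.2 t := by
      intro q hq
      obtain ⟨h1, h2, h3, h4⟩ := hWmem q hq
      obtain ⟨h5, h6⟩ := hγ _ h2 _ h3
      refine hθγ q.1 q.2 _ h5 fun s hs => ?_
      obtain ⟨h7, h8⟩ := h6 s hs
      simp only [hg, h4] at h7
      refine ⟨h7, ?_⟩
      have := (hmem _ h2.1).2 _ (hbr h8)
      rwa [h4] at this
    refine ⟨W, ?_, ?_, ?_, fun q hq => ⟨(hWγ q hq).1, (hWγ q hq).2.1⟩⟩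
    · exact ((continuousOn_extChartAt u₀).isOpen_inter_preimage (isOpen_extChartAt_source u₀)
        (isOpen_ball.inter isOpen_ball)).prod isOpen_ball
    · exact ⟨⟨mem_extChartAt_source u₀, mem_ball_self hε, mem_ball_self hr⟩, mem_ball_self hη⟩
    · refine (hγs.contMDiffOn_comp_extChartAt J u₀ fun q hq => ?_).congr fun q hq =>
        (hWγ (q.1, q.2.2) hq.2).2.2 _ hq.1
      obtain ⟨h1, h2, h3, -⟩ := hWmem (q.1, q.2.2) hq.2
      exact ⟨h1, ⟨h2, hq.1⟩, h3⟩
  choose W hWo hW0 hWs hW using key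
  refine ⟨⋃ u, W u, θ, isOpen_iUnion hWo, fun u => mem_iUnion.2 ⟨u, hW0 u⟩, ?_, fun q hq => ?_⟩
  · refine contMDiffOn_of_locally_contMDiffOn fun q hq => ?_
    obtain ⟨u, hu⟩ := mem_iUnion.1 hq.2
    refine ⟨{q | (q.1, q.2.2) ∈ W u}, (hWo u).preimage (by fun_prop), hu, ?_⟩
    exact (hWs u).mono fun q' hq' => ⟨hq'.1.1, hq'.2⟩
  · obtain ⟨u, hu⟩ := mem_iUnion.1 hq
    exact hW u q hu

end GermFlow

/-! ### Pulling back contact forms by the flow -/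

section GermIsotopyOfFlow

variable {E H : Type*} [NormedAddCommGroup E] [NormedSpace ℝ E] [NormedAddCommGroup H]
  [NormedSpace ℝ H]

theorem fderiv_prod_apply_snd {f : ℝ × E → H} {q : ℝ × E} (hf : DifferentiableAt ℝ f q) (v : E) :
    fderiv ℝ f q (0, v) = fderiv ℝ (fun y => f (q.1, y)) q.2 v := by
  have h1 : HasFDerivAt (fun y : E => (q.1, y)) (ContinuousLinearMap.inr ℝ ℝ E) q.2 :=
    hasFDerivAt_prodMk_right q.1 q.2
  have h2 := (show HasFDerivAt f (fderiv ℝ f q) (q.1, q.2) from hf.hasFDerivAt).comp q.2 h1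
  have h3 : fderiv ℝ (fun y => f (q.1, y)) q.2 = _ := h2.fderiv
  rw [h3]; rfl

theorem hasDerivAt_prod_fst {f : ℝ × E → H} {q : ℝ × E} (hf : DifferentiableAt ℝ f q) :
    HasDerivAt (fun s => f (s, q.2)) (fderiv ℝ f q (1, 0)) q.1 := by
  have h1 : HasDerivAt (fun s : ℝ => (s, q.2)) ((1 : ℝ), (0 : E)) q.1 :=
    (hasDerivAt_id q.1).prodMk (hasDerivAt_const q.1 q.2)
  exact (show HasFDerivAt f (fderiv ℝ f q) (q.1, q.2) from
    hf.hasFDerivAt).comp_hasDerivAt q.1 h1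

/-- The derivative in time of the pullback of a family of 1-forms under a flow. -/
theorem hasDerivAt_pullback_flow {β : ℝ → E → E →L[ℝ] ℝ} {X θ : ℝ → E → E} {t : ℝ} {x : E}
    (hθ : ContDiffAt ℝ 2 (fun q : ℝ × E => θ q.1 q.2) (t, x))
    (hθX : ∀ᶠ q : ℝ × E in 𝓝 (t, x), HasDerivAt (fun s => θ s q.2) (X q.1 (θ q.1 q.2)) q.1)
    (hβ : DifferentiableAt ℝ (fun q : ℝ × E => β q.1 q.2) (t, θ t x))
    (hX : DifferentiableAt ℝ (X t) (θ t x)) (v : E) :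
    HasDerivAt (fun s => β s (θ s x) (fderiv ℝ (θ s) x v))
      (flatLie (X t) (β t) (θ t x) (fderiv ℝ (θ t) x v) +
        deriv (fun s => β s (θ t x)) t (fderiv ℝ (θ t) x v)) t := by
  set Θ : ℝ × E → E := fun q => θ q.1 q.2 with hΘ
  set Bq : ℝ × E → E →L[ℝ] ℝ := fun q => β q.1 q.2 with hBq
  have hev : ∀ᶠ q : ℝ × E in 𝓝 (t, x), DifferentiableAt ℝ Θ q :=
    (hθ.eventually (by simp)).mono fun q hq => hq.differentiableAt two_ne_zero
  have hΘd : DifferentiableAt ℝ Θ (t, x) := hev.self_of_nhds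
  have hD : DifferentiableAt ℝ (fderiv ℝ Θ) (t, x) :=
    (hθ.fderiv_right (m := 1) (by norm_num)).differentiableAt one_ne_zero
  have hsym : IsSymmSndFDerivAt ℝ Θ (t, x) := hθ.isSymmSndFDerivAt (by simp)
  have htime : ∀ᶠ q : ℝ × E in 𝓝 (t, x), fderiv ℝ Θ q (1, 0) = X q.1 (θ q.1 q.2) := by
    filter_upwards [hev, hθX] with q h1 h2
    exact (hasDerivAt_prod_fst h1).unique h2
  have hxt : Filter.Tendsto (fun y : E => (t, y)) (𝓝 x) (𝓝 (t, x)) :=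
    (by fun_prop : Continuous fun y : E => (t, y)).continuousAt
  have hst : Filter.Tendsto (fun s : ℝ => (s, x)) (𝓝 t) (𝓝 (t, x)) :=
    (by fun_prop : Continuous fun s : ℝ => (s, x)).continuousAt
  have hθtx : DifferentiableAt ℝ (θ t) x :=
    hΘd.comp (f := fun y : E => (t, y)) x (by fun_prop)
  have h1 : fderiv ℝ (fun y => fderiv ℝ Θ (t, y) (1, 0)) x v =
      fderiv ℝ (X t) (θ t x) (fderiv ℝ (θ t) x v) := by
    have h2 : (fun y => fderiv ℝ Θ (t, y) (1, 0)) =ᶠ[𝓝 x] X t ∘ θ t := hxt.eventually htime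
    rw [h2.fderiv_eq, fderiv_comp x hX hθtx]
    rfl
  have h2 : fderiv ℝ (fderiv ℝ Θ) (t, x) (0, v) (1, 0) =
      fderiv ℝ (fun y => fderiv ℝ Θ (t, y) (1, 0)) x v := by
    have h3 : DifferentiableAt ℝ (fun q => fderiv ℝ Θ q (1, 0)) (t, x) :=
      hD.clm_apply (differentiableAt_const _)
    rw [← fderiv_prod_apply_snd h3 v, fderiv_clm_apply hD (differentiableAt_const _)]
    simp
  -- Symmetry of second derivatives exchanges time and space: the derivative of `Dθ_s v` in `s` is
  -- the space derivative of `X ∘ θ`.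
  have h3 : HasDerivAt (fun s => fderiv ℝ (θ s) x v)
      (fderiv ℝ (X t) (θ t x) (fderiv ℝ (θ t) x v)) t := by
    have h4 : DifferentiableAt ℝ (fun q => fderiv ℝ Θ q (0, v)) (t, x) :=
      hD.clm_apply (differentiableAt_const _)
    have h5 := hasDerivAt_prod_fst h4
    have h6 : fderiv ℝ (fun q => fderiv ℝ Θ q (0, v)) (t, x) (1, 0) =
        fderiv ℝ (fderiv ℝ Θ) (t, x) (1, 0) (0, v) := by
      rw [fderiv_clm_apply hD (differentiableAt_const _)]
      simp
    rw [h6, hsym.eq, h2, h1] at h5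
    refine h5.congr_of_eventuallyEq ?_
    filter_upwards [hst.eventually hev] with s hs
    exact (fderiv_prod_apply_snd hs v).symm
  have h4 : HasDerivAt (fun s => β s (θ s x))
      (fderiv ℝ Bq (t, θ t x) (1, X t (θ t x))) t := by
    have h5 : HasDerivAt (fun s : ℝ => (s, θ s x)) ((1 : ℝ), X t (θ t x)) t :=
      (hasDerivAt_id t).prodMk hθX.self_of_nhds
    exact hβ.hasFDerivAt.comp_hasDerivAt t h5
  refine (h4.clm_apply h3).congr_deriv ?_
  have h5 : fderiv ℝ Bq (t, θ t x) (1, X t (θ t x)) =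
      deriv (fun s => β s (θ t x)) t + fderiv ℝ (β t) (θ t x) (X t (θ t x)) := by
    rw [show ((1 : ℝ), X t (θ t x)) = (1, 0) + (0, X t (θ t x)) by simp, map_add,
      fderiv_prod_apply_snd hβ, ← (hasDerivAt_prod_fst hβ).deriv]
  rw [h5, flatLie, add_apply]
  ring

theorem ContDiffOn.contDiffAt_of_Ioo {f : ℝ × E → H} {B : Set E} (hB : IsOpen B)
    (hf : ContDiffOn ℝ ∞ f (Icc 0 1 ×ˢ B)) {t : ℝ} (ht : t ∈ Ioo (0 : ℝ) 1) {x : E} (hx : x ∈ B) :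
    ContDiffAt ℝ ∞ f (t, x) :=
  hf.contDiffAt (Filter.mem_of_superset ((isOpen_Ioo.prod hB).mem_nhds ⟨ht, hx⟩)
    (prod_mono_left Ioo_subset_Icc_self))

theorem ContDiffOn.contDiffAt_of_Icc {f : ℝ × E → H} {B : Set E} (hB : IsOpen B)
    (hf : ContDiffOn ℝ ∞ f (Icc 0 1 ×ˢ B)) {t : ℝ} (ht : t ∈ Icc (0 : ℝ) 1) {x : E} (hx : x ∈ B) :
    ContDiffAt ℝ ∞ (fun y => f (t, y)) x := by
  have h1 : ContDiffOn ℝ ∞ (fun y => f (t, y)) B := hf.comp (by fun_prop) fun y hy => ⟨ht, hy⟩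
  exact h1.contDiffAt (hB.mem_nhds hx)

/-- The derivative of the pullback is the pullback of `L_X β + (d/dt) β`, which is zero. It is
computed for `0 < t < 1` only, where two-sided derivatives exist; continuity up to the ends and the
mean value theorem do the rest. -/
theorem pullback_flow_eq {B U W : Set E} (hB : IsOpen B) (hU : IsOpen U) (hUB : U ⊆ B)
    (hW : IsOpen W) {β : ℝ → E → E →L[ℝ] ℝ} {X θ : ℝ → E → E}
    (hβ : ContDiffOn ℝ ∞ (fun q : ℝ × E => β q.1 q.2) (Icc 0 1 ×ˢ B))
    (hX : ContDiffOn ℝ ∞ (fun q : ℝ × E => X q.1 q.2) (Icc 0 1 ×ˢ U))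
    (hθ : ContDiffOn ℝ ∞ (fun q : ℝ × E => θ q.1 q.2) (Icc 0 1 ×ˢ W))
    (hXβ : ∀ t ∈ Icc (0 : ℝ) 1, ∀ x ∈ U, ∀ v,
      flatLie (X t) (β t) x v + derivWithin (fun s => β s x) (Icc 0 1) t v = 0)
    (hθX : ∀ x ∈ W, θ 0 x = x ∧ IsTimeSolution X U (fun t => θ t x)) {t : ℝ}
    (ht : t ∈ Icc (0 : ℝ) 1) {x : E} (hx : x ∈ W) :
    (β t (θ t x)).comp (fderiv ℝ (θ t) x) = β 0 x := by
  have hmem : ∀ s ∈ Icc (0 : ℝ) 1, ∀ y ∈ W, θ s y ∈ U := fun s hs y hy => ((hθX y hy).2 s hs).2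
  ext v
  set A : ℝ → ℝ := fun s => β s (θ s x) (fderiv ℝ (θ s) x v) with hA
  have hA0 : A 0 = β 0 x v := by
    have h1 : θ 0 =ᶠ[𝓝 x] id := by
      filter_upwards [hW.mem_nhds hx] with y hy
      exact (hθX y hy).1
    simp only [hA]
    rw [h1.fderiv_eq, (hθX x hx).1, fderiv_id]
    rfl
  have hAc : ContinuousOn A (Icc 0 1) := by
    have h1 : ContinuousOn (fun s => θ s x) (Icc 0 1) := (hθX x hx).2.continuousOn
    have h2 : ContinuousOn (fun s => β s (θ s x)) (Icc 0 1) :=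
      hβ.continuousOn.comp (continuousOn_id.prodMk h1) fun s hs => ⟨hs, hUB (hmem s hs x hx)⟩
    have h3 : restrictBase (Icc (0 : ℝ) 1) (univ ×ˢ W) = Icc 0 1 ×ˢ W := by
      ext q; simp [restrictBase, and_comm]
    have h4 := ContDiffOn.fderiv_slice (uniqueDiffOn_Icc zero_lt_one) (isOpen_univ.prod hW)
      (f := fun q : ℝ × E => θ q.1 q.2) (by rwa [h3])
    have h5 : ContinuousOn (fun s => fderiv ℝ (θ s) x) (Icc 0 1) :=
      h4.continuousOn.comp (f := fun s : ℝ => (s, x)) (by fun_prop) fun s hs => by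
        rw [h3]; exact ⟨hs, hx⟩
    exact h2.clm_apply (h5.clm_apply continuousOn_const)
  have hAd : ∀ s ∈ Ioo (0 : ℝ) 1, HasDerivAt A 0 s := by
    intro s hs
    have hs' := Ioo_subset_Icc_self hs
    have hθs := hθ.contDiffAt_of_Ioo hW hs hx
    have hβs := hβ.contDiffAt_of_Ioo hB hs (hUB (hmem s hs' x hx))
    have hXs := hX.contDiffAt_of_Icc hU hs' (hmem s hs' x hx)
    have hev : ∀ᶠ q : ℝ × E in 𝓝 (s, x),
        HasDerivAt (fun r => θ r q.2) (X q.1 (θ q.1 q.2)) q.1 := by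
      filter_upwards [(isOpen_Ioo.prod hW).mem_nhds (show (s, x) ∈ Ioo (0 : ℝ) 1 ×ˢ W from ⟨hs, hx⟩)]
        with q hq
      exact ((hθX q.2 hq.2).2 q.1 (Ioo_subset_Icc_self hq.1)).1.hasDerivAt
        (Icc_mem_nhds hq.1.1 hq.1.2)
    have h1 := hasDerivAt_pullback_flow (β := β) (X := X) (θ := θ)
      (hθs.of_le (WithTop.coe_le_coe.2 le_top)) hev (hβs.differentiableAt (by simp))
      (hXs.differentiableAt (by simp)) v
    have h2 := hXβ s hs' _ (hmem s hs' x hx) (fderiv ℝ (θ s) x v)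
    rw [derivWithin_of_mem_nhds (Icc_mem_nhds hs.1 hs.2)] at h2
    rwa [h2] at h1
  rcases eq_or_lt_of_le ht.1 with h | h
  · rw [← h]; exact hA0
  · obtain ⟨c, hc, hc'⟩ := exists_hasDerivAt_eq_slope A (fun _ => 0) h
      (hAc.mono (Icc_subset_Icc_right ht.2)) fun s hs => hAd s ⟨hs.1, hs.2.trans_le ht.2⟩
    have h1 : A t - A 0 = 0 := by
      rw [eq_comm, div_eq_zero_iff] at hc'
      rcases hc' with h2 | h2
      · exact h2
      · linarith
    rw [hA0] at h1
    exact sub_eq_zero.1 h1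

/-- A vector killed by the differential of `ψ` lies in the kernel of the pulled back form and is
orthogonal to everything for its exterior derivative, so the contact condition makes it zero. -/
theorem IsFlatContactAt.injective_of_pullback {α α' : E → E →L[ℝ] ℝ} {ψ : E → E} {x : E}
    (hψ : ContDiffAt ℝ 2 ψ x) (hα : DifferentiableAt ℝ α (ψ x))
    (h : ∀ᶠ y in 𝓝 x, (α (ψ y)).comp (fderiv ℝ ψ y) = α' y) (hα' : IsFlatContactAt α' x) :
    Function.Injective (fderiv ℝ ψ x) := by
  rw [injective_iff_map_eq_zero]
  intro v hv
  have h1 : ∀ w, α' x w = α (ψ x) (fderiv ℝ ψ x w) := fun w => by rw [← h.self_of_nhds]; rfl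
  refine hα'.2 v (by rw [h1, hv, map_zero]) fun w _ => ?_
  rw [flatD_congr (Filter.EventuallyEq.symm h), flatD_pullback hψ hα, hv, flatD_eq hα]
  simp

/-- The flow of a solution of `L_X β + (d/dt) β = 0` is an isotopy with `θ_t^* β_t = β_0`. -/
theorem isGermIsotopy_of_flow [FiniteDimensional ℝ E] {B U W : Set E} (hB : IsOpen B)
    (hU : IsOpen U) (hUB : U ⊆ B) (hW : IsOpen W) (hW0 : 0 ∈ W) {β : ℝ → E → E →L[ℝ] ℝ}
    {X θ : ℝ → E → E}
    (hβ : ContDiffOn ℝ ∞ (fun q : ℝ × E => β q.1 q.2) (Icc 0 1 ×ˢ B))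
    (hc : ∀ x ∈ B, IsFlatContactAt (β 0) x)
    (hX : ContDiffOn ℝ ∞ (fun q : ℝ × E => X q.1 q.2) (Icc 0 1 ×ˢ U))
    (hX0 : ∀ t ∈ Icc (0 : ℝ) 1, X t 0 = 0)
    (hθ : ContDiffOn ℝ ∞ (fun q : ℝ × E => θ q.1 q.2) (Icc 0 1 ×ˢ W))
    (hXβ : ∀ t ∈ Icc (0 : ℝ) 1, ∀ x ∈ U, ∀ v,
      flatLie (X t) (β t) x v + derivWithin (fun s => β s x) (Icc 0 1) t v = 0)
    (hθX : ∀ x ∈ W, θ 0 x = x ∧ IsTimeSolution X U (fun t => θ t x)) :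
    IsGermIsotopy W B β θ := by
  have h0 : (0 : ℝ) ∈ Icc (0 : ℝ) 1 := by simp
  have hmem : ∀ s ∈ Icc (0 : ℝ) 1, ∀ y ∈ W, θ s y ∈ U := fun s hs y hy => ((hθX y hy).2 s hs).2
  have hWU : W ⊆ U := fun x hx => by
    have := hmem 0 h0 x hx
    rwa [(hθX x hx).1] at this
  have hX1 : ContDiffOn ℝ 1 (fun q : ℝ × E => X q.1 q.2) (Icc 0 1 ×ˢ U) := hX.of_le (by simp)
  have hpull : ∀ t ∈ Icc (0 : ℝ) 1, ∀ x ∈ W,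
      (β t (θ t x)).comp (fderiv ℝ (θ t) x) = β 0 x := fun t ht x hx =>
    pullback_flow_eq hB hU hUB hW hβ hX hθ hXβ hθX ht hx
  refine ⟨hθ, fun x hx => (hθX x hx).1, fun t ht => ?_, fun t ht x hx => hUB (hmem t ht x hx),
    fun t ht x hx y hy hxy => ?_, fun t ht x hx => ?_, hpull⟩
  · refine (hθX 0 hW0).2.eqOn hU hX1 (δ := fun _ => 0) (fun s hs => ⟨?_, hWU hW0⟩) h0
      (hθX 0 hW0).1 ht
    rw [hX0 s hs]
    exact hasDerivWithinAt_const _ _ _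
  · have := (hθX x hx).2.eqOn hU hX1 (hθX y hy).2 ht hxy h0
    simp only [(hθX x hx).1, (hθX y hy).1] at this
    exact this
  · have hinj : Function.Injective (fderiv ℝ (θ t) x) := by
      refine (hc x (hUB (hWU hx))).injective_of_pullback (α := β t)
        ((hθ.contDiffAt_of_Icc hW ht hx).of_le (WithTop.coe_le_coe.2 le_top))
        ((hβ.contDiffAt_of_Icc hB ht (hUB (hmem t ht x hx))).differentiableAt (by simp)) ?_
      filter_upwards [hW.mem_nhds hx] with y hy
      exact hpull t ht y hy
    exact ⟨hinj, LinearMap.injective_iff_surjective.1 hinj⟩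

end GermIsotopyOfFlow

/-! ### The generating field for germs, and its zero at the origin -/

section GermField

open Metric

/-- A solution with `α(X) = 0` on a hyperplane whose tangent space at the origin is the contact
plane vanishes at the origin if `β` vanishes on that plane. -/
theorem IsFlatSolution.apply_zero {E : Type*} [NormedAddCommGroup E] [NormedSpace ℝ E]
    {a b : E → E →L[ℝ] ℝ} {ℓ : E →L[ℝ] ℝ} {X : E → E} {B : Set E} (hB : B ∈ 𝓝 (0 : E))
    (hX : IsFlatSolution a b ℓ (fun _ => 0) X B) (ha : DifferentiableAt ℝ a 0)
    (hc : IsFlatContactAt a 0) (hker : ∀ v, a 0 v = 0 → ℓ v = 0 ∧ b 0 v = 0) : X 0 = 0 := by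
  obtain ⟨hXd, hXe, hX0⟩ := hX 0 (mem_of_mem_nhds hB)
  refine hc.2 _ (hX0 (map_zero _)) fun w hw => ?_
  obtain ⟨hℓw, hbw⟩ := hker w hw
  have h1 := hXe w
  rw [flatLie_eq hXd ha, hbw, add_zero] at h1
  -- The line through `w` lies in the hyperplane, where `α(X)` is zero. So `d(α(X))` kills `w`, and
  -- Cartan's formula leaves `dα(X, w) = 0` for each `w` in the contact plane.
  have h2 : HasFDerivAt (fun z => a z (X z)) (fderiv ℝ (fun z => a z (X z)) 0) ((0 : ℝ) • w) := by
    rw [zero_smul]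
    exact (ha.clm_apply hXd).hasFDerivAt
  have h3 : HasDerivAt (fun s : ℝ => s • w) w 0 := by
    simpa using (hasDerivAt_id (0 : ℝ)).smul_const w
  have h4 := h2.comp_hasDerivAt (0 : ℝ) h3
  have h5 : (fun z => a z (X z)) ∘ (fun s : ℝ => s • w) =ᶠ[𝓝 0] fun _ => 0 := by
    have h6 : Filter.Tendsto (fun s : ℝ => s • w) (𝓝 0) (𝓝 0) := by
      have : Continuous fun s : ℝ => s • w := by fun_prop
      simpa using this.tendsto 0
    filter_upwards [h6.eventually hB] with s hs
    exact (hX _ hs).2.2 (by rw [map_smul, hℓw, smul_zero])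
  have h7 := h4.unique ((hasDerivAt_const (0 : ℝ) (0 : ℝ)).congr_of_eventuallyEq h5)
  rw [h7, zero_add] at h1
  exact h1

theorem derivWithin_clm_apply_eq_zero {E : Type*} [NormedAddCommGroup E] [NormedSpace ℝ E]
    {c : ℝ → E →L[ℝ] ℝ} {I : Set ℝ} {t : ℝ} (ht : t ∈ I) (hI : UniqueDiffWithinAt ℝ I t)
    (hc : DifferentiableWithinAt ℝ c I t) {v : E} (hv : ∀ s ∈ I, c s v = 0) :
    derivWithin c I t v = 0 := by
  have h1 := hc.hasDerivWithinAt.clm_apply (hasDerivWithinAt_const t I v)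
  have h2 : HasDerivWithinAt (fun s => c s v) 0 I t :=
    (hasDerivWithinAt_const t I (0 : ℝ)).congr hv (hv t ht)
  simpa using hI.eq_deriv _ h1 h2

universe u

variable {F : Type u} {K P : Type*} {E : Type} [NormedAddCommGroup F] [NormedSpace ℝ F]
  [FiniteDimensional ℝ F] [TopologicalSpace K] (J : ModelWithCorners ℝ F K) [TopologicalSpace P]
  [ChartedSpace K P] [IsManifold J ∞ P] [T2Space P] [SecondCountableTopology P]
  [NormedAddCommGroup E] [NormedSpace ℝ E] [FiniteDimensional ℝ E]

/-- A solution of `L_X β + (d/dt) β = 0` that vanishes at the origin, for a family of germs of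
contact forms whose kernel at the origin does not depend on time. -/
theorem exists_germ_field {β : P → ℝ → E → E →L[ℝ] ℝ} {W : Set (P × E)} (hW : IsOpen W)
    (hW0 : ∀ u, (u, 0) ∈ W)
    (hβ : ContMDiffOn (J.prod (𝓘(ℝ, ℝ).prod 𝓘(ℝ, E))) 𝓘(ℝ, E →L[ℝ] ℝ) ∞
      (fun q : P × ℝ × E => β q.1 q.2.1 q.2.2) (timeDomain W))
    (hc : ∀ u, ∀ t ∈ Icc (0 : ℝ) 1, IsFlatContactAt (β u t) 0)
    (hker : ∀ u, ∀ t ∈ Icc (0 : ℝ) 1, (β u t 0).ker = (β u 0 0).ker) :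
    ∃ (U : Set (P × E)) (X : P → ℝ → E → E), IsOpen U ∧ (∀ u, (u, 0) ∈ U) ∧ U ⊆ W ∧
      ContMDiffOn (J.prod (𝓘(ℝ, ℝ).prod 𝓘(ℝ, E))) 𝓘(ℝ, E) ∞
        (fun q : P × ℝ × E => X q.1 q.2.1 q.2.2) (timeDomain U) ∧
      (∀ u, ∀ t ∈ Icc (0 : ℝ) 1, ∀ x ∈ slice U u, ∀ v, flatLie (X u t) (β u t) x v +
        derivWithin (fun s => β u s x) (Icc 0 1) t v = 0) ∧
      (∀ u, ∀ t ∈ Icc (0 : ℝ) 1, X u t 0 = 0) ∧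
      ∀ (Q : Set P), ∀ u ∈ Q, (∀ᶠ q : P × E in 𝓝 (u, 0), q.1 ∈ Q →
          ∀ t ∈ Icc (0 : ℝ) 1, β q.1 t q.2 = β q.1 0 q.2) →
        ∀ᶠ q : P × E in 𝓝 (u, 0), q.1 ∈ Q → ∀ t ∈ Icc (0 : ℝ) 1, X q.1 t q.2 = 0 := by
  have : CompleteSpace F := FiniteDimensional.complete ℝ F
  set D : Set (P × ℝ × E) := {q | (q.1, q.2.2) ∈ W} with hD
  have hDo : IsOpen D := hW.preimage (by fun_prop)
  have ha : ContMDiffOn (J.prod (𝓘(ℝ, ℝ).prod 𝓘(ℝ, E))) 𝓘(ℝ, E →L[ℝ] ℝ) ∞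
      (fun q : P × ℝ × E => β q.1 q.2.1 q.2.2) (timeRestrict D) := by
    rwa [timeDomain_eq_timeRestrict] at hβ
  obtain ⟨hb, hbd⟩ := ha.time_derivWithin J hDo
  have had : ∀ q ∈ timeRestrict D, DifferentiableAt ℝ (β q.1 q.2.1) q.2.2 := fun q hq =>
    (ha.contDiffAt_of_slice J hDo hq).differentiableAt (by simp)
  -- The initial hypersurface is the common contact plane at the origin, as a linear hyperplane. A
  -- vector on which `α_t(0)` is one is not in its kernel, hence is transverse.
  set ℓ : P × ℝ × E → ℝ := fun q => β q.1 0 0 q.2.2 with hℓdef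
  have hℓ' : ContMDiff (J.prod (𝓘(ℝ, ℝ).prod 𝓘(ℝ, E))) 𝓘(ℝ, ℝ) ∞ ℓ := by
    have h1 : ContMDiff (J.prod (𝓘(ℝ, ℝ).prod 𝓘(ℝ, E))) (J.prod (𝓘(ℝ, ℝ).prod 𝓘(ℝ, E))) ∞
        (fun q : P × ℝ × E => (q.1, (0 : ℝ), (0 : E))) :=
      contMDiff_fst.prodMk (contMDiff_const.prodMk contMDiff_const)
    have h2 : ContMDiff (J.prod (𝓘(ℝ, ℝ).prod 𝓘(ℝ, E))) 𝓘(ℝ, E →L[ℝ] ℝ) ∞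
        (fun q : P × ℝ × E => β q.1 0 0) :=
      contMDiffOn_univ.1 (hβ.comp h1.contMDiffOn fun q _ => ⟨by simp, hW0 q.1⟩)
    exact h2.clm_apply (contMDiff_snd.comp contMDiff_snd)
  have hℓ0 : ∀ u t, ℓ (u, t, 0) = 0 := fun u t => map_zero _
  have key := fun i : P × Icc (0 : ℝ) 1 => exists_local_flat_solution J hDo ha hb
    hℓ'.contMDiffOn (h := fun _ => 0) contMDiffOn_const (q₀ := (i.1, i.2.1, 0))
    ⟨hW0 i.1, i.2.2⟩ (hℓ0 _ _) (hc i.1 _ i.2.2) (fun v hv _ => by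
      have h1 : fderiv ℝ (fun y => ℓ (i.1, i.2.1, y)) 0 = β i.1 0 0 := (β i.1 0 0).fderiv
      rw [h1]
      intro h0
      have h2 : v ∈ (β i.1 i.2.1 0).ker := by
        rw [hker i.1 _ i.2.2]; exact h0
      have h3 : β i.1 i.2.1 0 v = 0 := h2
      rw [show β i.1 i.2.1 0 v = 1 from hv] at h3
      exact one_ne_zero h3)
  choose O X C hO hqO hOD hC hXs hX hball hun using key
  set T : Set (P × ℝ × E) := {q | q.2.1 ∈ Icc (0 : ℝ) 1} with hT
  have hnear : ∀ (c : ℝ) (u : P) (t : ℝ) {O' : Set (P × ℝ × E)}, IsOpen O' → (u, t, 0) ∈ O' →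
      ∀ᶠ q' : P × ℝ × E in 𝓝 (u, t, 0), ∀ y ∈ closedBall q'.2.2 (c * |ℓ q'|),
        (q'.1, q'.2.1, y) ∈ O' := by
    intro c u t O' hO' hq
    have hB := hO'.mem_nhds hq
    rw [nhds_prod_eq, nhds_prod_eq, ← Filter.prod_assoc] at hB
    obtain ⟨A, hA, B, hB, hAB⟩ := Filter.mem_prod_iff.1 hB
    obtain ⟨ε, hε, hBε⟩ := Metric.mem_nhds_iff.1 hB
    have h1 : ∀ᶠ q' : P × ℝ × E in 𝓝 (u, t, 0), c * |ℓ q'| < ε / 2 := by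
      have h2 : Continuous fun q' => c * |ℓ q'| := (hℓ'.continuous.abs).const_mul c
      have h3 := h2.tendsto (u, t, 0)
      rw [hℓ0, abs_zero, mul_zero] at h3
      exact h3.eventually (gt_mem_nhds (half_pos hε))
    have h4 : ∀ᶠ q' : P × ℝ × E in 𝓝 (u, t, 0), (q'.1, q'.2.1) ∈ A :=
      (by fun_prop : Continuous fun q' : P × ℝ × E => (q'.1, q'.2.1)).continuousAt.eventually
        (by rw [nhds_prod_eq]; exact hA)
    have h5 : ∀ᶠ q' : P × ℝ × E in 𝓝 (u, t, 0), q'.2.2 ∈ ball (0 : E) (ε / 2) :=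
      (by fun_prop : Continuous fun q' : P × ℝ × E => q'.2.2).continuousAt.eventually
        (ball_mem_nhds _ (half_pos hε))
    filter_upwards [h1, h4, h5] with q' h1 h4 h5 y hy
    refine hAB (show ((q'.1, q'.2.1), y) ∈ A ×ˢ B from ⟨h4, hBε ?_⟩)
    rw [mem_closedBall] at hy
    rw [mem_ball] at h5 ⊢
    linarith [dist_triangle y q'.2.2 0]
  have := J.locallyCompactSpace
  have := ChartedSpace.locallyCompactSpace K P
  have := TopologicalSpace.metrizableSpace_of_t3_secondCountable (P × ℝ × E)
  -- The gluing lemma needs a nonempty index type.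
  rcases isEmpty_or_nonempty P with hP | hP
  · exact ⟨W, fun u => (hP.false u).elim, hW, hW0, subset_rfl, fun q => (hP.false q.1).elim,
      fun u => (hP.false u).elim, fun u => (hP.false u).elim, fun _ u => (hP.false u).elim⟩
  obtain ⟨U', Y, hU', hLU', hY⟩ := exists_glue (D := T) (T := fun _ => E)
    (L := {q : P × ℝ × E | q.2.1 ∈ Icc (0 : ℝ) 1 ∧ q.2.2 = 0}) hO X
    (by
      rintro ⟨u, t, x⟩ ⟨ht, hx⟩
      obtain rfl : x = 0 := hx
      exact mem_iUnion.2 ⟨(u, ⟨t, ht⟩), hqO _⟩)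
    (fun i j q hq hqi hqj => by
      obtain ⟨u, t, x⟩ := q
      obtain ⟨ht, rfl⟩ : t ∈ Icc (0 : ℝ) 1 ∧ x = 0 := hq
      rw [eventually_nhdsWithin_iff]
      filter_upwards [hnear (C i) u t (hO j) hqj, (hO i).mem_nhds hqi] with q' h1 h2 h3
      exact (hun i q' ⟨h2, h3⟩ {y | (q'.1, q'.2.1, y) ∈ O j} (fun y => X j (q'.1, q'.2.1, y))
        ((hO j).preimage (by fun_prop)) (fun y hy => h1 y hy)
        (fun y hy => hX j (q'.1, q'.2.1, y) ⟨hy, h3⟩ y rfl)).symm)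
  set U : Set (P × E) := {q | ∀ t ∈ Icc (0 : ℝ) 1, (q.1, t, q.2) ∈ U'} with hU
  have hUY : ∀ q ∈ timeDomain U, ∃ i, q ∈ O i ∧ ∀ᶠ q' in 𝓝[T] q, Y q' = X i q' :=
    fun q hq => hY q (hq.2 _ hq.1)
  have hU0 : ∀ u, (u, 0) ∈ U := fun u t ht => hLU' ⟨ht, rfl⟩
  have hYslice : ∀ {u : P} {t : ℝ} {x : E} {i}, t ∈ Icc (0 : ℝ) 1 →
      (∀ᶠ q' in 𝓝[T] (u, t, x), Y q' = X i q') →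
      (fun y => Y (u, t, y)) =ᶠ[𝓝 x] fun y => X i (u, t, y) := by
    intro u t x i ht hi
    have h2 : Filter.Tendsto (fun x' : E => (u, t, x')) (𝓝 x) (𝓝 (u, t, x)) :=
      (by fun_prop : Continuous fun x' : E => (u, t, x')).continuousAt
    filter_upwards [h2.eventually (eventually_nhdsWithin_iff.1 hi)] with x' hx'
    exact hx' ht
  refine ⟨U, fun u t x => Y (u, t, x), isOpen_forall_time hU', hU0, ?_, ?_, ?_, ?_, ?_⟩
  · intro q hq
    obtain ⟨i, hi, -⟩ := hUY (q.1, 0, q.2) ⟨by simp, hq⟩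
    exact hOD i hi
  · intro q hq
    obtain ⟨i, hi, hYi⟩ := hUY q hq
    have h1 : timeRestrict (O i) ∈ 𝓝[timeDomain U] q :=
      mem_nhdsWithin.2 ⟨O i, hO i, hi, fun q' hq' => ⟨hq'.1, hq'.2.1⟩⟩
    refine ((hXs i q ⟨hi, hq.1⟩).mono_of_mem_nhdsWithin h1).congr_of_eventuallyEq ?_ ?_
    · exact nhdsWithin_mono q (fun q' hq' => hq'.1) hYi
    · exact hYi.self_of_nhdsWithin hq.1
  · intro u t ht x hx v
    obtain ⟨i, hi, hYi⟩ := hUY (u, t, x) ⟨ht, hx⟩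
    have h1 := (hX i (u, t, x) ⟨hi, ht⟩ x rfl).2.1 v
    rwa [flatLie_congr (Filter.EventuallyEq.refl _ _) (hYslice ht hYi)]
  · intro u t ht
    obtain ⟨i, hi, hYi⟩ := hUY (u, t, 0) ⟨ht, hU0 u⟩
    refine (hYslice ht hYi).self_of_nhds.trans ?_
    refine IsFlatSolution.apply_zero (a := β u t) (B := {y | (u, t, y) ∈ O i}) (ℓ := β u 0 0)
      (b := fun y => derivWithin (fun s => β u s y) (Icc 0 1) t) (X := fun y => X i (u, t, y))
      (((hO i).preimage (by fun_prop)).mem_nhds hi)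
      (fun y hy => hX i (u, t, y) ⟨hy, ht⟩ y rfl) (had (u, t, 0) ⟨hW0 u, ht⟩) (hc u t ht)
      fun v hv => ?_
    have h1 : ∀ s ∈ Icc (0 : ℝ) 1, β u s 0 v = 0 := fun s hs => by
      have h2 : v ∈ (β u t 0).ker := hv
      rw [hker u t ht, ← hker u s hs] at h2
      exact h2
    exact ⟨h1 0 (by simp), derivWithin_clm_apply_eq_zero ht (uniqueDiffOn_Icc zero_lt_one t ht)
      (hbd (u, t, 0) ⟨hW0 u, ht⟩) h1⟩
  -- The zero field is a competitor only for parameters in `Q`. The general `Q` serves two uses: all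
  -- parameters, near `A`, and a single parameter, for the clause on constant families.
  · intro Q u hu hβQ
    have key : ∀ t ∈ Icc (0 : ℝ) 1, ∀ᶠ q' in 𝓝 (u, t, (0 : E)), q'.2.1 ∈ Icc (0 : ℝ) 1 →
        q'.1 ∈ Q → Y q' = 0 := by
      intro t ht
      obtain ⟨i, hi, hYi⟩ := hUY (u, t, 0) ⟨ht, hU0 u⟩
      obtain ⟨A, hA, hAo, huA⟩ := eventually_nhds_iff.1 hβQ
      have h1 := hnear (C i) u t (O' := {q | (q.1, q.2.2) ∈ A})
        (hAo.preimage (by fun_prop)) huA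
      filter_upwards [h1, eventually_nhdsWithin_iff.1 hYi, (hO i).mem_nhds hi] with
        q' h2 h3 h4 h5 h6
      rw [h3 h5]
      refine (hun i q' ⟨h4, h5⟩ {y | (q'.1, y) ∈ A ∧ (q'.1, y) ∈ W} (fun _ => 0)
        ((hAo.preimage (by fun_prop)).inter (hW.preimage (by fun_prop)))
        (fun y hy => ⟨h2 y hy, hball i q' ⟨h4, h5⟩ y hy⟩) fun y hy =>
          ⟨differentiableAt_const _, fun v => ?_, fun _ => map_zero _⟩).symm
      have h7 : derivWithin (fun s => β q'.1 s y) (Icc 0 1) q'.2.1 = 0 := by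
        rw [derivWithin_congr (f := fun _ => β q'.1 0 y) (fun s hs => hA _ hy.1 h6 s hs)
          (hA _ hy.1 h6 _ h5)]
        simp
      simp [flatLie, h7]
    have h1 : IsOpen {q : P × E | ∀ t ∈ Icc (0 : ℝ) 1, (q.1, t, q.2) ∈
        {q : P × ℝ × E | ∀ᶠ q' in 𝓝 q, q'.2.1 ∈ Icc (0 : ℝ) 1 → q'.1 ∈ Q → Y q' = 0}} :=
      isOpen_forall_time isOpen_setOfPred_eventually_nhds
    filter_upwards [h1.mem_nhds (show (u, (0 : E)) ∈ _ from key)] with q hq hqQ t ht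
    exact (hq t ht).self_of_nhds ht hqQ

end GermField

/-! ### The isotopy generated by the canonical field -/

section CanonicalGermIsotopy

open Metric

theorem ContMDiffOn.fderiv_slice {F K P E H : Type*} [NormedAddCommGroup F] [NormedSpace ℝ F]
    [TopologicalSpace K] (J : ModelWithCorners ℝ F K) [TopologicalSpace P] [ChartedSpace K P]
    [IsManifold J ∞ P] [NormedAddCommGroup E] [NormedSpace ℝ E] [NormedAddCommGroup H]
    [NormedSpace ℝ H] {f : P × ℝ × E → H} {D : Set (P × ℝ × E)} (hD : IsOpen D)
    (hf : ContMDiffOn (J.prod (𝓘(ℝ, ℝ).prod 𝓘(ℝ, E))) 𝓘(ℝ, H) ∞ f (timeRestrict D)) :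
    ContMDiffOn (J.prod (𝓘(ℝ, ℝ).prod 𝓘(ℝ, E))) 𝓘(ℝ, E →L[ℝ] H) ∞
      (fun q => fderiv ℝ (fun y => f (q.1, q.2.1, y)) q.2.2) (timeRestrict D) := by
  refine contMDiffOn_of_locally_contMDiffOn fun q₀ hq₀ => ?_
  obtain ⟨ε, hε, hbox⟩ := exists_chart_box J hD hq₀.1
  set κ := extChartAt J q₀.1 with hκ
  have hrange : ∀ u, κ u ∈ range J := fun u => by rw [hκ, extChartAt_coe]; exact mem_range_self _
  set S : Set (F × ℝ) := (range J ∩ ball (κ q₀.1) ε) ×ˢ (Icc (0 : ℝ) 1 ∩ ball q₀.2.1 ε) with hS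
  set B : Set ((F × ℝ) × E) := univ ×ˢ ball q₀.2.2 ε with hB
  have hSu : UniqueDiffOn ℝ S := (J.uniqueDiffOn.inter isOpen_ball).prod
    ((uniqueDiffOn_Icc zero_lt_one).inter isOpen_ball)
  have hg : ContDiffOn ℝ ∞ (fun q : (F × ℝ) × E => f (κ.symm q.1.1, q.1.2, q.2))
      (restrictBase S B) := by
    refine hf.contDiffOn_extChartAt_symm J q₀.1 fun q hq => ?_
    have h1 := hbox q.1.1 hq.2.1.1
    exact ⟨h1.1, h1.2 _ hq.2.1.2.2 _ hq.1.2, hq.2.1.2.1⟩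
  have hg' := ContDiffOn.fderiv_slice hSu (isOpen_univ.prod isOpen_ball) hg
  refine ⟨(κ.source ∩ κ ⁻¹' ball (κ q₀.1) ε) ×ˢ (ball q₀.2.1 ε ×ˢ ball q₀.2.2 ε),
    ((continuousOn_extChartAt q₀.1).isOpen_inter_preimage
      (isOpen_extChartAt_source q₀.1) isOpen_ball).prod (isOpen_ball.prod isOpen_ball),
    ⟨⟨mem_extChartAt_source q₀.1, mem_ball_self hε⟩, mem_ball_self hε, mem_ball_self hε⟩, ?_⟩
  refine (hg'.contMDiffOn_comp_extChartAt J q₀.1 fun q hq => ?_).congr fun q hq => ?_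
  · exact ⟨hq.2.1.1, ⟨trivial, hq.2.2.2⟩, ⟨⟨hrange _, hq.2.1.2⟩, hq.1.2, hq.2.2.1⟩, trivial⟩
  · simp only [← hκ, κ.left_inv hq.2.1.1]

universe u

variable {F : Type u} {K P : Type*} {E : Type} [NormedAddCommGroup F] [NormedSpace ℝ F]
  [FiniteDimensional ℝ F] [TopologicalSpace K] (J : ModelWithCorners ℝ F K) [TopologicalSpace P]
  [ChartedSpace K P] [IsManifold J ∞ P] [T2Space P] [SecondCountableTopology P]
  [NormedAddCommGroup E] [NormedSpace ℝ E] [FiniteDimensional ℝ E]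

/-- The isotopy of germs obtained from the solution of `L_X β + (d/dt) β = 0`. -/
theorem exists_canonical_germ_isotopy {β : P → ℝ → E → E →L[ℝ] ℝ} {W : Set (P × E)}
    (hW : IsOpen W) (hW0 : ∀ u, (u, 0) ∈ W)
    (hβ : ContMDiffOn (J.prod (𝓘(ℝ, ℝ).prod 𝓘(ℝ, E))) 𝓘(ℝ, E →L[ℝ] ℝ) ∞
      (fun q : P × ℝ × E => β q.1 q.2.1 q.2.2) (timeDomain W))
    (hc : ∀ u, ∀ t ∈ Icc (0 : ℝ) 1, ∀ x ∈ slice W u, IsFlatContactAt (β u t) x)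
    (hker : ∀ u, ∀ t ∈ Icc (0 : ℝ) 1, (β u t 0).ker = (β u 0 0).ker) :
    ∃ (W' : Set (P × E)) (θ : P → ℝ → E → E), IsOpen W' ∧ (∀ u, (u, 0) ∈ W') ∧ W' ⊆ W ∧
      ContMDiffOn (J.prod (𝓘(ℝ, ℝ).prod 𝓘(ℝ, E))) 𝓘(ℝ, E) ∞
        (fun q : P × ℝ × E => θ q.1 q.2.1 q.2.2) (timeDomain W') ∧
      (∀ u, IsGermIsotopy (slice W' u) (slice W u) (β u) (θ u)) ∧
      ∀ (Q : Set P), ∀ u ∈ Q, (∀ᶠ q : P × E in 𝓝 (u, 0), q.1 ∈ Q →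
          ∀ t ∈ Icc (0 : ℝ) 1, β q.1 t q.2 = β q.1 0 q.2) →
        ∀ᶠ q : P × E in 𝓝 (u, 0), q.1 ∈ Q → ∀ t ∈ Icc (0 : ℝ) 1, θ q.1 t q.2 = q.2 := by
  have : CompleteSpace F := FiniteDimensional.complete ℝ F
  have h0 : (0 : ℝ) ∈ Icc (0 : ℝ) 1 := by simp
  obtain ⟨U, X, hU, hU0, hUW, hXs, hXβ, hX0, hXz⟩ :=
    exists_germ_field J hW hW0 hβ (fun u t ht => hc u t ht 0 (hW0 u)) hker
  obtain ⟨W', θ, hW', hW'0, hθs, hθ⟩ := exists_germ_flow J hU hU0 hXs hX0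
  have hW'U : W' ⊆ U := fun q hq => by
    obtain ⟨h1, h2⟩ := hθ q hq
    have h3 : θ q.1 0 q.2 ∈ slice U q.1 := (h2 0 h0).2
    rwa [h1] at h3
  refine ⟨W', θ, hW', hW'0, hW'U.trans hUW, hθs, fun u => ?_, fun Q u hu hQ => ?_⟩
  · exact isGermIsotopy_of_flow (U := slice U u) (X := X u) (hW.preimage (by fun_prop))
      (hU.preimage (by fun_prop)) (fun x hx => hUW hx) (hW'.preimage (by fun_prop)) (hW'0 u)
      (hβ.contDiffOn_timeSlice J u) (hc u 0 h0) (hXs.contDiffOn_timeSlice J u) (hX0 u)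
      (hθs.contDiffOn_timeSlice J u) (hXβ u) (fun x hx => hθ (u, x) hx)
  · filter_upwards [hXz Q u hu hQ, hW'.mem_nhds (hW'0 u)] with q h1 h2 hqQ
    obtain ⟨h3, h4⟩ := hθ q h2
    refine h4.eqOn (hU.preimage (by fun_prop)) ((hXs.contDiffOn_timeSlice J q.1).of_le (by simp))
      (δ := fun _ => q.2) (fun s hs => ⟨?_, hW'U h2⟩) h0 h3
    rw [h1 hqQ s hs]
    exact hasDerivWithinAt_const _ _ _

end CanonicalGermIsotopy

/-! ### Relative isotopies by slowing down the given one -/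

section RelativeGermIsotopy

theorem IsFlatContactAt.pullback {E E' : Type*} [NormedAddCommGroup E] [NormedSpace ℝ E]
    [NormedAddCommGroup E'] [NormedSpace ℝ E'] {α : E → E →L[ℝ] ℝ} {ψ : E' → E} {y : E'}
    (hα : IsFlatContactAt α (ψ y)) (hψ : ContDiffAt ℝ 2 ψ y) (hαd : DifferentiableAt ℝ α (ψ y))
    (hb : Function.Bijective (fderiv ℝ ψ y)) :
    IsFlatContactAt (fun z => (α (ψ z)).comp (fderiv ℝ ψ z)) y := by
  refine ⟨fun h => hα.1 ?_, fun v hv hvw => hb.1 ?_⟩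
  · ext w
    obtain ⟨w', rfl⟩ := hb.2 w
    exact congrArg (fun f : E' →L[ℝ] ℝ => f w') h
  · rw [map_zero]
    refine hα.2 _ hv fun w hw => ?_
    obtain ⟨w', rfl⟩ := hb.2 w
    rw [← flatD_pullback hψ hαd]
    exact hvw _ hw

/-- Composition of an isotopy with an isotopy of the pulled back forms. -/
theorem IsGermIsotopy.comp_pullback {E : Type*} [NormedAddCommGroup E] [NormedSpace ℝ E]
    {W W₁ D : Set E} {α β : ℝ → E → E →L[ℝ] ℝ} {θ ψ : ℝ → E → E} (hW : IsOpen W)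
    (hW₁ : IsOpen W₁) (hWW₁ : W ⊆ W₁) (h : IsGermIsotopy W W₁ β θ)
    (hψ : ContDiffOn ℝ ∞ (fun q : ℝ × E => ψ q.1 q.2) (Icc 0 1 ×ˢ W₁))
    (hinit : ∀ x ∈ W₁, ψ 0 x = x) (hfix : ∀ t ∈ Icc (0 : ℝ) 1, ψ t 0 = 0)
    (hmaps : ∀ t ∈ Icc (0 : ℝ) 1, MapsTo (ψ t) W₁ D)
    (hinj : ∀ t ∈ Icc (0 : ℝ) 1, InjOn (ψ t) W₁)
    (hbij : ∀ t ∈ Icc (0 : ℝ) 1, ∀ x ∈ W₁, Function.Bijective (fderiv ℝ (ψ t) x))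
    (hβ : ∀ t ∈ Icc (0 : ℝ) 1, ∀ x ∈ W₁, β t x = (α t (ψ t x)).comp (fderiv ℝ (ψ t) x)) :
    IsGermIsotopy W D α (fun t x => ψ t (θ t x)) := by
  have hd : ∀ t ∈ Icc (0 : ℝ) 1, ∀ x ∈ W, fderiv ℝ (fun x => ψ t (θ t x)) x =
      (fderiv ℝ (ψ t) (θ t x)).comp (fderiv ℝ (θ t) x) := fun t ht x hx =>
    fderiv_comp x ((hψ.contDiffAt_of_Icc hW₁ ht (h.mapsTo t ht hx)).differentiableAt (by simp))
      ((h.smooth.contDiffAt_of_Icc hW ht hx).differentiableAt (by simp))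
  have h0 : (0 : ℝ) ∈ Icc (0 : ℝ) 1 := by simp
  refine ⟨?_, fun x hx => ?_, fun t ht => ?_, fun t ht x hx => hmaps t ht (h.mapsTo t ht hx),
    fun t ht x hx y hy hxy => ?_, fun t ht x hx => ?_, fun t ht x hx => ?_⟩
  · exact hψ.comp (contDiffOn_fst.prodMk h.smooth) fun q hq => ⟨hq.1, h.mapsTo q.1 hq.1 hq.2⟩
  · simp only [h.init x hx, hinit x (hWW₁ hx)]
  · simp only [h.fix t ht, hfix t ht]
  · exact h.injOn t ht hx hy (hinj t ht (h.mapsTo t ht hx) (h.mapsTo t ht hy) hxy)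
  · rw [hd t ht x hx]
    exact (hbij t ht _ (h.mapsTo t ht hx)).comp (h.bijective_fderiv t ht x hx)
  · rw [hd t ht x hx, ← ContinuousLinearMap.comp_assoc, ← hβ t ht _ (h.mapsTo t ht hx),
      h.pullback t ht x hx, hβ 0 h0 x (hWW₁ hx), hinit x (hWW₁ hx)]
    have h1 : ψ 0 =ᶠ[𝓝 x] id := by
      filter_upwards [hW₁.mem_nhds (hWW₁ hx)] with y hy using hinit y hy
    rw [h1.fderiv_eq, fderiv_id, ContinuousLinearMap.comp_id]

section Cutoff

open Classical in
/-- The isotopies `φ₀`, run up to time `χ`, and the identity off the support of `χ`. -/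
noncomputable def cutoffIsotopy {P E : Type*} [TopologicalSpace P] (χ : P → ℝ)
    (φ₀ : P → ℝ → E → E) (u : P) (t : ℝ) (x : E) : E :=
  if u ∈ tsupport χ then φ₀ u (χ u * t) x else x

/-- The domain of `cutoffIsotopy`. -/
def cutoffDomain {P E : Type*} [TopologicalSpace P] [Zero E] (χ : P → ℝ) (W W₀ : Set (P × E)) : Set (P × E) :=
  {q | q ∈ W₀ ∧ (q.1, 0) ∈ W₀} ∪ {q | q ∈ W ∧ q.1 ∉ tsupport χ}

theorem cutoffIsotopy_of_mem {P E : Type*} [TopologicalSpace P] {χ : P → ℝ}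
    {φ₀ : P → ℝ → E → E} {u : P} (hu : u ∈ tsupport χ) (t : ℝ) :
    cutoffIsotopy χ φ₀ u t = φ₀ u (χ u * t) := by
  ext x; rw [cutoffIsotopy, if_pos hu]

theorem cutoffIsotopy_of_notMem {P E : Type*} [TopologicalSpace P] {χ : P → ℝ}
    {φ₀ : P → ℝ → E → E} {u : P} (hu : u ∉ tsupport χ) (t : ℝ) :
    cutoffIsotopy χ φ₀ u t = id := by
  ext x; rw [cutoffIsotopy, if_neg hu]; rfl

theorem mul_mem_unitInterval {a t : ℝ} (ha : a ∈ Icc (0 : ℝ) 1) (ht : t ∈ Icc (0 : ℝ) 1) :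
    a * t ∈ Icc (0 : ℝ) 1 := ⟨mul_nonneg ha.1 ht.1, mul_le_one₀ ha.2 ht.1 ht.2⟩

theorem isOpen_cutoffDomain {P E : Type*} [TopologicalSpace P] [TopologicalSpace E] [Zero E]
    {χ : P → ℝ} {W W₀ : Set (P × E)} (hW : IsOpen W) (hW₀ : IsOpen W₀) : IsOpen (cutoffDomain χ W W₀) :=
  (hW₀.inter (hW₀.preimage (by fun_prop))).union
    (hW.inter ((isClosed_tsupport χ).isOpen_compl.preimage continuous_fst))

theorem slice_cutoffDomain_of_mem {P E : Type*} [TopologicalSpace P] [Zero E] {χ : P → ℝ}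
    {W W₀ : Set (P × E)} {u : P} (hu : u ∈ tsupport χ) :
    slice (cutoffDomain χ W W₀) u ⊆ slice W₀ u := by
  rintro x (hx | hx)
  exacts [hx.1, (hx.2 hu).elim]

variable {F K P E : Type*} [NormedAddCommGroup F] [NormedSpace ℝ F] [TopologicalSpace K]
  {J : ModelWithCorners ℝ F K} [TopologicalSpace P] [ChartedSpace K P] [NormedAddCommGroup E]
  [NormedSpace ℝ E] {χ : P → ℝ} {φ₀ : P → ℝ → E → E} {W W₀ : Set (P × E)}
  {α : P → ℝ → E → E →L[ℝ] ℝ}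

/-- The two formulas agree where both apply: off the support of `χ` the given isotopy is evaluated
at time zero, where it is the identity. The condition on `(u, 0)` in the domain guarantees that the
isotopy hypothesis is available there. -/
theorem contMDiffOn_cutoffIsotopy (hW : IsOpen W) (hW₀ : IsOpen W₀)
    (hχ : ContMDiff J 𝓘(ℝ, ℝ) ∞ χ) (hχI : ∀ u, χ u ∈ Icc (0 : ℝ) 1)
    (hφs : ContMDiffOn (J.prod (𝓘(ℝ, ℝ).prod 𝓘(ℝ, E))) 𝓘(ℝ, E) ∞
      (fun q : P × ℝ × E => φ₀ q.1 q.2.1 q.2.2) (timeDomain W₀))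
    (hφ : ∀ u, (u, 0) ∈ W₀ → IsGermIsotopy (slice W₀ u) (slice W u) (α u) (φ₀ u)) :
    ContMDiffOn (J.prod (𝓘(ℝ, ℝ).prod 𝓘(ℝ, E))) 𝓘(ℝ, E) ∞
      (fun q : P × ℝ × E => cutoffIsotopy χ φ₀ q.1 q.2.1 q.2.2)
      (timeDomain (cutoffDomain χ W W₀)) := by
  have hpair : ContMDiff (J.prod (𝓘(ℝ, ℝ).prod 𝓘(ℝ, E))) (J.prod (𝓘(ℝ, ℝ).prod 𝓘(ℝ, E))) ∞
      (fun q : P × ℝ × E => (q.1, χ q.1 * q.2.1, q.2.2)) :=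
    contMDiff_fst.prodMk (((hχ.comp contMDiff_fst).mul (contMDiff_fst.comp contMDiff_snd)).prodMk
      (contMDiff_snd.comp contMDiff_snd))
  refine contMDiffOn_of_locally_contMDiffOn fun q hq => ?_
  rcases hq.2 with h | h
  · refine ⟨{q | (q.1, q.2.2) ∈ W₀ ∧ (q.1, (0 : E)) ∈ W₀},
      (hW₀.preimage (by fun_prop)).inter (hW₀.preimage (by fun_prop)), h, ?_⟩
    refine (hφs.comp hpair.contMDiffOn fun q' hq' =>
      ⟨mul_mem_unitInterval (hχI _) hq'.1.1, hq'.2.1⟩).congr fun q' hq' => ?_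
    by_cases hu : q'.1 ∈ tsupport χ
    · rw [cutoffIsotopy_of_mem hu]; rfl
    · rw [cutoffIsotopy_of_notMem hu, Function.comp_apply, image_eq_zero_of_notMem_tsupport hu,
        zero_mul, (hφ q'.1 hq'.2.2).init _ hq'.2.1]
      rfl
  · refine ⟨{q | (q.1, q.2.2) ∈ W ∧ q.1 ∈ (tsupport χ)ᶜ},
      (hW.preimage (by fun_prop)).inter ((isClosed_tsupport χ).isOpen_compl.preimage
        continuous_fst), h, ?_⟩
    refine (contMDiff_snd.comp contMDiff_snd).contMDiffOn.congr fun q' hq' => ?_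
    rw [cutoffIsotopy_of_notMem hq'.2.2]
    rfl

theorem cutoffIsotopy_spec (hχI : ∀ u, χ u ∈ Icc (0 : ℝ) 1) (hχW : ∀ u ∈ tsupport χ, (u, 0) ∈ W₀)
    (hφ : ∀ u, (u, 0) ∈ W₀ → IsGermIsotopy (slice W₀ u) (slice W u) (α u) (φ₀ u))
    (u : P) :
    (∀ x ∈ slice (cutoffDomain χ W W₀) u, cutoffIsotopy χ φ₀ u 0 x = x) ∧
    ∀ t ∈ Icc (0 : ℝ) 1, cutoffIsotopy χ φ₀ u t 0 = 0 ∧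
      MapsTo (cutoffIsotopy χ φ₀ u t) (slice (cutoffDomain χ W W₀) u) (slice W u) ∧
      InjOn (cutoffIsotopy χ φ₀ u t) (slice (cutoffDomain χ W W₀) u) ∧
      ∀ x ∈ slice (cutoffDomain χ W W₀) u,
        Function.Bijective (fderiv ℝ (cutoffIsotopy χ φ₀ u t) x) := by
  by_cases hu : u ∈ tsupport χ
  · have h := hφ u (hχW u hu)
    have hs := slice_cutoffDomain_of_mem (W := W) (W₀ := W₀) hu
    refine ⟨fun x hx => ?_, fun t ht => ?_⟩
    · rw [cutoffIsotopy_of_mem hu, mul_zero, h.init x (hs hx)]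
    · have ht' := mul_mem_unitInterval (hχI u) ht
      rw [cutoffIsotopy_of_mem hu]
      exact ⟨h.fix _ ht', (h.mapsTo _ ht').mono_left hs, (h.injOn _ ht').mono hs,
        fun x hx => h.bijective_fderiv _ ht' x (hs hx)⟩
  · simp only [cutoffIsotopy_of_notMem hu, fderiv_id]
    refine ⟨fun x _ => rfl, fun t _ => ⟨rfl, ?_, injOn_id _, fun x _ => Function.bijective_id⟩⟩
    rintro x (hx | hx)
    · have := (hφ u hx.2).mapsTo 0 (by simp) hx.1
      rwa [(hφ u hx.2).init x hx.1] at this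
    · exact hx.1

/-- The kernel at the origin of the pulled back forms does not depend on time. -/
theorem ker_pullback_cutoffIsotopy (hχI : ∀ u, χ u ∈ Icc (0 : ℝ) 1) (hχW : ∀ u ∈ tsupport χ, (u, 0) ∈ W₀)
    (hφ : ∀ u, (u, 0) ∈ W₀ → IsGermIsotopy (slice W₀ u) (slice W u) (α u) (φ₀ u))
    (hker : ∀ u, ∀ t ∈ Icc (0 : ℝ) 1, (α u t 0).ker = (α u 0 0).ker)
    (u : P) {t : ℝ} (ht : t ∈ Icc (0 : ℝ) 1) :
    ((α u t (cutoffIsotopy χ φ₀ u t 0)).comp (fderiv ℝ (cutoffIsotopy χ φ₀ u t) 0)).ker =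
      (α u 0 0).ker := by
  rw [((cutoffIsotopy_spec hχI hχW hφ u).2 t ht).1]
  by_cases hu : u ∈ tsupport χ
  · have hs := mul_mem_unitInterval (hχI u) ht
    have h := (hφ u (hχW u hu)).pullback _ hs 0 (hχW u hu)
    rw [(hφ u (hχW u hu)).fix _ hs] at h
    rw [cutoffIsotopy_of_mem hu, ← h]
    -- The form is taken at time `t` but the isotopy at time `χ u * t`, where it pulls the form of
    -- that time back to the initial one. The two forms have the same kernel at the origin.
    have h1 : (α u t 0).ker = (α u (χ u * t) 0).ker := by rw [hker u t ht, hker u _ hs]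
    ext v
    have := SetLike.ext_iff.1 h1 (fderiv ℝ (φ₀ u (χ u * t)) 0 v)
    exact this
  · rw [cutoffIsotopy_of_notMem hu, fderiv_id, ContinuousLinearMap.comp_id, hker u t ht]

end Cutoff

end RelativeGermIsotopy

section RelativeGermIsotopy

universe u

variable {F : Type u} {K P : Type*} {E : Type} [NormedAddCommGroup F] [NormedSpace ℝ F]
  [FiniteDimensional ℝ F] [TopologicalSpace K] (J : ModelWithCorners ℝ F K) [TopologicalSpace P]
  [ChartedSpace K P] [IsManifold J ∞ P] [T2Space P] [SecondCountableTopology P]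
  [NormedAddCommGroup E] [NormedSpace ℝ E] [FiniteDimensional ℝ E]

/-- Correcting `ψ` by the canonical isotopy `θ` of `β = ψ^* α` gives `(ψ ∘ θ)^* α_t = θ^* β_t = β_0
= α_0`. The correction is trivial wherever `β` is already constant in time. -/
theorem exists_relative_germ_isotopy {W W₀ : Set (P × E)} {A : Set P}
    {α : P → ℝ → E → E →L[ℝ] ℝ} {φ₀ : P → ℝ → E → E} (hW : IsOpen W) (hW0 : ∀ u, (u, 0) ∈ W)
    (hα : ContMDiffOn (J.prod (𝓘(ℝ, ℝ).prod 𝓘(ℝ, E))) 𝓘(ℝ, E →L[ℝ] ℝ) ∞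
      (fun q : P × ℝ × E => α q.1 q.2.1 q.2.2) (timeDomain W))
    (hc : ∀ u, ∀ t ∈ Icc (0 : ℝ) 1, ∀ x ∈ slice W u, IsFlatContactAt (α u t) x)
    (hker : ∀ u, ∀ t ∈ Icc (0 : ℝ) 1, (α u t 0).ker = (α u 0 0).ker)
    (hA : IsClosed A) (hW₀ : IsOpen W₀) (hW₀W : W₀ ⊆ W) (hAW₀ : ∀ u ∈ A, (u, 0) ∈ W₀)
    (hφs : ContMDiffOn (J.prod (𝓘(ℝ, ℝ).prod 𝓘(ℝ, E))) 𝓘(ℝ, E) ∞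
      (fun q : P × ℝ × E => φ₀ q.1 q.2.1 q.2.2) (timeDomain W₀))
    (hφ : ∀ u, (u, 0) ∈ W₀ → IsGermIsotopy (slice W₀ u) (slice W u) (α u) (φ₀ u)) :
    ∃ (W' : Set (P × E)) (φ : P → ℝ → E → E), IsOpen W' ∧ (∀ u, (u, 0) ∈ W') ∧ W' ⊆ W ∧
      ContMDiffOn (J.prod (𝓘(ℝ, ℝ).prod 𝓘(ℝ, E))) 𝓘(ℝ, E) ∞
        (fun q : P × ℝ × E => φ q.1 q.2.1 q.2.2) (timeDomain W') ∧
      (∀ u, IsGermIsotopy (slice W' u) (slice W u) (α u) (φ u)) ∧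
      (∃ O : Set (P × E), IsOpen O ∧ (∀ u ∈ A, (u, 0) ∈ O) ∧ O ⊆ W₀ ∩ W' ∧
        ∀ q ∈ O, ∀ t ∈ Icc (0 : ℝ) 1, φ q.1 t q.2 = φ₀ q.1 t q.2) ∧
      (∀ u, (∀ᶠ x in 𝓝 0, ∀ t ∈ Icc (0 : ℝ) 1, α u t x = α u 0 x) →
        ((u, 0) ∈ W₀ → ∀ᶠ x in 𝓝 0, ∀ t ∈ Icc (0 : ℝ) 1, φ₀ u t x = x) →
        ∀ᶠ x in 𝓝 0, ∀ t ∈ Icc (0 : ℝ) 1, φ u t x = x) := by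
  have h0 : (0 : ℝ) ∈ Icc (0 : ℝ) 1 := by simp
  have hN : IsOpen {u : P | (u, (0 : E)) ∈ W₀} := hW₀.preimage (by fun_prop)
  obtain ⟨χ, hχ, ⟨N, hNo, hAN, hN1⟩, hχN, hχI⟩ := exists_smooth_cutoff J hA hN hAW₀
  have hχW : ∀ u ∈ tsupport χ, (u, (0 : E)) ∈ W₀ := fun u hu => hχN hu
  set W₁ := cutoffDomain χ W W₀ with hW₁def
  set ψ := cutoffIsotopy χ φ₀ with hψdef
  have hW₁ : IsOpen W₁ := isOpen_cutoffDomain hW hW₀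
  have hW₁0 : ∀ u, (u, (0 : E)) ∈ W₁ := fun u => by
    by_cases hu : u ∈ tsupport χ
    · exact Or.inl ⟨hχW u hu, hχW u hu⟩
    · exact Or.inr ⟨hW0 u, hu⟩
  have hW₁W : W₁ ⊆ W := by
    rintro q (hq | hq)
    exacts [hW₀W hq.1, hq.1]
  have hψs := contMDiffOn_cutoffIsotopy hW hW₀ hχ hχI hφs hφ
  rw [← hψdef, ← hW₁def] at hψs
  have hspec := cutoffIsotopy_spec hχI hχW hφ
  rw [← hψdef, ← hW₁def] at hspec
  have hsl : ∀ u, IsOpen (slice W₁ u) := fun u => hW₁.preimage (by fun_prop)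
  have hψu := fun u => hψs.contDiffOn_timeSlice J u
  have hαu := fun u => hα.contDiffOn_timeSlice J u
  have hslW : ∀ u, IsOpen (slice W u) := fun u => hW.preimage (by fun_prop)
  set β : P → ℝ → E → E →L[ℝ] ℝ :=
    fun u t x => (α u t (ψ u t x)).comp (fderiv ℝ (ψ u t) x) with hβdef
  have hβs : ContMDiffOn (J.prod (𝓘(ℝ, ℝ).prod 𝓘(ℝ, E))) 𝓘(ℝ, E →L[ℝ] ℝ) ∞
      (fun q : P × ℝ × E => β q.1 q.2.1 q.2.2) (timeDomain W₁) := by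
    have h1 : ContMDiffOn (J.prod (𝓘(ℝ, ℝ).prod 𝓘(ℝ, E))) 𝓘(ℝ, E →L[ℝ] ℝ) ∞
        (fun q : P × ℝ × E => α q.1 q.2.1 (ψ q.1 q.2.1 q.2.2)) (timeDomain W₁) :=
      hα.comp (contMDiffOn_fst.prodMk ((contMDiff_fst.comp contMDiff_snd).contMDiffOn.prodMk hψs))
        fun q hq => ⟨hq.1, ((hspec q.1).2 q.2.1 hq.1).2.1 hq.2⟩
    have h2 : ContMDiffOn (J.prod (𝓘(ℝ, ℝ).prod 𝓘(ℝ, E))) 𝓘(ℝ, E →L[ℝ] E) ∞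
        (fun q : P × ℝ × E => fderiv ℝ (ψ q.1 q.2.1) q.2.2) (timeDomain W₁) := by
      rw [timeDomain_eq_timeRestrict] at hψs ⊢
      exact hψs.fderiv_slice J (hW₁.preimage (by fun_prop))
    exact h1.clm_comp h2
  have hβc : ∀ u, ∀ t ∈ Icc (0 : ℝ) 1, ∀ x ∈ slice W₁ u, IsFlatContactAt (β u t) x := by
    intro u t ht x hx
    have hmem := ((hspec u).2 t ht).2.1 hx
    exact (hc u t ht _ hmem).pullback
      (((hψu u).contDiffAt_of_Icc (hsl u) ht hx).of_le (WithTop.coe_le_coe.2 le_top))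
      (((hαu u).contDiffAt_of_Icc (hslW u) ht hmem).differentiableAt (by simp))
      (((hspec u).2 t ht).2.2.2 x hx)
  have hβk : ∀ u, ∀ t ∈ Icc (0 : ℝ) 1, (β u t 0).ker = (β u 0 0).ker := fun u t ht =>
    (ker_pullback_cutoffIsotopy hχI hχW hφ hker u ht).trans
      (ker_pullback_cutoffIsotopy hχI hχW hφ hker u h0).symm
  have hβ0 : ∀ u, ∀ x ∈ slice W₁ u, β u 0 x = α u 0 x := fun u x hx => by
    have h1 : ψ u 0 =ᶠ[𝓝 x] id := by
      filter_upwards [(hsl u).mem_nhds hx] with y hy using (hspec u).1 y hy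
    simp only [hβdef]
    rw [(hspec u).1 x hx, h1.fderiv_eq, fderiv_id, ContinuousLinearMap.comp_id]
  obtain ⟨W', θ, hW', hW'0, hW'W₁, hθs, hθ, hθz⟩ :=
    exists_canonical_germ_isotopy J hW₁ hW₁0 hβs hβc hβk
  refine ⟨W', fun u t x => ψ u t (θ u t x), hW', hW'0, hW'W₁.trans hW₁W, ?_, fun u => ?_, ?_,
    fun u hαt hφt => ?_⟩
  · exact hψs.comp
      (contMDiffOn_fst.prodMk ((contMDiff_fst.comp contMDiff_snd).contMDiffOn.prodMk hθs))
      fun q hq => ⟨hq.1, (hθ q.1).mapsTo q.2.1 hq.1 hq.2⟩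
  · have h2 := (hspec u).2
    exact (hθ u).comp_pullback (hW'.preimage (by fun_prop)) (hsl u) (fun x hx => hW'W₁ hx) (hψu u)
      (hspec u).1 (fun t ht => (h2 t ht).1) (fun t ht => (h2 t ht).2.1)
      (fun t ht => (h2 t ht).2.2.1) (fun t ht => (h2 t ht).2.2.2) fun t ht x hx => rfl
  · have hψφ : ∀ u ∈ N, ∀ t, ψ u t = φ₀ u t := fun u hu t => by
      rw [hψdef, cutoffIsotopy_of_mem (subset_tsupport _ (by simp [hN1 u hu])), hN1 u hu, one_mul]
    refine ⟨interior {q | q ∈ W₀ ∩ W' ∧ ∀ t ∈ Icc (0 : ℝ) 1, ψ q.1 t (θ q.1 t q.2) = φ₀ q.1 t q.2},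
      isOpen_interior, fun u hu => ?_, fun q hq => (interior_subset hq).1,
      fun q hq => (interior_subset hq).2⟩
    have hNe : ∀ᶠ q : P × E in 𝓝 (u, 0), q.1 ∈ N :=
      (hNo.preimage continuous_fst).mem_nhds (hAN hu)
    have hW₀e : ∀ᶠ q : P × E in 𝓝 (u, 0), (q.1, (0 : E)) ∈ W₀ :=
      (hW₀.preimage (by fun_prop : Continuous fun q : P × E => (q.1, (0 : E)))).mem_nhds (hAW₀ u hu)
    -- Near `A` the cutoff is one, so `β_t = φ₀^* α_t = α_0` and `θ` is the identity for all nearby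
    -- parameters.
    have hz := hθz univ u (mem_univ u) (by
      filter_upwards [hNe, hW₀e, hW₀.mem_nhds (hAW₀ u hu), hW₁.mem_nhds (hW₁0 u)]
        with q h1 h2 h3 h4 _ t ht
      rw [hβ0 q.1 q.2 h4]
      simp only [hβdef]
      rw [hψφ q.1 h1, (hφ q.1 h2).pullback t ht q.2 h3])
    rw [mem_interior_iff_mem_nhds]
    filter_upwards [hz, hNe, hW₀.mem_nhds (hAW₀ u hu), hW'.mem_nhds (hW'0 u)] with q h1 h2 h3 h4
    exact ⟨⟨h3, h4⟩, fun t ht => by rw [h1 trivial t ht, hψφ q.1 h2]⟩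
  · have hψt : ∀ᶠ x in 𝓝 (0 : E), ∀ t ∈ Icc (0 : ℝ) 1, ψ u t x = x := by
      by_cases hu : u ∈ tsupport χ
      · filter_upwards [hφt (hχW u hu)] with x hx t ht
        rw [hψdef, cutoffIsotopy_of_mem hu, hx _ (mul_mem_unitInterval (hχI u) ht)]
      · exact Filter.Eventually.of_forall fun x t _ => by
          rw [hψdef, cutoffIsotopy_of_notMem hu]; rfl
    have hβt : ∀ᶠ x in 𝓝 (0 : E), ∀ t ∈ Icc (0 : ℝ) 1, β u t x = β u 0 x := by
      filter_upwards [hψt.eventually_nhds, hαt, (hsl u).mem_nhds (hW₁0 u)] with x h1 h2 h3 t ht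
      have h4 : ψ u t =ᶠ[𝓝 x] id := by
        filter_upwards [h1] with y hy using hy t ht
      rw [hβ0 u x h3, ← h2 t ht]
      simp only [hβdef]
      rw [h4.self_of_nhds, h4.fderiv_eq, fderiv_id, ContinuousLinearMap.comp_id, id]
    -- Here the forms are constant for this parameter alone, so nothing is claimed about its
    -- neighbours.
    have hz := hθz {u} u rfl (by
      have := (continuous_snd (X := P) (Y := E)).tendsto (u, 0) |>.eventually hβt
      filter_upwards [this] with q hq hqu
      obtain rfl : q.1 = u := hqu
      exact hq)
    have hz' := ((continuous_const.prodMk continuous_id : Continuous fun x : E => (u, x)).tendsto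
      0).eventually hz
    filter_upwards [hz', hψt] with x h1 h2 t ht
    rw [h1 rfl t ht, h2 t ht]

end RelativeGermIsotopy

/-! ### The statements without parameters -/

section Absolute

/-- The data are viewed as a constant family over `ℝ`, relative to the empty set, and the solution
is restricted to the parameter `0`. -/
theorem exists_lie_solution {n : ℕ} {V : Type*} [TopologicalSpace V]
    [ChartedSpace (EuclideanSpace ℝ (Fin n)) V] [IsManifold (𝓡 n) ∞ V] [T2Space V]
    [SecondCountableTopology V] {α : ℝ → (x : V) → TangentSpace (𝓡 n) x →L[ℝ] ℝ} {L : Set V}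
    (hα : SmoothFormsOn (𝓘(ℝ, ℝ).prod (𝓡 n)) (fun q : ℝ × V => q.2) (fun q => α q.1 q.2)
      (Icc 0 1 ×ˢ univ))
    (hc : ∀ t ∈ Icc (0 : ℝ) 1, IsContactForm (α t)) (hL : IsHypersurface n L)
    (htr : ∀ t ∈ Icc (0 : ℝ) 1, ∀ x ∈ L, ∀ v, IsReebVector (α t) x v → ¬ IsTangentTo L x v) :
    ∃ (U : Set V) (X : ℝ → (x : V) → TangentSpace (𝓡 n) x), IsOpen U ∧ L ⊆ U ∧
      SmoothFieldsOn (𝓘(ℝ, ℝ).prod (𝓡 n)) (fun q : ℝ × V => q.2) (fun q => X q.1 q.2)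
        (Icc 0 1 ×ˢ U) ∧
      SolvesLieEquation α X U := by
  have hL' : IsHypersurfaceFamily (n := n) 𝓘(ℝ, ℝ) {q : ℝ × V | q.2 ∈ L} := by
    rintro ⟨u, x⟩ hx
    obtain ⟨O, f, hxO, hO, hf, hreg, hmem⟩ := hL x hx
    exact ⟨{q | q.2 ∈ O}, fun q => f q.2, hxO, hO.preimage continuous_snd,
      hf.comp contMDiffOn_snd fun q hq => hq, fun q hq => hreg q.2 hq, fun q hq => hmem q.2 hq⟩
  obtain ⟨U, X, hU, hLU, hX, hXs, -⟩ := exists_relative_lie_solution (P := ℝ) 𝓘(ℝ, ℝ)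
    (α := fun _ => α) (X₀ := fun _ _ _ => 0) (A := ∅) (N := ∅)
    (ContMDiffOn.comp hα contMDiffOn_snd fun q hq => ⟨hq.1, trivial⟩) (fun _ => hc) hL'
    (fun _ => htr) isClosed_empty isOpen_empty subset_rfl (fun q hq => hq.2.elim)
    (fun u t ht x hx => hx.elim)
  exact ⟨slice U 0, X 0, hU.preimage (by fun_prop), fun x hx => hLU hx,
    ContMDiffOn.comp hX (contMDiff_const.prodMk contMDiff_id).contMDiffOn fun q hq => hq, hXs 0⟩

/-- Again a constant family over `ℝ`; the canonical isotopy suffices, as there is nothing to extend.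
-/
theorem exists_germ_isotopy {E : Type} [NormedAddCommGroup E] [NormedSpace ℝ E]
    [FiniteDimensional ℝ E] {W : Set E} {α : ℝ → E → E →L[ℝ] ℝ} (hW : IsOpen W) (hW0 : 0 ∈ W)
    (hα : ContDiffOn ℝ ∞ (fun q : ℝ × E => α q.1 q.2) (Icc 0 1 ×ˢ W))
    (hc : ∀ t ∈ Icc (0 : ℝ) 1, ∀ x ∈ W, IsFlatContactAt (α t) x)
    (hker : ∀ t ∈ Icc (0 : ℝ) 1, (α t 0).ker = (α 0 0).ker) :
    ∃ (W' : Set E) (φ : ℝ → E → E), IsOpen W' ∧ 0 ∈ W' ∧ W' ⊆ W ∧ IsGermIsotopy W' W α φ := by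
  have h1 : ContMDiff (𝓘(ℝ, ℝ).prod (𝓘(ℝ, ℝ).prod 𝓘(ℝ, E))) 𝓘(ℝ, ℝ × E) ∞
      (fun q : ℝ × ℝ × E => q.2) := by
    rw [modelWithCornersSelf_prod, ← chartedSpaceSelf_prod]
    exact contMDiff_snd
  obtain ⟨W', θ, hW', hW'0, hW'W, -, hθ, -⟩ := exists_canonical_germ_isotopy (P := ℝ) 𝓘(ℝ, ℝ)
    (W := {q | q.2 ∈ W}) (β := fun _ => α) (hW.preimage continuous_snd) (fun _ => hW0)
    (hα.contMDiffOn.comp h1.contMDiffOn fun q hq => hq) (fun _ => hc) (fun _ => hker)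
  exact ⟨slice W' 0, θ 0, hW'.preimage (by fun_prop), hW'0 0, fun x hx => hW'W hx, hθ 0⟩

end Absolute

theorem mainTheorem12
    {n : ℕ} {V : Type*} [TopologicalSpace V] [ChartedSpace (EuclideanSpace ℝ (Fin n)) V]
    [IsManifold (𝓡 n) ∞ V] [T2Space V] [SecondCountableTopology V]
    {F K P : Type*} [NormedAddCommGroup F] [NormedSpace ℝ F] [FiniteDimensional ℝ F]
    [TopologicalSpace K] (J : ModelWithCorners ℝ F K) [TopologicalSpace P] [ChartedSpace K P]
    [IsManifold J ∞ P] [T2Space P] [SecondCountableTopology P] (p : ℕ) :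
    -- 1) the equation near a hypersurface
    (∀ (α : ℝ → (x : V) → TangentSpace (𝓡 n) x →L[ℝ] ℝ) (L : Set V),
      SmoothFormsOn (𝓘(ℝ, ℝ).prod (𝓡 n)) (fun q : ℝ × V => q.2) (fun q => α q.1 q.2)
        (Icc 0 1 ×ˢ univ) →
      (∀ t ∈ Icc (0 : ℝ) 1, IsContactForm (α t)) →
      IsHypersurface n L →
      (∀ t ∈ Icc (0 : ℝ) 1, ∀ x ∈ L, ∀ v, IsReebVector (α t) x v → ¬ IsTangentTo L x v) →
      ∃ (U : Set V) (X : ℝ → (x : V) → TangentSpace (𝓡 n) x), IsOpen U ∧ L ⊆ U ∧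
        SmoothFieldsOn (𝓘(ℝ, ℝ).prod (𝓡 n)) (fun q : ℝ × V => q.2) (fun q => X q.1 q.2)
          (Icc 0 1 ×ˢ U) ∧
        SolvesLieEquation α X U) ∧
    -- 2) isotopy of germs at the origin
    (∀ (W : Set (EuclideanSpace ℝ (Fin (2 * p + 1))))
      (α : ℝ → EuclideanSpace ℝ (Fin (2 * p + 1)) →
        EuclideanSpace ℝ (Fin (2 * p + 1)) →L[ℝ] ℝ),
      IsOpen W → 0 ∈ W →
      ContDiffOn ℝ ∞ (fun q : ℝ × EuclideanSpace ℝ (Fin (2 * p + 1)) => α q.1 q.2)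
        (Icc 0 1 ×ˢ W) →
      (∀ t ∈ Icc (0 : ℝ) 1, ∀ x ∈ W, IsFlatContactAt (α t) x) →
      (∀ t ∈ Icc (0 : ℝ) 1, (α t 0).ker = (α 0 0).ker) →
      ∃ (W' : Set (EuclideanSpace ℝ (Fin (2 * p + 1))))
        (φ : ℝ → EuclideanSpace ℝ (Fin (2 * p + 1)) → EuclideanSpace ℝ (Fin (2 * p + 1))),
        IsOpen W' ∧ 0 ∈ W' ∧ W' ⊆ W ∧ IsGermIsotopy W' W α φ) ∧
    -- 3) relative version with parameters of 1)
    (∀ (α : P → ℝ → (x : V) → TangentSpace (𝓡 n) x →L[ℝ] ℝ) (L : Set (P × V))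
      (A N : Set (P × V)) (X₀ : P → ℝ → (x : V) → TangentSpace (𝓡 n) x),
      SmoothFormsOn (J.prod (𝓘(ℝ, ℝ).prod (𝓡 n))) (fun q : P × ℝ × V => q.2.2)
        (fun q => α q.1 q.2.1 q.2.2) (timeDomain univ) →
      (∀ u, ∀ t ∈ Icc (0 : ℝ) 1, IsContactForm (α u t)) →
      IsHypersurfaceFamily (n := n) J L →
      (∀ u, ∀ t ∈ Icc (0 : ℝ) 1, ∀ x ∈ slice L u, ∀ v, IsReebVector (α u t) x v →
        ¬ IsTangentTo (slice L u) x v) →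
      IsClosed A → IsOpen N → A ⊆ N →
      SmoothFieldsOn (J.prod (𝓘(ℝ, ℝ).prod (𝓡 n))) (fun q : P × ℝ × V => q.2.2)
        (fun q => X₀ q.1 q.2.1 q.2.2) (timeDomain N) →
      (∀ u, SolvesLieEquation (α u) (X₀ u) (slice N u)) →
      ∃ (U : Set (P × V)) (X : P → ℝ → (x : V) → TangentSpace (𝓡 n) x), IsOpen U ∧ L ⊆ U ∧
        SmoothFieldsOn (J.prod (𝓘(ℝ, ℝ).prod (𝓡 n))) (fun q : P × ℝ × V => q.2.2)
          (fun q => X q.1 q.2.1 q.2.2) (timeDomain U) ∧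
        (∀ u, SolvesLieEquation (α u) (X u) (slice U u)) ∧
        (∃ O : Set (P × V), IsOpen O ∧ A ∩ U ⊆ O ∧ O ⊆ N ∩ U ∧
          ∀ q ∈ O, ∀ t ∈ Icc (0 : ℝ) 1, X q.1 t q.2 = X₀ q.1 t q.2) ∧
        (∀ u, (∀ t ∈ Icc (0 : ℝ) 1, α u t = α u 0) →
          (∀ t ∈ Icc (0 : ℝ) 1, ∀ x ∈ slice N u, X₀ u t x = 0) →
          ∀ t ∈ Icc (0 : ℝ) 1, ∀ x ∈ slice U u, X u t x = 0)) ∧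
    -- 3) relative version with parameters of 2)
    (∀ (W W₀ : Set (P × EuclideanSpace ℝ (Fin (2 * p + 1)))) (A : Set P)
      (α : P → ℝ → EuclideanSpace ℝ (Fin (2 * p + 1)) →
        EuclideanSpace ℝ (Fin (2 * p + 1)) →L[ℝ] ℝ)
      (φ₀ : P → ℝ → EuclideanSpace ℝ (Fin (2 * p + 1)) → EuclideanSpace ℝ (Fin (2 * p + 1))),
      IsOpen W → (∀ u, (u, 0) ∈ W) →
      ContMDiffOn (J.prod (𝓘(ℝ, ℝ).prod 𝓘(ℝ, EuclideanSpace ℝ (Fin (2 * p + 1)))))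
        𝓘(ℝ, EuclideanSpace ℝ (Fin (2 * p + 1)) →L[ℝ] ℝ) ∞
        (fun q : P × ℝ × EuclideanSpace ℝ (Fin (2 * p + 1)) => α q.1 q.2.1 q.2.2)
        (timeDomain W) →
      (∀ u, ∀ t ∈ Icc (0 : ℝ) 1, ∀ x ∈ slice W u, IsFlatContactAt (α u t) x) →
      (∀ u, ∀ t ∈ Icc (0 : ℝ) 1, (α u t 0).ker = (α u 0 0).ker) →
      IsClosed A → IsOpen W₀ → W₀ ⊆ W → (∀ u ∈ A, (u, 0) ∈ W₀) →
      ContMDiffOn (J.prod (𝓘(ℝ, ℝ).prod 𝓘(ℝ, EuclideanSpace ℝ (Fin (2 * p + 1)))))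
        𝓘(ℝ, EuclideanSpace ℝ (Fin (2 * p + 1))) ∞
        (fun q : P × ℝ × EuclideanSpace ℝ (Fin (2 * p + 1)) => φ₀ q.1 q.2.1 q.2.2)
        (timeDomain W₀) →
      (∀ u, (u, 0) ∈ W₀ → IsGermIsotopy (slice W₀ u) (slice W u) (α u) (φ₀ u)) →
      ∃ (W' : Set (P × EuclideanSpace ℝ (Fin (2 * p + 1))))
        (φ : P → ℝ → EuclideanSpace ℝ (Fin (2 * p + 1)) → EuclideanSpace ℝ (Fin (2 * p + 1))),
        IsOpen W' ∧ (∀ u, (u, 0) ∈ W') ∧ W' ⊆ W ∧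
        ContMDiffOn (J.prod (𝓘(ℝ, ℝ).prod 𝓘(ℝ, EuclideanSpace ℝ (Fin (2 * p + 1)))))
          𝓘(ℝ, EuclideanSpace ℝ (Fin (2 * p + 1))) ∞
          (fun q : P × ℝ × EuclideanSpace ℝ (Fin (2 * p + 1)) => φ q.1 q.2.1 q.2.2)
          (timeDomain W') ∧
        (∀ u, IsGermIsotopy (slice W' u) (slice W u) (α u) (φ u)) ∧
        (∃ O : Set (P × EuclideanSpace ℝ (Fin (2 * p + 1))), IsOpen O ∧
          (∀ u ∈ A, (u, 0) ∈ O) ∧ O ⊆ W₀ ∩ W' ∧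
          ∀ q ∈ O, ∀ t ∈ Icc (0 : ℝ) 1, φ q.1 t q.2 = φ₀ q.1 t q.2) ∧
        (∀ u, (∀ᶠ x in 𝓝 0, ∀ t ∈ Icc (0 : ℝ) 1, α u t x = α u 0 x) →
          ((u, 0) ∈ W₀ → ∀ᶠ x in 𝓝 0, ∀ t ∈ Icc (0 : ℝ) 1, φ₀ u t x = x) →
          ∀ᶠ x in 𝓝 0, ∀ t ∈ Icc (0 : ℝ) 1, φ u t x = x)) := by
  refine ⟨fun α L hα hc hL htr => exists_lie_solution hα hc hL htr,
    fun W α hW hW0 hα hc hker => exists_germ_isotopy hW hW0 hα hc hker,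
    fun α L A N X₀ hα hc hL htr hA hN hAN hX₀ hX₀s =>
      exists_relative_lie_solution J hα hc hL htr hA hN hAN hX₀ hX₀s,
    fun W W₀ A α φ₀ hW hW0 hα hc hker hA hW₀ hW₀W hAW₀ hφs hφ =>
      exists_relative_germ_isotopy J hW hW0 hα hc hker hA hW₀ hW₀W hAW₀ hφs hφ⟩
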